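/- **Model.** Let $L,K\ge 1$, $\mathcal L=\{1,\dots,L\}$, $\mathcal K=\{1,\dots,K\}$, and let $\mathcal X_l$ ($l\in\mathcal L$), $\mathcal Y_k$ ($k\in\mathcal K$) be finite alphabets. A discrete memoryless cloud radio access network consists of a memoryless channel $p(y_{\mathcal K}|x_{\mathcal L})$ from $L$ users to $K$ relays, and of error-free links of capacities $C_k\ge 0$ from the relays to a central processor. Write $[1:a]$ for the set of integers $j$ with $1\le j\le a$. For nonnegative rates $R_1,\dots,R_L$, an $(n,R_1,\dots,R_L)$ code with oblivious relays and enabled time-sharing consists of - a finite alphabet $\mathcal Q$, a pmf $p_Q$ on $\mathcal Q$, and conditional pmfs $p_{X_l|Q}$, $l\in\mathcal L$; - encoding functions $\phi_l:[1:|\mathcal X_l|^{nN_l}]\times[1:2^{nR_l}]\times\mathcal Q^n\to\mathcal X_l^n$, where $N_l$ is the number of elements of $[1:2^{nR_l}]$, such that for every $q^n$ the map $f\mapsto(\phi_l(f,m,q^n))_m$ is a bijection onto the set of all codebooks $(\mathcal X_l^n)^{N_l}$; - relaying functions $\phi^r_k:\mathcal Y_k^n\times\mathcal Q^n\to[1:2^{nC_k}]$,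 $k\in\mathcal K$; - a decoding function $g$ mapping $(F_1,\dots,F_L,J_1,\dots,J_K,Q^n)$ to message estimates $(\hat M_1,\dots,\hat M_L)$. Here $Q^n$ is i.i.d. with pmf $p_Q$. The messages $M_l$ are independent, uniform on $[1:2^{nR_l}]$, and independent of $Q^n$ and of the codebook indices. Given $Q^n=q^n$, the codebook indices $F_l$ are independent with $$p(f_l|q^n)=\prod_{m}\prod_{i=1}^n p_{X_l|Q}\big(\phi_{l}(f_l,m,q^n)_i\,\big|\,q_i\big).$$ User $l$ sends $X_l^n=\phi_l(F_l,M_l,Q^n)$ over the channel, and relay $k$ forwards $J_k=\phi^r_k(Y_k^n,Q^n)$. A tuple $(R_1,\dots,R_L)$ of nonnegative rates is achievable if for every $\epsilon>0$ and all sufficiently large $n$ there is an $(n,R_1,\dots,R_L)$ code with $\Pr\{(\hat M_1,\dots,\hat M_L)\ne(M_1,\dots,M_L)\}\le\epsilon$. The capacity region $\mathcal C(C_{\mathcal K})$ is the closure of the set of achievable rate tuples. **Theorem.** Suppose that the relay outputs are conditionally independent given the users' inputs, i.e. $p(y_{\mathcal K}|x_{\mathcal L})=\prod_{k=1}^K p(y_k|x_{\mathcal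 L})$. Then $\mathcal C(C_{\mathcal K})$ is the set of all nonnegative rate tuples $(R_1,\dots,R_L)$ for which there exist finite-alphabet random variables $Q$ and $U_1,\dots,U_K$ and a joint pmf of the form $$p(q)\prod_{l=1}^L p(x_l|q)\prod_{k=1}^K p(y_k|x_{\mathcal L})\prod_{k=1}^K p(u_k|y_k,q),$$ where the $p(y_k|x_{\mathcal L})$ are those of the channel, such that for all non-empty $\mathcal T\subseteq\mathcal L$ and all $\mathcal S\subseteq\mathcal K$ $$\sum_{t\in\mathcal T}R_t\le\sum_{s\in\mathcal S}\big[C_s-I(Y_s;U_s|X_{\mathcal L},Q)\big]+I(X_{\mathcal T};U_{\mathcal S^c}|X_{\mathcal T^c},Q),$$ with mutual informations in bits. -/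

import Mathlib

open scoped BigOperators

noncomputable section

namespace CRAN

/-! ## Information measures on a finite probability space

Probability mass functions on a finite set are elements of `stdSimplex ℝ Ω`; random variables are
functions on `Ω`. -/

/-- `prEq p A ω` is the probability, under the pmf `p`, that the random variable `A` takes the value
`A ω`. -/
def prEq {Ω α : Type*} [Fintype Ω] (p : Ω → ℝ) (A : Ω → α) (ω : Ω) : ℝ :=
  open Classical in ∑ ω', if A ω' = A ω then p ω' else 0

/-- The conditional mutual information `I(A; B | C)` in bits, i.e. the expectation of
`log₂ (p(a,b,c) p(c) / (p(a,c) p(b,c)))`. Points of probability zero contribute zero. -/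
def condMI {Ω α β γ : Type*} [Fintype Ω] (p : Ω → ℝ) (A : Ω → α) (B : Ω → β) (C : Ω → γ) : ℝ :=
  ∑ ω, p ω * Real.logb 2
    (prEq p (fun ω => (A ω, B ω, C ω)) ω * prEq p C ω /
      (prEq p (fun ω => (A ω, C ω)) ω * prEq p (fun ω => (B ω, C ω)) ω))

/-! ## The channel -/

variable {L K : ℕ} {X : Fin L → Type*} {Y : Fin K → Type*}

/-- A discrete memoryless channel, given by its single-letter law: `W x y = p(y_𝒦 | x_ℒ)`. -/
def IsChannel [∀ k, Fintype (Y k)] (W : (∀ l, X l) → (∀ k, Y k) → ℝ) : Prop :=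
  ∀ x, W x ∈ stdSimplex ℝ (∀ k, Y k)

/-- The law `p(y_k | x_ℒ)` of the output at relay `k`. -/
def marginal [∀ k, Fintype (Y k)] (W : (∀ l, X l) → (∀ k, Y k) → ℝ)
    (k : Fin K) (x : ∀ l, X l) (b : Y k) : ℝ :=
  open Classical in ∑ y, if y k = b then W x y else 0

/-- The relay outputs are conditionally independent given the users' inputs. -/
def CondIndepOutputs [∀ k, Fintype (Y k)] (W : (∀ l, X l) → (∀ k, Y k) → ℝ) : Prop :=
  ∀ x y, W x y = ∏ k, marginal W k x (y k)

/-! ## Codes with oblivious relays and enabled time-sharing -/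

/-- The number of integers in `[1 : 2 ^ (n r)]`. -/
def numIdx (n : ℕ) (r : ℝ) : ℕ := ⌊(2 : ℝ) ^ ((n : ℝ) * r)⌋₊

/-- A code of block length `n` and rates `R` for fronthaul capacities `C`. -/
structure Code (X : Fin L → Type*) [∀ l, Fintype (X l)] (Y : Fin K → Type*)
    (C : Fin K → ℝ) (n : ℕ) (R : Fin L → ℝ) where
  /-- the size of the time-sharing alphabet -/
  nQ : ℕ
  /-- the time-sharing pmf `p(q)` -/
  pQ : Fin nQ → ℝ
  pQ_mem : pQ ∈ stdSimplex ℝ (Fin nQ)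
  /-- the single-letter input pmfs `p(x_l | q)` -/
  pX : ∀ l, Fin nQ → X l → ℝ
  pX_mem : ∀ l q, pX l q ∈ stdSimplex ℝ (X l)
  /-- the encoding functions: codebook index, message, time-sharing sequence to channel input -/
  enc : ∀ l, Fin (Fintype.card (X l) ^ (n * numIdx n (R l))) → Fin (numIdx n (R l)) →
    (Fin n → Fin nQ) → (Fin n → X l)
  /-- the codebook index runs over all possible codebooks (each of them exactly once) -/
  enc_bijective : ∀ l q, Function.Bijective fun f m => enc l f m q
  /-- the relaying functions, which do not see the codebook indices -/
  relay : ∀ k, (Fin n → Y k) → (Fin n → Fin nQ) → Fin (numIdx n (C k))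
  /-- the decoding function, which sees the codebook indices -/
  dec : (∀ l, Fin (Fintype.card (X l) ^ (n * numIdx n (R l)))) → (∀ k, Fin (numIdx n (C k))) →
    (Fin n → Fin nQ) → ∀ l, Fin (numIdx n (R l))

namespace Code

variable [∀ l, Fintype (X l)] {C : Fin K → ℝ} {n : ℕ} {R : Fin L → ℝ}

/-- The probability that user `l` selects the codebook with index `f`, given the time-sharing
sequence `q`: the product over all messages of the probability of the codeword. -/
def idxProb (c : Code X Y C n R) (l : Fin L)
    (f : Fin (Fintype.card (X l) ^ (n * numIdx n (R l)))) (q : Fin n → Fin c.nQ) : ℝ :=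
  ∏ m, ∏ i, c.pX l (q i) (c.enc l f m q i)

/-- The channel input of all users at time `i`. -/
def input (c : Code X Y C n R) (f : ∀ l, Fin (Fintype.card (X l) ^ (n * numIdx n (R l))))
    (m : ∀ l, Fin (numIdx n (R l))) (q : Fin n → Fin c.nQ) (i : Fin n) : ∀ l, X l :=
  fun l => c.enc l (f l) (m l) q i

/-- The messages decoded by the central processor when the relays observe `y`. -/
def output (c : Code X Y C n R) (f : ∀ l, Fin (Fintype.card (X l) ^ (n * numIdx n (R l))))
    (y : Fin n → ∀ k, Y k) (q : Fin n → Fin c.nQ) : ∀ l, Fin (numIdx n (R l)) :=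
  c.dec f (fun k => c.relay k (fun i => y i k) q) q

/-- The probability of decoding error, over the time-sharing sequence, the independently selected
codebook indices, the independent uniform messages and the memoryless channel. -/
def errorProb [∀ k, Fintype (Y k)] (c : Code X Y C n R) (W : (∀ l, X l) → (∀ k, Y k) → ℝ) : ℝ :=
  ∑ q : Fin n → Fin c.nQ, ∑ f : ∀ l, Fin (Fintype.card (X l) ^ (n * numIdx n (R l))),
    ∑ m : ∀ l, Fin (numIdx n (R l)), ∑ y : Fin n → ∀ k, Y k,
      (∏ i, c.pQ (q i)) * (∏ l, c.idxProb l (f l) q) * (∏ l, (numIdx n (R l) : ℝ)⁻¹) *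
        (∏ i, W (c.input f m q i) (y i)) * (if c.output f y q = m then 0 else 1)

end Code

/-- The rate tuple `R` is achievable: for every `ε > 0` there are codes of all sufficiently large
block lengths with error probability at most `ε`. -/
def Achievable [∀ l, Fintype (X l)] [∀ k, Fintype (Y k)]
    (W : (∀ l, X l) → (∀ k, Y k) → ℝ) (C : Fin K → ℝ) (R : Fin L → ℝ) : Prop :=
  (∀ l, 0 ≤ R l) ∧
    ∀ ε : ℝ, 0 < ε → ∃ N : ℕ, ∀ n ≥ N, ∃ c : Code X Y C n R, c.errorProb W ≤ ε

/-- The capacity region: the closure of the set of achievable rate tuples. -/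
def capacityRegion [∀ l, Fintype (X l)] [∀ k, Fintype (Y k)]
    (W : (∀ l, X l) → (∀ k, Y k) → ℝ) (C : Fin K → ℝ) : Set (Fin L → ℝ) :=
  closure {R | Achievable W C R}

/-! ## The single-letter region -/

/-- The auxiliary data of a single-letter law: finite alphabets for `Q` and the `U_k`, and the pmfs
`p(q)`, `p(x_l | q)` and `p(u_k | y_k, q)`. -/
structure TestLaw (X : Fin L → Type*) [∀ l, Fintype (X l)] (Y : Fin K → Type*) where
  nQ : ℕ
  nU : Fin K → ℕ
  pQ : Fin nQ → ℝ
  pQ_mem : pQ ∈ stdSimplex ℝ (Fin nQ)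
  pX : ∀ l, Fin nQ → X l → ℝ
  pX_mem : ∀ l q, pX l q ∈ stdSimplex ℝ (X l)
  pU : ∀ k, Y k → Fin nQ → Fin (nU k) → ℝ
  pU_mem : ∀ k b q, pU k b q ∈ stdSimplex ℝ (Fin (nU k))

namespace TestLaw

variable [∀ l, Fintype (X l)]

/-- The values `(q, x_ℒ, y_𝒦, u_𝒦)` of `(Q, X_ℒ, Y_𝒦, U_𝒦)`. -/
abbrev Outcome (P : TestLaw X Y) : Type _ :=
  Fin P.nQ × (∀ l, X l) × (∀ k, Y k) × (∀ k, Fin (P.nU k))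

/-- The random variable `Q`. -/
def rvQ (P : TestLaw X Y) (ω : P.Outcome) : Fin P.nQ := ω.1

/-- The random variables `X_ℒ`. -/
def rvX (P : TestLaw X Y) (ω : P.Outcome) : ∀ l, X l := ω.2.1

/-- The random variables `Y_𝒦`. -/
def rvY (P : TestLaw X Y) (ω : P.Outcome) : ∀ k, Y k := ω.2.2.1

/-- The random variables `U_𝒦`. -/
def rvU (P : TestLaw X Y) (ω : P.Outcome) : ∀ k, Fin (P.nU k) := ω.2.2.2

variable [∀ k, Fintype (Y k)]

/-- The joint pmf `p(q) ∏ p(x_l | q) ∏ p(y_k | x_ℒ) ∏ p(u_k | y_k, q)`. -/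
def joint (P : TestLaw X Y) (W : (∀ l, X l) → (∀ k, Y k) → ℝ) (ω : P.Outcome) : ℝ :=
  P.pQ (P.rvQ ω) * (∏ l, P.pX l (P.rvQ ω) (P.rvX ω l)) *
    (∏ k, marginal W k (P.rvX ω) (P.rvY ω k)) *
    (∏ k, P.pU k (P.rvY ω k) (P.rvQ ω) (P.rvU ω k))

/-- `I(Y_s; U_s | X_ℒ, Q)`. -/
def relayInfo (P : TestLaw X Y) (W : (∀ l, X l) → (∀ k, Y k) → ℝ) (s : Fin K) : ℝ :=
  condMI (P.joint W) (fun ω => P.rvY ω s) (fun ω => P.rvU ω s) (fun ω => (P.rvX ω, P.rvQ ω))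

/-- `I(X_T; U_{Sᶜ} | X_{Tᶜ}, Q)`. -/
def userInfo (P : TestLaw X Y) (W : (∀ l, X l) → (∀ k, Y k) → ℝ)
    (T : Finset (Fin L)) (S : Finset (Fin K)) : ℝ :=
  condMI (P.joint W) (fun ω => T.restrict (P.rvX ω)) (fun ω => Sᶜ.restrict (P.rvU ω))
    (fun ω => (Tᶜ.restrict (P.rvX ω), P.rvQ ω))

end TestLaw

/-- The nonnegative rate tuples satisfying all the single-letter bounds for some joint law. -/
def singleLetterRegion [∀ l, Fintype (X l)] [∀ k, Fintype (Y k)]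
    (W : (∀ l, X l) → (∀ k, Y k) → ℝ) (C : Fin K → ℝ) : Set (Fin L → ℝ) :=
  {R | (∀ l, 0 ≤ R l) ∧ ∃ P : TestLaw X Y,
    ∀ T : Finset (Fin L), T.Nonempty → ∀ S : Finset (Fin K),
      ∑ t ∈ T, R t ≤ ∑ s ∈ S, (C s - P.relayInfo W s) + P.userInfo W T S}

end CRAN

end

noncomputable section

namespace CRAN

/-! ## Finite product sums -/

section ProductSums

variable {ι : Type*} [Fintype ι]

/-! Write `J_k` for the index sent by relay `k`. Because of the Markov structure of the
single-letter law, the right-hand side of each bound is the average over `Q` of one expected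
log-likelihood ratio: `∑_{s∈S} C_s + E log [∏_k p(u_k|x) / (∏_{s∈S} p(u_s|y_s) · p(u_{Sᶜ}|x_{Tᶜ}))]`
(`rateFun`, `TestLaw.bound_eq`). Both halves of the proof work with this form.

Direct part. The decoder knows the codebook indices, so the model already supplies random codebooks;
only the relays must be constructed. Relay `k` hashes the sequences `u_k` at random: a sequence
survives with probability `1/(G_k+1)` and falls into one of `N_k` bins. The relay draws a survivor
with weight proportional to `p(u_k|y_k)`, truncated at a threshold `τ_k`, and sends its bin. If `G_k
τ_k` is small, Chebyshev's inequality shows that about the expected mass survives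
(`sum_hash_bad_le`). The quantizer is then at most `2(G_k+1)` times the test channel restricted to
survivors, and the factor `G_k+1` cancels on averaging over the hashing. The decoder accepts any
messages that are typical together with some survivors in the received bins. Confusing the messages
in `T` together with the sequences of the relays in `S` costs `∏_{k∈S} (N_k(G_k+1))⁻¹` and a change
of measure (`confusionMass_le`). `exists_oneShot` collects these terms; Chernoff bounds make them
decay exponentially when the rate bounds hold with slack.

Converse. Relays do not see the codebooks, and averaging over the codebooks makes the channel inputs
memoryless given the time-sharing sequence. Fano's inequality therefore bounds `∑_{t∈T} log M_t`, up
to small terms, by `∑_{s∈S} log N_s + H(J_{Sᶜ}|X_{Tᶜ}^n) - H(J_𝒦|X^n)` (`oneShot_converse_subset`).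
To single-letterize, take `U_k = J_k` and let `Q` consist of a uniform time `i`, the time-sharing
sequence and all inputs at times other than `i`. Independence over time gives `I(X_T^n;
J_{Sᶜ}|X_{Tᶜ}^n) ≤ ∑_i I(X_{T,i}; J_{Sᶜ}|all other inputs)` and `∑_i I(Y_{s,i}; J_s|X^n) ≤
H(J_s|X^n)`, while conditional independence of the outputs splits `H(J_𝒦|X^n)` over the relays.
Together these give `multiLetter_le`.

Passage to the limit. The alphabets obtained this way grow with `n`. Rescaling the columns of a test
channel changes the bounds linearly, so Carathéodory's theorem replaces every `U_k` by one of
bounded size. For bounded alphabets the vectors of bounds form a compact set, and time-sharing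
replaces it by its convex hull, which is again compact. Hence the vanishing slack can be removed
(`mem_singleLetterRegion_of_approx`). -/

/-- Push a product weight forward along a coordinatewise map. -/
theorem sum_prod_mul_comp [DecidableEq ι] {α β : ι → Type*} [∀ i, Fintype (α i)]
    [∀ i, Fintype (β i)] [∀ i, DecidableEq (β i)] (g : ∀ i, α i → ℝ) (φ : ∀ i, α i → β i)
    (F : (∀ i, β i) → ℝ) :
    ∑ a : ∀ i, α i, (∏ i, g i (a i)) * F (fun i => φ i (a i)) =
      ∑ b : ∀ i, β i, (∏ i, ∑ a, if φ i a = b i then g i a else 0) * F b := by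
  simp_rw [Fintype.prod_sum, Finset.sum_mul]
  rw [Finset.sum_comm]
  refine Finset.sum_congr rfl fun a _ => ?_
  rw [Finset.sum_eq_single (fun i => φ i (a i))]
  · simp
  · intro b _ hb
    rw [Fintype.prod_ite_zero, if_neg, zero_mul]
    intro h
    exact hb (funext fun i => (h i).symm)
  · simp

theorem sum_prod_eq_one [DecidableEq ι] {α : ι → Type*} [∀ i, Fintype (α i)] (w : ∀ i, α i → ℝ)
    (hw : ∀ i, ∑ a, w i a = 1) : ∑ a : ∀ i, α i, ∏ i, w i (a i) = 1 := by
  rw [← Fintype.prod_sum]; simp [hw]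

/-- The marginal of a product weight on one coordinate. -/
theorem sum_prod_mul_eval_pi [DecidableEq ι] {α : ι → Type*} [∀ i, Fintype (α i)]
    (w : ∀ i, α i → ℝ) (hw : ∀ i, ∑ a, w i a = 1) (i : ι) (F : α i → ℝ) :
    ∑ c : ∀ i, α i, (∏ j, w j (c j)) * F (c i) = ∑ a, w i a * F a := by
  set g : ∀ j, α j → ℝ := Function.update (fun _ _ => 1) i F with hg
  have h1 : g i = F := Function.update_self ..
  have h2 : ∀ j, j ≠ i → g j = fun _ => 1 := fun j hj => Function.update_of_ne hj ..
  have h : ∀ c : ∀ i, α i, (∏ j, w j (c j)) * F (c i) = ∏ j, (w j (c j) * g j (c j)) := by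
    intro c
    rw [Finset.prod_mul_distrib, Finset.prod_eq_single (f := fun j => g j (c j)) i, h1]
    · intro b _ hb; rw [h2 b hb]
    · simp
  simp_rw [h]
  rw [← Fintype.prod_sum (f := fun j a => w j a * g j a), Finset.prod_eq_single i, h1]
  · intro b _ hb; simp [h2 b hb, hw]
  · simp

theorem sum_prod_mul_eval [DecidableEq ι] {α : Type*} [Fintype α] (w : ι → α → ℝ)
    (hw : ∀ i, ∑ a, w i a = 1) (i : ι) (F : α → ℝ) :
    ∑ c : ι → α, (∏ j, w j (c j)) * F (c i) = ∑ a, w i a * F a :=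
  sum_prod_mul_eval_pi w hw i F

/-- The marginal of a product weight on two different coordinates. -/
theorem sum_prod_mul_eval₂ [DecidableEq ι] {α : Type*} [Fintype α] (w : ι → α → ℝ)
    (hw : ∀ i, ∑ a, w i a = 1) {i i' : ι} (hi : i ≠ i') (F : α → α → ℝ) :
    ∑ c : ι → α, (∏ j, w j (c j)) * F (c i) (c i') = ∑ a, ∑ b, w i a * w i' b * F a b := by
  classical
  -- Fixing the value `a` of coordinate `i` by an indicator leaves a function of the single
  -- coordinate `i'`, so the summand becomes a product over coordinates.
  have h : ∀ c : ι → α, (∏ j, w j (c j)) * F (c i) (c i') =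
      ∑ a, (∏ j, (w j (c j) * if j = i then (if c j = a then 1 else 0) else 1)) * F a (c i') := by
    intro c
    simp_rw [Finset.prod_mul_distrib, Finset.prod_ite_eq' Finset.univ i]
    simp
  simp_rw [h]
  rw [Finset.sum_comm]
  refine Finset.sum_congr rfl fun a _ => ?_
  have h' : ∀ c : ι → α,
      (∏ j, (w j (c j) * if j = i then (if c j = a then 1 else 0) else 1)) * F a (c i') =
      ∏ j, (w j (c j) * (if j = i then (if c j = a then 1 else 0) else 1) *
        if j = i' then F a (c j) else 1) := by
    intro c
    rw [Finset.prod_mul_distrib (g := fun j => if j = i' then F a (c j) else 1),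
      Finset.prod_ite_eq' Finset.univ i']
    simp
  simp_rw [h']
  rw [← Fintype.prod_sum (f := fun j b => w j b * (if j = i then (if b = a then 1 else 0) else 1) *
        if j = i' then F a b else 1)]
  rw [← Finset.mul_prod_erase _ _ (Finset.mem_univ i),
    ← Finset.mul_prod_erase _ _ (Finset.mem_erase.2 ⟨hi.symm, Finset.mem_univ i'⟩),
    Finset.prod_eq_one]
  · simp [hi, hi.symm, Finset.mul_sum, mul_assoc]
  · intro j hj
    simp only [Finset.mem_erase, Finset.mem_univ, and_true] at hj
    simp [hj.1, hj.2, hw]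

/-- Resampling one coordinate of a product weight does not change expectations. -/
theorem sum_prod_mul_update [DecidableEq ι] {α : Type*} [Fintype α] (w : ι → α → ℝ)
    (i : ι) (hw : ∑ a, w i a = 1) (f : (ι → α) → ℝ) :
    ∑ x : ι → α, (∏ j, w j (x j)) * ∑ a, w i a * f (Function.update x i a) =
      ∑ x : ι → α, (∏ j, w j (x j)) * f x := by
  have key : ∑ z : (ι → α) × α, (∏ j, w j (z.1 j)) * w i z.2 * f (Function.update z.1 i z.2) =
      ∑ z : (ι → α) × α, (∏ j, w j (z.1 j)) * w i z.2 * f z.1 := by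
    -- Exchanging the coordinate `x i` with the fresh letter preserves the joint weight and
    -- interchanges the two sides.
    have hinv : Function.Involutive
        (fun z : (ι → α) × α => (Function.update z.1 i z.2, z.1 i)) := by
      rintro ⟨x, a⟩; simp
    refine Fintype.sum_equiv hinv.toPerm _ _ ?_
    rintro ⟨x, a⟩
    simp only [Function.Involutive.coe_toPerm]
    congr 1
    rw [← Finset.mul_prod_erase _ _ (Finset.mem_univ i),
      ← Finset.mul_prod_erase _ (fun j => w j (Function.update x i a j)) (Finset.mem_univ i)]
    have : ∏ j ∈ Finset.univ.erase i, w j (Function.update x i a j) =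
        ∏ j ∈ Finset.univ.erase i, w j (x j) := by
      refine Finset.prod_congr rfl fun j hj => ?_
      rw [Function.update_of_ne (Finset.ne_of_mem_erase hj)]
    rw [this]; simp; ring
  rw [Fintype.sum_prod_type, Fintype.sum_prod_type] at key
  simp_rw [Finset.mul_sum, ← mul_assoc]
  rw [key]
  refine Finset.sum_congr rfl fun x _ => ?_
  dsimp only
  rw [← Finset.sum_mul, ← Finset.mul_sum, hw, mul_one]

/-- Exchanging some of the coordinates of two independent copies does not change expectations. -/
theorem sum_prod_piecewise [DecidableEq ι] {α : ι → Type*} [∀ i, Fintype (α i)]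
    (w : ∀ i, α i → ℝ) (T : Finset ι) (f : (∀ i, α i) → (∀ i, α i) → ℝ) :
    ∑ x : ∀ i, α i, ∑ x' : ∀ i, α i, (∏ i, w i (x i)) * (∏ i, w i (x' i)) *
      f (T.piecewise x' x) (T.piecewise x x') =
    ∑ x : ∀ i, α i, ∑ x' : ∀ i, α i, (∏ i, w i (x i)) * (∏ i, w i (x' i)) * f x x' := by
  have hinv : Function.Involutive (fun z : (∀ i, α i) × (∀ i, α i) =>
      (T.piecewise z.2 z.1, T.piecewise z.1 z.2)) := by
    rintro ⟨x, x'⟩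
    ext i <;> by_cases h : i ∈ T <;> simp [h]
  rw [← Fintype.sum_prod_type', ← Fintype.sum_prod_type']
  refine Fintype.sum_equiv hinv.toPerm _ _ ?_
  rintro ⟨x, x'⟩
  simp only [Function.Involutive.coe_toPerm]
  congr 1
  rw [← Finset.prod_mul_distrib, ← Finset.prod_mul_distrib]
  refine Finset.prod_congr rfl fun i _ => ?_
  by_cases h : i ∈ T <;> simp [h, mul_comm]

/-- The average of a product over independent coordinates and times. -/
theorem sum_prod_prod_comm [DecidableEq ι] {κ : Type*} [Fintype κ] [DecidableEq κ]
    {α : κ → Type*} [∀ k, Fintype (α k)] (g : ι → (∀ k, α k) → ℝ) :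
    ∑ x : ∀ k, ι → α k, ∏ i, g i (fun k => x k i) = ∏ i, ∑ a : ∀ k, α k, g i a := by
  rw [Fintype.prod_sum]
  exact Fintype.sum_equiv (Equiv.piComm fun (k : κ) (_ : ι) => α k) _ _ fun x => rfl

/-- A weighted average over deterministic choices of a nonnegative function bounds its value at
some choice. -/
theorem exists_le_of_sum_le {α : Type*} [Fintype α] (w f : α → ℝ) (hw : ∀ a, 0 ≤ w a)
    (h1 : ∑ a, w a = 1) {B : ℝ} (hB : ∑ a, w a * f a ≤ B) : ∃ a, f a ≤ B := by
  by_contra! hc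
  have h0 : ∃ a ∈ Finset.univ, 0 < w a := by
    by_contra! h
    have : ∑ a, w a ≤ 0 := Finset.sum_nonpos h
    linarith
  obtain ⟨a, _, ha⟩ := h0
  have : ∑ a, w a * B < ∑ a, w a * f a :=
    Finset.sum_lt_sum (fun a _ => mul_le_mul_of_nonneg_left (hc a).le (hw a))
      ⟨a, Finset.mem_univ _, mul_lt_mul_of_pos_left (hc a) ha⟩
  rw [← Finset.sum_mul, h1] at this
  linarith

end ProductSums

/-! ## Conditional entropy -/

section Entropy

variable {Ω : Type*} [Fintype Ω] {α β γ δ : Type*}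

/-- The probability that `A` takes the value `a`. -/
def mass (p : Ω → ℝ) (A : Ω → α) (a : α) : ℝ :=
  open Classical in ∑ ω, if A ω = a then p ω else 0

/-- The conditional entropy `H(A | C)` in bits. -/
def condEnt (p : Ω → ℝ) (A : Ω → α) (C : Ω → γ) : ℝ :=
  -∑ ω, p ω * Real.logb 2 (mass p (fun ω => (A ω, C ω)) (A ω, C ω) / mass p C (C ω))

theorem prEq_eq_mass (p : Ω → ℝ) (A : Ω → α) (ω : Ω) : prEq p A ω = mass p A (A ω) := rfl

theorem mass_congr (p : Ω → ℝ) {A : Ω → α} {B : Ω → β} {a : α} {b : β}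
    (h : ∀ ω, A ω = a ↔ B ω = b) : mass p A a = mass p B b := by
  classical
  unfold mass
  refine Finset.sum_congr rfl fun ω _ => ?_
  by_cases h' : B ω = b
  · rw [if_pos h', if_pos ((h ω).2 h')]
  · rw [if_neg h', if_neg (fun hc => h' ((h ω).1 hc))]

theorem mass_nonneg {p : Ω → ℝ} (hp : ∀ ω, 0 ≤ p ω) (A : Ω → α) (a : α) : 0 ≤ mass p A a := by
  classical
  unfold mass
  exact Finset.sum_nonneg fun ω _ => by split_ifs <;> simp [hp]

theorem le_mass {p : Ω → ℝ} (hp : ∀ ω, 0 ≤ p ω) (A : Ω → α) (ω : Ω) : p ω ≤ mass p A (A ω) := by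
  classical
  unfold mass
  have := Finset.single_le_sum (f := fun ω' => if A ω' = A ω then p ω' else 0)
    (fun ω' _ => by split_ifs <;> simp [hp]) (Finset.mem_univ ω)
  simpa using this

theorem mass_pos {p : Ω → ℝ} (hp : ∀ ω, 0 ≤ p ω) (A : Ω → α) {ω : Ω} (h : 0 < p ω) :
    0 < mass p A (A ω) := h.trans_le (le_mass hp A ω)

theorem sum_mul_comp [Fintype α] (p : Ω → ℝ) (A : Ω → α) (f : α → ℝ) :
    ∑ ω, p ω * f (A ω) = ∑ a, mass p A a * f a := by
  classical
  simp_rw [mass, Finset.sum_mul]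
  rw [Finset.sum_comm]
  exact Finset.sum_congr rfl fun ω _ => by simp

theorem sum_mass [Fintype α] (p : Ω → ℝ) (A : Ω → α) : ∑ a, mass p A a = ∑ ω, p ω := by
  simpa using (sum_mul_comp p A fun _ => 1).symm

theorem mass_comp [Fintype α] (p : Ω → ℝ) (f : Ω → α) (A : α → β) (b : β) :
    mass p (fun ω => A (f ω)) b = mass (mass p f) A b := by
  classical
  have := sum_mul_comp p f (fun a => if A a = b then 1 else 0)
  simp only [mul_ite, mul_one, mul_zero] at this
  rw [mass, mass, ← this]

theorem sum_mass_pair [Fintype α] (p : Ω → ℝ) (A : Ω → α) (C : Ω → γ) (c : γ) :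
    ∑ a, mass p (fun ω => (A ω, C ω)) (a, c) = mass p C c := by
  classical
  simp_rw [mass]
  rw [Finset.sum_comm]
  refine Finset.sum_congr rfl fun ω _ => ?_
  by_cases h : C ω = c <;> simp [h]

theorem mass_pair_le {p : Ω → ℝ} (hp : ∀ ω, 0 ≤ p ω) (A : Ω → α) (C : Ω → γ) (a : α) (c : γ) :
    mass p (fun ω => (A ω, C ω)) (a, c) ≤ mass p C c := by
  classical
  unfold mass
  refine Finset.sum_le_sum fun ω _ => ?_
  by_cases h : C ω = c <;> by_cases h' : A ω = a <;> simp [h, h', hp]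

/-- Only the joint law of the variables matters, so an entropy may be computed on any space through
which they factor. -/
theorem condEnt_comp {Ω' : Type*} [Fintype Ω'] (p : Ω → ℝ) (f : Ω → Ω') (A : Ω' → α)
    (C : Ω' → γ) :
    condEnt p (fun ω => A (f ω)) (fun ω => C (f ω)) = condEnt (mass p f) A C := by
  unfold condEnt
  rw [← sum_mul_comp p f (fun ω' => Real.logb 2
    (mass (mass p f) (fun ω => (A ω, C ω)) (A ω', C ω') / mass (mass p f) C (C ω')))]
  simp_rw [← mass_comp]

/-- An entropy depends only on the partitions that the variables induce, and the first partition
matters only inside each cell of the conditioning one. -/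
theorem condEnt_congr (p : Ω → ℝ) {A : Ω → α} {C : Ω → γ} {A' : Ω → β} {C' : Ω → δ}
    (hC : ∀ ω ω', C ω = C ω' ↔ C' ω = C' ω')
    (hA : ∀ ω ω', C ω = C ω' → (A ω = A ω' ↔ A' ω = A' ω')) :
    condEnt p A C = condEnt p A' C' := by
  unfold condEnt
  congr 1
  refine Finset.sum_congr rfl fun ω _ => ?_
  rw [mass_congr p (B := C') (b := C' ω) (fun ω' => hC ω' ω),
    mass_congr p (B := fun ω => (A' ω, C' ω)) (b := (A' ω, C' ω)) (fun ω' => ?_)]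
  simp only [Prod.mk.injEq, ← hC ω' ω]
  constructor
  · rintro ⟨h, h'⟩; exact ⟨(hA _ _ h').1 h, h'⟩
  · rintro ⟨h, h'⟩; exact ⟨(hA _ _ h').2 h, h'⟩

/-- The conditional entropy is computed by any kernel that factorizes the joint law. -/
theorem condEnt_eq_of_kernel {p : Ω → ℝ} (hp : ∀ ω, 0 ≤ p ω) {A : Ω → α} {C : Ω → γ} (κ : Ω → ℝ)
    (h : ∀ ω, 0 < p ω → mass p (fun ω => (A ω, C ω)) (A ω, C ω) = mass p C (C ω) * κ ω) :
    condEnt p A C = -∑ ω, p ω * Real.logb 2 (κ ω) := by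
  unfold condEnt
  congr 1
  refine Finset.sum_congr rfl fun ω _ => ?_
  rcases (hp ω).eq_or_lt with h0 | h0
  · simp [← h0]
  · rw [h ω h0, mul_div_cancel_left₀ _ (mass_pos hp C h0).ne']

/-- Gibbs' inequality: the cross entropy bounds the conditional entropy. -/
theorem condEnt_le_of_kernel [Fintype α] [Fintype γ] {p : Ω → ℝ} (hp : ∀ ω, 0 ≤ p ω)
    (A : Ω → α) (C : Ω → γ) (κ : α → γ → ℝ) (hκ : ∀ a c, 0 ≤ κ a c) (hs : ∀ c, ∑ a, κ a c ≤ 1)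
    (hpos : ∀ ω, 0 < p ω → 0 < κ (A ω) (C ω)) :
    condEnt p A C ≤ -∑ ω, p ω * Real.logb 2 (κ (A ω) (C ω)) := by
  unfold condEnt
  rw [neg_le_neg_iff, ← sub_nonpos, ← Finset.sum_sub_distrib]
  have hl2 : 0 < Real.log 2 := Real.log_pos (by norm_num)
  set P := mass p (fun ω => (A ω, C ω)) with hP
  -- This is `log t ≤ t - 1` at `t = κ(a|c) p(c) / p(a,c)`. The linear terms sum to at most zero
  -- because `κ` is a subprobability kernel.
  have hpt : ∀ ω, p ω * Real.logb 2 (κ (A ω) (C ω)) - p ω * Real.logb 2 (P (A ω, C ω) / mass p C (C ω))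
      ≤ (p ω * (κ (A ω) (C ω) * mass p C (C ω) / P (A ω, C ω)) - p ω) / Real.log 2 := by
    intro ω
    rcases (hp ω).eq_or_lt with h0 | h0
    · simp [← h0]
    · have h1 := hpos ω h0
      have h2 := mass_pos hp C h0
      have h3 : 0 < P (A ω, C ω) := mass_pos hp (fun ω => (A ω, C ω)) h0
      rw [← mul_sub, ← Real.logb_div h1.ne' (div_pos h3 h2).ne', Real.logb, ← mul_div_assoc,
        div_le_div_iff_of_pos_right hl2]
      have := Real.log_le_sub_one_of_pos (x := κ (A ω) (C ω) * mass p C (C ω) / P (A ω, C ω))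
        (by positivity)
      rw [div_div_eq_mul_div]
      nlinarith
  refine (Finset.sum_le_sum fun ω _ => hpt ω).trans ?_
  rw [← Finset.sum_div, Finset.sum_sub_distrib]
  refine div_nonpos_of_nonpos_of_nonneg (sub_nonpos.2 ?_) hl2.le
  rw [sum_mul_comp p (fun ω => (A ω, C ω)) (fun z => κ z.1 z.2 * mass p C z.2 / P z),
    Fintype.sum_prod_type, Finset.sum_comm, ← sum_mass p C]
  refine Finset.sum_le_sum fun c _ => ?_
  calc ∑ a, P (a, c) * (κ a c * mass p C c / P (a, c))
      ≤ ∑ a, κ a c * mass p C c := by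
        refine Finset.sum_le_sum fun a _ => ?_
        have h1 := mul_nonneg (hκ a c) (mass_nonneg hp C c)
        rcases eq_or_ne (P (a, c)) 0 with h | h
        · simpa [h] using h1
        · rw [mul_div_cancel₀ _ h]
    _ ≤ mass p C c := by
        rw [← Finset.sum_mul]
        exact mul_le_of_le_one_left (mass_nonneg hp C c) (hs c)

theorem condEnt_nonneg {p : Ω → ℝ} (hp : ∀ ω, 0 ≤ p ω) (A : Ω → α) (C : Ω → γ) :
    0 ≤ condEnt p A C := by
  unfold condEnt
  rw [neg_nonneg]
  refine Finset.sum_nonpos fun ω _ => mul_nonpos_of_nonneg_of_nonpos (hp ω) ?_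
  exact Real.logb_nonpos (by norm_num)
    (div_nonneg (mass_nonneg hp _ _) (mass_nonneg hp _ _))
    (div_le_one_of_le₀ (mass_pair_le hp A C _ _) (mass_nonneg hp _ _))

theorem condEnt_chain {p : Ω → ℝ} (hp : ∀ ω, 0 ≤ p ω) (A : Ω → α) (B : Ω → β) (C : Ω → γ) :
    condEnt p (fun ω => (A ω, B ω)) C =
      condEnt p A C + condEnt p B (fun ω => (A ω, C ω)) := by
  unfold condEnt
  rw [← neg_add, ← Finset.sum_add_distrib]
  congr 1
  refine Finset.sum_congr rfl fun ω _ => ?_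
  rcases (hp ω).eq_or_lt with h0 | h0
  · simp [← h0]
  · have h1 := mass_pos hp C h0
    have h2 := mass_pos hp (fun ω => (A ω, C ω)) h0
    have h3 := mass_pos hp (fun ω => (B ω, A ω, C ω)) h0
    rw [← mul_add, ← Real.logb_mul (div_pos h2 h1).ne' (div_pos h3 h2).ne',
      div_mul_div_comm, mul_comm (mass p C (C ω)), mul_div_mul_left _ _ h2.ne', mass_congr p (A := fun ω => ((A ω, B ω), C ω)) (B := fun ω => (B ω, A ω, C ω))
      (b := (B ω, A ω, C ω))]
    intro ω'
    simp only [Prod.mk.injEq]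
    tauto

/-- Conditioning on more reduces the conditional entropy. -/
theorem condEnt_anti [Fintype α] [Fintype δ] {p : Ω → ℝ} (hp : ∀ ω, 0 ≤ p ω)
    (A : Ω → α) (C : Ω → γ) (D : Ω → δ) (f : δ → γ) (h : ∀ ω, C ω = f (D ω)) :
    condEnt p A D ≤ condEnt p A C := by
  -- The coarser conditional law `p(a | f d)` is an admissible kernel for the finer conditioning.
  have := condEnt_le_of_kernel hp A D
    (fun a d => mass p (fun ω => (A ω, C ω)) (a, f d) / mass p C (f d))
    (fun a d => div_nonneg (mass_nonneg hp _ _) (mass_nonneg hp _ _))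
    (fun d => by
      rw [← Finset.sum_div, sum_mass_pair]
      exact div_self_le_one _)
    (fun ω h0 => by
      rw [← h ω]
      exact div_pos (mass_pos hp (fun ω => (A ω, C ω)) h0) (mass_pos hp C h0))
  unfold condEnt at this ⊢
  simp_rw [h] at this ⊢
  exact this

/-- Gibbs' inequality against the uniform kernel. -/
theorem condEnt_le_log_card [Fintype α] [Fintype γ] {p : Ω → ℝ} (hp : p ∈ stdSimplex ℝ Ω)
    (A : Ω → α) (C : Ω → γ) : condEnt p A C ≤ Real.logb 2 (Fintype.card α) := by
  have := condEnt_le_of_kernel hp.1 A C (fun _ _ => (Fintype.card α : ℝ)⁻¹)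
    (fun _ _ => by positivity)
    (fun _ => by
      rw [Finset.sum_const, Finset.card_univ, nsmul_eq_mul]; exact mul_inv_le_one)
    (fun ω _ => by
      have : Nonempty α := ⟨A ω⟩
      have : 0 < Fintype.card α := Fintype.card_pos
      positivity)
  rw [← Finset.sum_mul, hp.2, one_mul, Real.logb_inv, neg_neg] at this
  exact this

/-- Fano's inequality. -/
theorem condEnt_le_fano [Fintype α] [Fintype γ] [DecidableEq α] {p : Ω → ℝ}
    (hp : p ∈ stdSimplex ℝ Ω) (A : Ω → α) (C : Ω → γ) (g : γ → α) :
    condEnt p A C ≤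
      1 + (∑ ω, p ω * if g (C ω) = A ω then 0 else 1) * Real.logb 2 (Fintype.card α) := by
  rcases isEmpty_or_nonempty α with hα | hα
  · have hΩ : IsEmpty Ω := ⟨fun ω => hα.elim (A ω)⟩
    have := hp.2
    simp at this
  have hN : (0 : ℝ) < Fintype.card α := by exact_mod_cast Fintype.card_pos
  -- Half of the mass sits on the guess `g c` and half is spread uniformly: a correct guess costs
  -- one bit, a wrong one `log₂ |α|` bits more.
  have := condEnt_le_of_kernel hp.1 A C
    (fun a c => if g c = a then 1 / 2 else 1 / 2 * (Fintype.card α : ℝ)⁻¹)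
    (fun _ _ => by split_ifs <;> positivity)
    (fun c => by
      calc ∑ a, (if g c = a then (1 : ℝ) / 2 else 1 / 2 * (Fintype.card α : ℝ)⁻¹)
          ≤ ∑ a, ((if g c = a then 1 / 2 else 0) + 1 / 2 * (Fintype.card α : ℝ)⁻¹) := by
            refine Finset.sum_le_sum fun a _ => ?_
            have : (0 : ℝ) ≤ 1 / 2 * (Fintype.card α : ℝ)⁻¹ := by positivity
            split_ifs <;> linarith
        _ = 1 := by
            rw [Finset.sum_add_distrib, Finset.sum_const, Finset.card_univ, nsmul_eq_mul]
            simp only [Finset.sum_ite_eq, Finset.mem_univ, if_true]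
            field_simp; norm_num)
    (fun ω _ => by split_ifs <;> positivity)
  refine this.trans (le_of_eq ?_)
  rw [Finset.sum_mul]
  have h1 : ∀ r : ℝ, 1 + r = ∑ ω, p ω + r := fun r => by rw [hp.2]
  rw [h1, ← Finset.sum_add_distrib, ← Finset.sum_neg_distrib]
  refine Finset.sum_congr rfl fun ω _ => ?_
  have h2 : Real.logb 2 (1 / 2) = -1 := by
    rw [one_div, Real.logb_inv, Real.logb_self_eq_one (by norm_num)]
  split_ifs
  · rw [h2]; ring
  · rw [Real.logb_mul (by norm_num) (by positivity), h2, Real.logb_inv]; ring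

/-- Subadditivity of conditional entropy. -/
theorem condEnt_pi_le {ι : Type*} [Fintype ι] [DecidableEq ι] {α : ι → Type*}
    [∀ i, Fintype (α i)] [Fintype γ] {p : Ω → ℝ} (hp : ∀ ω, 0 ≤ p ω) (A : Ω → ∀ i, α i)
    (C : Ω → γ) : condEnt p A C ≤ ∑ i, condEnt p (fun ω => A ω i) C := by
  -- Gibbs' inequality against the product of the conditional marginals.
  refine (condEnt_le_of_kernel hp A C
    (fun a c => ∏ i, mass p (fun ω => (A ω i, C ω)) (a i, c) / mass p C c)
    (fun a c => Finset.prod_nonneg fun i _ => div_nonneg (mass_nonneg hp _ _) (mass_nonneg hp _ _))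
    (fun c => ?_) (fun ω h0 => Finset.prod_pos fun i _ =>
      div_pos (mass_pos hp (fun ω => (A ω i, C ω)) h0) (mass_pos hp C h0))).trans (le_of_eq ?_)
  · rw [← Fintype.prod_sum (f := fun i a => mass p (fun ω => (A ω i, C ω)) (a, c) / mass p C c)]
    refine Finset.prod_le_one (fun i _ => Finset.sum_nonneg fun a _ =>
      div_nonneg (mass_nonneg hp _ _) (mass_nonneg hp _ _)) fun i _ => ?_
    rw [← Finset.sum_div, sum_mass_pair]
    exact div_self_le_one _
  · unfold condEnt
    rw [Finset.sum_neg_distrib, Finset.sum_comm]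
    congr 1
    refine Finset.sum_congr rfl fun ω _ => ?_
    rw [← Finset.mul_sum]
    rcases (hp ω).eq_or_lt with h0 | h0
    · simp [← h0]
    · rw [Real.logb_prod]
      intro i _
      exact (div_pos (mass_pos hp (fun ω => (A ω i, C ω)) h0) (mass_pos hp C h0)).ne'

/-- The likelihood ratio is requested in cross-multiplied form and only on the support, so that
vanishing masses never have to be discussed. -/
theorem condMI_eq {p : Ω → ℝ} (hp : ∀ ω, 0 ≤ p ω) (A : Ω → α) (B : Ω → β) (C : Ω → γ) (κ : Ω → ℝ)
    (h : ∀ ω, 0 < p ω → mass p (fun ω => (A ω, B ω, C ω)) (A ω, B ω, C ω) * mass p C (C ω) =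
      κ ω * (mass p (fun ω => (A ω, C ω)) (A ω, C ω) * mass p (fun ω => (B ω, C ω)) (B ω, C ω))) :
    condMI p A B C = ∑ ω, p ω * Real.logb 2 (κ ω) := by
  unfold condMI
  refine Finset.sum_congr rfl fun ω _ => ?_
  rcases (hp ω).eq_or_lt with h0 | h0
  · simp [← h0]
  · simp only [prEq_eq_mass]
    rw [h ω h0, mul_div_cancel_right₀]
    exact (mul_pos (mass_pos hp (fun ω => (A ω, C ω)) h0)
      (mass_pos hp (fun ω => (B ω, C ω)) h0)).ne'

end Entropy

/-! ## Single-letter laws without time-sharing -/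

section Law

variable {L K : ℕ} {X : Fin L → Type*} {Y : Fin K → Type*} {U : Fin K → Type*}

/-- The kernel `p(u_k | x)`. -/
def outProb [∀ k, Fintype (Y k)] (V : ∀ k, (∀ l, X l) → Y k → ℝ) (pU : ∀ k, Y k → U k → ℝ)
    (k : Fin K) (x : ∀ l, X l) (u : U k) : ℝ := ∑ b, V k x b * pU k b u

/-- The kernel `p(u_{Sᶜ} | x_{Tᶜ})`. -/
def partProb [∀ l, Fintype (X l)] [∀ k, Fintype (Y k)] (pX : ∀ l, X l → ℝ)
    (V : ∀ k, (∀ l, X l) → Y k → ℝ) (pU : ∀ k, Y k → U k → ℝ)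
    (T : Finset (Fin L)) (S : Finset (Fin K)) (x : ∀ l, X l) (u : ∀ k, U k) : ℝ :=
  ∑ x' : ∀ l, X l, (∏ l, pX l (x' l)) * ∏ k ∈ Sᶜ, outProb V pU k (T.piecewise x' x) (u k)

/-- The joint pmf of `(X, Y, U)`. -/
def lawProb (pX : ∀ l, X l → ℝ) (V : ∀ k, (∀ l, X l) → Y k → ℝ) (pU : ∀ k, Y k → U k → ℝ)
    (x : ∀ l, X l) (y : ∀ k, Y k) (u : ∀ k, U k) : ℝ :=
  (∏ l, pX l (x l)) * (∏ k, V k x (y k)) * ∏ k, pU k (y k) (u k)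

/-- The likelihood ratio whose expected logarithm is the single-letter bound. -/
def lawRatio [∀ l, Fintype (X l)] [∀ k, Fintype (Y k)] (pX : ∀ l, X l → ℝ)
    (V : ∀ k, (∀ l, X l) → Y k → ℝ) (pU : ∀ k, Y k → U k → ℝ)
    (T : Finset (Fin L)) (S : Finset (Fin K)) (x : ∀ l, X l) (y : ∀ k, Y k) (u : ∀ k, U k) : ℝ :=
  (∏ k, outProb V pU k x (u k)) / ((∏ s ∈ S, pU s (y s) (u s)) * partProb pX V pU T S x u)

/-- The right-hand side of the single-letter bound for `T` and `S`. -/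
def rateFun [∀ l, Fintype (X l)] [∀ k, Fintype (Y k)] [∀ k, Fintype (U k)] (C : Fin K → ℝ)
    (V : ∀ k, (∀ l, X l) → Y k → ℝ) (pX : ∀ l, X l → ℝ) (pU : ∀ k, Y k → U k → ℝ)
    (T : Finset (Fin L)) (S : Finset (Fin K)) : ℝ :=
  ∑ s ∈ S, C s + ∑ x, ∑ y, ∑ u, lawProb pX V pU x y u * Real.logb 2 (lawRatio pX V pU T S x y u)

/-- All kernels are probability mass functions. -/
structure IsLaw [∀ l, Fintype (X l)] [∀ k, Fintype (Y k)] [∀ k, Fintype (U k)]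
    (pX : ∀ l, X l → ℝ) (V : ∀ k, (∀ l, X l) → Y k → ℝ) (pU : ∀ k, Y k → U k → ℝ) : Prop where
  input_mem : ∀ l, pX l ∈ stdSimplex ℝ (X l)
  channel_mem : ∀ k x, V k x ∈ stdSimplex ℝ (Y k)
  test_mem : ∀ k b, pU k b ∈ stdSimplex ℝ (U k)

variable [∀ l, Fintype (X l)] [∀ k, Fintype (Y k)] [∀ k, Fintype (U k)]
  {pX : ∀ l, X l → ℝ} {V : ∀ k, (∀ l, X l) → Y k → ℝ} {pU : ∀ k, Y k → U k → ℝ}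

namespace IsLaw

theorem outProb_nonneg (h : IsLaw pX V pU) (k : Fin K) (x : ∀ l, X l) (u : U k) :
    0 ≤ outProb V pU k x u :=
  Finset.sum_nonneg fun b _ => mul_nonneg ((h.channel_mem k x).1 b) ((h.test_mem k b).1 u)

theorem sum_outProb (h : IsLaw pX V pU) (k : Fin K) (x : ∀ l, X l) :
    ∑ u, outProb V pU k x u = 1 := by
  simp_rw [outProb]
  rw [Finset.sum_comm]
  simp_rw [← Finset.mul_sum, (h.test_mem k _).2, mul_one, (h.channel_mem k x).2]

theorem input_nonneg (h : IsLaw pX V pU) (x : ∀ l, X l) : 0 ≤ ∏ l, pX l (x l) :=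
  Finset.prod_nonneg fun l _ => (h.input_mem l).1 _

theorem partProb_nonneg (h : IsLaw pX V pU) (T : Finset (Fin L)) (S : Finset (Fin K))
    (x : ∀ l, X l) (u : ∀ k, U k) : 0 ≤ partProb pX V pU T S x u :=
  Finset.sum_nonneg fun x' _ => mul_nonneg (h.input_nonneg x')
    (Finset.prod_nonneg fun k _ => h.outProb_nonneg k _ _)

theorem lawProb_nonneg (h : IsLaw pX V pU) (x : ∀ l, X l) (y : ∀ k, Y k) (u : ∀ k, U k) :
    0 ≤ lawProb pX V pU x y u :=
  mul_nonneg (mul_nonneg (h.input_nonneg x)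
    (Finset.prod_nonneg fun k _ => (h.channel_mem k x).1 _))
    (Finset.prod_nonneg fun k _ => (h.test_mem k _).1 _)

theorem test_le_outProb (h : IsLaw pX V pU) (k : Fin K) (x : ∀ l, X l) (b : Y k) (u : U k) :
    V k x b * pU k b u ≤ outProb V pU k x u :=
  Finset.single_le_sum (f := fun b => V k x b * pU k b u)
    (fun b _ => mul_nonneg ((h.channel_mem k x).1 b) ((h.test_mem k b).1 u)) (Finset.mem_univ b)

theorem test_le_one (h : IsLaw pX V pU) (k : Fin K) (b : Y k) (u : U k) : pU k b u ≤ 1 := by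
  rw [← (h.test_mem k b).2]
  exact Finset.single_le_sum (fun u _ => (h.test_mem k b).1 u) (Finset.mem_univ u)

theorem channel_le_one (h : IsLaw pX V pU) (k : Fin K) (x : ∀ l, X l) (b : Y k) : V k x b ≤ 1 := by
  rw [← (h.channel_mem k x).2]
  exact Finset.single_le_sum (fun u _ => (h.channel_mem k x).1 u) (Finset.mem_univ b)

theorem input_le_one (h : IsLaw pX V pU) (x : ∀ l, X l) : ∏ l, pX l (x l) ≤ 1 := by
  refine Finset.prod_le_one (fun l _ => (h.input_mem l).1 _) fun l _ => ?_
  rw [← (h.input_mem l).2]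
  exact Finset.single_le_sum (fun u _ => (h.input_mem l).1 u) (Finset.mem_univ _)

theorem le_partProb (h : IsLaw pX V pU) (T : Finset (Fin L)) (S : Finset (Fin K))
    (x : ∀ l, X l) (u : ∀ k, U k) :
    (∏ l, pX l (x l)) * ∏ k ∈ Sᶜ, outProb V pU k x (u k) ≤ partProb pX V pU T S x u := by
  have := Finset.single_le_sum
    (f := fun x' : ∀ l, X l => (∏ l, pX l (x' l)) *
      ∏ k ∈ Sᶜ, outProb V pU k (T.piecewise x' x) (u k))
    (fun x' _ => mul_nonneg (h.input_nonneg x')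
      (Finset.prod_nonneg fun k _ => h.outProb_nonneg k _ _)) (Finset.mem_univ x)
  have hx : T.piecewise x x = x := by
    ext l
    by_cases hl : l ∈ T <;> simp [hl]
  simp only [hx] at this
  exact this

/-- For relays in `S` the pair `(y_k, u_k)` is one term of the sum defining `p(u_k|x)`, and every
other factor is at most one. Such dominations give positivity of the kernels on the support, and
later continuity of the logarithmic terms at the boundary. -/
theorem lawProb_le_input_mul (h : IsLaw pX V pU) (S : Finset (Fin K))
    (x : ∀ l, X l) (y : ∀ k, Y k) (u : ∀ k, U k) :
    lawProb pX V pU x y u ≤ (∏ l, pX l (x l)) * ∏ k ∈ S, outProb V pU k x (u k) := by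
  rw [lawProb, mul_assoc, ← Finset.prod_mul_distrib, ← Finset.prod_mul_prod_compl S]
  refine mul_le_mul_of_nonneg_left ?_ (h.input_nonneg x)
  rw [← mul_one (∏ k ∈ S, outProb V pU k x (u k))]
  have h0 : ∀ k, 0 ≤ V k x (y k) * pU k (y k) (u k) := fun k =>
    mul_nonneg ((h.channel_mem k x).1 _) ((h.test_mem k _).1 _)
  refine mul_le_mul (Finset.prod_le_prod (fun k _ => h0 k) fun k _ => h.test_le_outProb k x _ _)
    (Finset.prod_le_one (fun k _ => h0 k) fun k _ =>
      mul_le_one₀ (h.channel_le_one k x _) ((h.test_mem k _).1 _) (h.test_le_one k _ _))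
    (Finset.prod_nonneg fun k _ => h0 k)
    (Finset.prod_nonneg fun k _ => h.outProb_nonneg k x _)

theorem lawProb_le_partProb (h : IsLaw pX V pU) (T : Finset (Fin L)) (S : Finset (Fin K))
    (x : ∀ l, X l) (y : ∀ k, Y k) (u : ∀ k, U k) :
    lawProb pX V pU x y u ≤ partProb pX V pU T S x u :=
  (h.lawProb_le_input_mul Sᶜ x y u).trans (h.le_partProb T S x u)

theorem lawProb_le_outProb (h : IsLaw pX V pU) (k : Fin K)
    (x : ∀ l, X l) (y : ∀ k, Y k) (u : ∀ k, U k) :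
    lawProb pX V pU x y u ≤ outProb V pU k x (u k) := by
  refine (h.lawProb_le_input_mul {k} x y u).trans ?_
  rw [Finset.prod_singleton]
  exact mul_le_of_le_one_left (h.outProb_nonneg _ _ _) (h.input_le_one x)

theorem lawProb_le_test (h : IsLaw pX V pU) (k : Fin K)
    (x : ∀ l, X l) (y : ∀ k, Y k) (u : ∀ k, U k) :
    lawProb pX V pU x y u ≤ pU k (y k) (u k) := by
  rw [lawProb, ← Finset.mul_prod_erase Finset.univ (fun k => pU k (y k) (u k))
    (Finset.mem_univ k), mul_left_comm]
  refine mul_le_of_le_one_right ((h.test_mem k _).1 _) ?_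
  exact mul_le_one₀ (mul_le_one₀ (h.input_le_one x)
    (Finset.prod_nonneg fun k _ => (h.channel_mem k x).1 _)
    (Finset.prod_le_one (fun k _ => (h.channel_mem k x).1 _) fun k _ => h.channel_le_one k x _))
    (Finset.prod_nonneg fun k _ => (h.test_mem k _).1 _)
    (Finset.prod_le_one (fun k _ => (h.test_mem k _).1 _) fun k _ => h.test_le_one k _ _)

/-- On the support of the law, the logarithm of the likelihood ratio splits. -/
theorem mul_logb_lawRatio (h : IsLaw pX V pU) (T : Finset (Fin L)) (S : Finset (Fin K))
    (x : ∀ l, X l) (y : ∀ k, Y k) (u : ∀ k, U k) :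
    lawProb pX V pU x y u * Real.logb 2 (lawRatio pX V pU T S x y u) =
      ∑ k, lawProb pX V pU x y u * Real.logb 2 (outProb V pU k x (u k)) -
      ∑ s ∈ S, lawProb pX V pU x y u * Real.logb 2 (pU s (y s) (u s)) -
      lawProb pX V pU x y u * Real.logb 2 (partProb pX V pU T S x u) := by
  rcases (h.lawProb_nonneg x y u).eq_or_lt with h0 | h0
  · simp [← h0]
  · have h1 : ∀ k, 0 < outProb V pU k x (u k) := fun k => h0.trans_le (h.lawProb_le_outProb k x y u)
    have h2 : ∀ k, 0 < pU k (y k) (u k) := fun k => h0.trans_le (h.lawProb_le_test k x y u)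
    have h3 := h0.trans_le (h.lawProb_le_partProb T S x y u)
    rw [lawRatio, Real.logb_div (Finset.prod_pos fun k _ => h1 k).ne'
      (mul_pos (Finset.prod_pos fun k _ => h2 k) h3).ne',
      Real.logb_mul (Finset.prod_pos fun k _ => h2 k).ne' h3.ne', Real.logb_prod _ _ fun k _ => (h1 k).ne',
      Real.logb_prod _ _ fun k _ => (h2 k).ne', ← Finset.mul_sum, ← Finset.mul_sum]
    ring

end IsLaw

/-- Summing a product weight over the points that agree with `x` outside `T`. -/
theorem sum_prod_agree {ι : Type*} [Fintype ι] [DecidableEq ι] {α : ι → Type*}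
    [∀ i, Fintype (α i)] (w : ∀ i, α i → ℝ) (hw : ∀ i, ∑ a, w i a = 1) (T : Finset ι)
    (x : ∀ i, α i) (f : (∀ i, α i) → ℝ) [DecidablePred fun x' : ∀ i, α i => ∀ i ∈ Tᶜ, x' i = x i] :
    ∑ x' : ∀ i, α i, (if ∀ i ∈ Tᶜ, x' i = x i then (∏ i, w i (x' i)) * f x' else 0) =
      (∏ i ∈ Tᶜ, w i (x i)) * ∑ x' : ∀ i, α i, (∏ i, w i (x' i)) * f (T.piecewise x' x) := by
  classical
  -- The weight of the fixed coordinates is the probability that an independent copy agrees with `x`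
  -- off `T`. Exchanging the `T`-coordinates of two copies then separates this event from the
  -- freshly drawn coordinates.
  have h1 : ∏ i ∈ Tᶜ, w i (x i) =
      ∑ x'' : ∀ i, α i, (∏ i, w i (x'' i)) * if ∀ i ∈ Tᶜ, x'' i = x i then 1 else 0 := by
    have : ∀ x'' : ∀ i, α i, ((∏ i, w i (x'' i)) * if ∀ i ∈ Tᶜ, x'' i = x i then 1 else 0) =
        ∏ i, if i ∈ Tᶜ → x'' i = x i then w i (x'' i) else 0 := by
      intro x''
      rw [Fintype.prod_ite_zero, mul_ite, mul_one, mul_zero]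
      congr
    simp_rw [this]
    rw [← Fintype.prod_sum (f := fun i a => if i ∈ Tᶜ → a = x i then w i a else 0),
      ← Finset.prod_mul_prod_compl Tᶜ, mul_comm, Finset.prod_eq_one (s := Tᶜᶜ), one_mul]
    · refine Finset.prod_congr rfl fun i hi => ?_
      simp [hi]
    · intro i hi
      have : i ∉ Tᶜ := by simpa using hi
      simp [this, hw]
  have h2 := sum_prod_piecewise w T (fun x' x'' => (if ∀ i ∈ Tᶜ, x' i = x i then f x' else 0))
  have h3 : ∀ x' : ∀ i, α i, ∑ x'' : ∀ i, α i, (∏ i, w i (x' i)) * (∏ i, w i (x'' i)) *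
      (if ∀ i ∈ Tᶜ, x' i = x i then f x' else 0) =
      (if ∀ i ∈ Tᶜ, x' i = x i then (∏ i, w i (x' i)) * f x' else 0) := by
    intro x'
    rw [← Finset.sum_mul, ← Finset.mul_sum, sum_prod_eq_one w hw, mul_one, mul_ite, mul_zero]
  simp_rw [h3] at h2
  rw [← h2, h1, Finset.sum_mul]
  refine Finset.sum_congr rfl fun a _ => ?_
  rw [Finset.mul_sum]
  refine Finset.sum_congr rfl fun b _ => ?_
  have h4 : (∀ i ∈ Tᶜ, T.piecewise b a i = x i) ↔ ∀ i ∈ Tᶜ, a i = x i := by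
    refine forall₂_congr fun i hi => ?_
    rw [Finset.piecewise_eq_of_notMem _ _ _ (by simpa using hi)]
  by_cases h5 : ∀ i ∈ Tᶜ, a i = x i
  · rw [if_pos h5, if_pos (h4.2 h5)]
    have : T.piecewise b a = T.piecewise b x := by
      ext i
      by_cases hi : i ∈ T
      · simp [hi]
      · simp [hi, h5 i (by simpa using hi)]
    rw [this]; ring
  · rw [if_neg h5, if_neg (fun h => h5 (h4.1 h))]; ring

end Law

/-! ## The single-letter bound of a law with time-sharing -/

theorem restrict_eq_restrict_iff {ι : Type*} {β : ι → Type*} (D : Finset ι) (z z' : ∀ i, β i) :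
    D.restrict z = D.restrict z' ↔ ∀ i ∈ D, z i = z' i := by
  simp [funext_iff, Finset.restrict]

section Bridge

variable {L K : ℕ} {X : Fin L → Type*} {Y : Fin K → Type*}
  [∀ l, Fintype (X l)] [∀ k, Fintype (Y k)]

omit [∀ l, Fintype (X l)] in
theorem marginal_mem {W : (∀ l, X l) → (∀ k, Y k) → ℝ} (hW : IsChannel W) (k : Fin K)
    (x : ∀ l, X l) : marginal W k x ∈ stdSimplex ℝ (Y k) :=
  ⟨fun b => mass_nonneg (hW x).1 (fun y => y k) b,
    (sum_mass (W x) (fun y => y k)).trans (hW x).2⟩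

namespace TestLaw

variable (P : TestLaw X Y) {W : (∀ l, X l) → (∀ k, Y k) → ℝ}

theorem isLaw (hW : IsChannel W) (q : Fin P.nQ) :
    IsLaw (fun l => P.pX l q) (marginal W) (fun k b => P.pU k b q) where
  input_mem l := P.pX_mem l q
  channel_mem := marginal_mem hW
  test_mem k b := P.pU_mem k b q

theorem joint_eq (q : Fin P.nQ) (x : ∀ l, X l) (y : ∀ k, Y k) (u : ∀ k, Fin (P.nU k)) :
    P.joint W (q, x, y, u) =
      P.pQ q * lawProb (fun l => P.pX l q) (marginal W) (fun k b => P.pU k b q) x y u := by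
  simp only [joint, lawProb, rvQ, rvX, rvY, rvU]; ring

theorem joint_nonneg (hW : IsChannel W) (ω : P.Outcome) : 0 ≤ P.joint W ω := by
  obtain ⟨q, x, y, u⟩ := ω
  rw [joint_eq]
  exact mul_nonneg (P.pQ_mem.1 q) ((P.isLaw hW q).lawProb_nonneg x y u)

/-- Given `q` and `x` the pairs `(y_k, u_k)` are independent, so an event made of one condition on
`x` and one on each pair has a product form. All masses in the two informations are of this kind. -/
theorem mass_joint {α : Type*} (A : P.Outcome → α) (a : α) (q : Fin P.nQ)
    (E : (∀ l, X l) → Prop) (G : ∀ k, Y k → Fin (P.nU k) → Prop)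
    [DecidablePred E] [∀ k b u, Decidable (G k b u)]
    (h : ∀ q' x y u, A (q', x, y, u) = a ↔ q' = q ∧ E x ∧ ∀ k, G k (y k) (u k)) :
    mass (P.joint W) A a = P.pQ q * ∑ x, if E x then (∏ l, P.pX l q (x l)) *
      ∏ k, ∑ b, ∑ u, (if G k b u then marginal W k x b * P.pU k b q u else 0) else 0 := by
  classical
  rw [mass, Fintype.sum_prod_type, Finset.sum_eq_single q]
  · rw [Fintype.sum_prod_type, Finset.mul_sum]
    refine Finset.sum_congr rfl fun x _ => ?_
    rw [Fintype.sum_prod_type]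
    simp_rw [h, joint_eq]
    by_cases hE : E x
    · simp_rw [Fintype.prod_sum, Fintype.prod_ite_zero]
      simp only [hE, true_and, if_true, Finset.mul_sum]
      refine Finset.sum_congr rfl fun y _ => Finset.sum_congr rfl fun u _ => ?_
      split_ifs
      · rw [lawProb, Finset.prod_mul_distrib]; ring
      · simp
    · simp [hE]
  · intro q' _ hq'
    refine Finset.sum_eq_zero fun ω _ => ?_
    rw [if_neg]
    rw [h]
    exact fun hc => hq' hc.1
  · simp

theorem sum_all (hW : IsChannel W) (q : Fin P.nQ) (k : Fin K) (x : ∀ l, X l) :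
    ∑ b, ∑ u, marginal W k x b * P.pU k b q u = 1 := by
  simp_rw [← Finset.mul_sum, (P.pU_mem k _ q).2, mul_one, (marginal_mem hW k x).2]

/-- Given `(x, q)` every relay other than `s` integrates out, which leaves the ratio of
`p(u_s|y_s,q)` and `p(u_s|x,q)`. -/
theorem relayInfo_eq (hW : IsChannel W) (s : Fin K) :
    P.relayInfo W s = ∑ ω : P.Outcome, P.joint W ω *
      Real.logb 2 (P.pU s (ω.2.2.1 s) ω.1 (ω.2.2.2 s) /
        outProb (marginal W) (fun k b => P.pU k b ω.1) s ω.2.1 (ω.2.2.2 s)) := by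
  classical
  refine condMI_eq (P.joint_nonneg hW) _ _ _ _ ?_
  rintro ⟨q, x, y, u⟩ h0
  have hpos : 0 < outProb (marginal W) (fun k b => P.pU k b q) s x (u s) := by
    rw [joint_eq] at h0
    exact (pos_of_mul_pos_right h0 (P.pQ_mem.1 q)).trans_le
      ((P.isLaw hW q).lawProb_le_outProb s x y u)
  have key : ∀ (G : ∀ k, Y k → Fin (P.nU k) → Prop) [∀ k b u, Decidable (G k b u)],
      (∑ x', if x' = x then (∏ l, P.pX l q (x' l)) *
        ∏ k, ∑ b, ∑ u, (if (k = s → G k b u) then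
          marginal W k x' b * P.pU k b q u else 0) else 0) =
      (∏ l, P.pX l q (x l)) *
        ∑ b, ∑ u, (if G s b u then marginal W s x b * P.pU s b q u else 0) := by
    intro G _
    rw [Finset.sum_ite_eq', if_pos (Finset.mem_univ _), Finset.prod_eq_single s]
    · simp
    · intro k _ hk
      simp only [hk, IsEmpty.forall_iff, if_true]
      exact P.sum_all hW q k x
    · simp
  have hev : ∀ Q : Fin K → Prop, (∀ k, k = s → Q k) ↔ Q s := fun Q => by simp
  simp only [rvY, rvU, rvX, rvQ]
  rw [P.mass_joint _ _ q (fun x' => x' = x)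
      (fun k b u' => k = s → b = y k ∧ u' = u k) (fun q' x' y' u' => by
        rw [hev (fun k => y' k = y k ∧ u' k = u k)]
        simp only [Prod.mk.injEq]; tauto),
    P.mass_joint _ _ q (fun x' => x' = x)
      (fun k b u' => k = s → True) (fun q' x' y' u' => by
        simp only [Prod.mk.injEq]; tauto),
    P.mass_joint _ _ q (fun x' => x' = x)
      (fun k b u' => k = s → b = y k) (fun q' x' y' u' => by
        rw [hev (fun k => y' k = y k)]
        simp only [Prod.mk.injEq]; tauto),
    P.mass_joint _ _ q (fun x' => x' = x)
      (fun k b u' => k = s → u' = u k) (fun q' x' y' u' => by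
        rw [hev (fun k => u' k = u k)]
        simp only [Prod.mk.injEq]; tauto),
    key (fun k b u' => b = y k ∧ u' = u k), key (fun k b u' => True), key (fun k b u' => b = y k),
    key (fun k b u' => u' = u k)]
  have e1 : (∑ b, ∑ u', if b = y s ∧ u' = u s then marginal W s x b * P.pU s b q u' else 0) =
      marginal W s x (y s) * P.pU s (y s) q (u s) := by
    simp [ite_and]
  have e2 : (∑ b, ∑ u', if True then marginal W s x b * P.pU s b q u' else 0) = 1 := by
    simpa using P.sum_all hW q s x
  have e3 : (∑ b, ∑ u', if b = y s then marginal W s x b * P.pU s b q u' else 0) =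
      marginal W s x (y s) := by
    rw [Finset.sum_comm]
    simp [← Finset.mul_sum, (P.pU_mem s _ q).2]
  have e4 : (∑ b, ∑ u', if u' = u s then marginal W s x b * P.pU s b q u' else 0) =
      outProb (marginal W) (fun k b => P.pU k b q) s x (u s) := by
    simp [outProb]
  rw [e1, e2, e3, e4]
  field_simp

/-- The inputs are independent given `q`, so conditioning on `x_{Tᶜ}` means drawing the inputs of
`T` afresh; this identifies `p(u_{Sᶜ}|x_{Tᶜ},q)` with `partProb`. -/
theorem userInfo_eq (hW : IsChannel W) (T : Finset (Fin L)) (S : Finset (Fin K)) :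
    P.userInfo W T S = ∑ ω : P.Outcome, P.joint W ω *
      Real.logb 2 ((∏ k ∈ Sᶜ, outProb (marginal W) (fun k b => P.pU k b ω.1) k ω.2.1 (ω.2.2.2 k)) /
        partProb (fun l => P.pX l ω.1) (marginal W) (fun k b => P.pU k b ω.1) T S
          ω.2.1 ω.2.2.2) := by
  classical
  refine condMI_eq (P.joint_nonneg hW) _ _ _ _ ?_
  rintro ⟨q, x, y, u⟩ h0
  have hpos : 0 < partProb (fun l => P.pX l q) (marginal W) (fun k b => P.pU k b q) T S x u := by
    rw [joint_eq] at h0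
    exact (pos_of_mul_pos_right h0 (P.pQ_mem.1 q)).trans_le
      ((P.isLaw hW q).lawProb_le_partProb T S x y u)
  have key : ∀ x', ∏ k, ∑ b, ∑ u', (if k ∈ Sᶜ → u' = u k then
      marginal W k x' b * P.pU k b q u' else 0) =
      ∏ k ∈ Sᶜ, outProb (marginal W) (fun k b => P.pU k b q) k x' (u k) := by
    intro x'
    rw [← Finset.prod_mul_prod_compl Sᶜ, Finset.prod_eq_one (s := Sᶜᶜ), mul_one]
    · refine Finset.prod_congr rfl fun k hk => ?_
      simp [hk, outProb]
    · intro k hk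
      have : k ∉ Sᶜ := by simpa using hk
      simp only [this, IsEmpty.forall_iff, if_true]
      exact P.sum_all hW q k x'
  have key1 : ∀ x', ∏ k, ∑ b, ∑ u', (if True then
      marginal W k x' b * P.pU k b q u' else 0) = 1 := by
    intro x'
    refine Finset.prod_eq_one fun k _ => ?_
    simpa using P.sum_all hW q k x'
  have hTx : ∀ x' : ∀ l, X l, x' = x ↔ (∀ l ∈ T, x' l = x l) ∧ ∀ l ∈ Tᶜ, x' l = x l := by
    intro x'
    constructor
    · rintro rfl; exact ⟨fun _ _ => rfl, fun _ _ => rfl⟩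
    · rintro ⟨h1, h2⟩
      ext l
      by_cases hl : l ∈ T
      · exact h1 l hl
      · exact h2 l (by simpa using hl)
  have hpX : ∀ l, ∑ a, P.pX l q a = 1 := fun l => (P.pX_mem l q).2
  simp only [rvU, rvX, rvQ]
  rw [P.mass_joint _ _ q (fun x' => x' = x) (fun k _ u' => k ∈ Sᶜ → u' = u k)
      (fun q' x' y' u' => by
        simp only [Prod.mk.injEq, restrict_eq_restrict_iff, hTx x']; tauto),
    P.mass_joint _ _ q (fun x' => ∀ l ∈ Tᶜ, x' l = x l) (fun k _ u' => True)
      (fun q' x' y' u' => by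
        simp only [Prod.mk.injEq, restrict_eq_restrict_iff]; tauto),
    P.mass_joint _ _ q (fun x' => x' = x) (fun k _ u' => True)
      (fun q' x' y' u' => by
        simp only [Prod.mk.injEq, restrict_eq_restrict_iff, hTx x']; tauto),
    P.mass_joint _ _ q (fun x' => ∀ l ∈ Tᶜ, x' l = x l) (fun k _ u' => k ∈ Sᶜ → u' = u k)
      (fun q' x' y' u' => by
        simp only [Prod.mk.injEq, restrict_eq_restrict_iff]; tauto)]
  simp_rw [key, key1]
  rw [sum_prod_agree (fun l => P.pX l q) hpX T x (fun _ => 1),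
    sum_prod_agree (fun l => P.pX l q) hpX T x
      (fun x' => ∏ k ∈ Sᶜ, outProb (marginal W) (fun k b => P.pU k b q) k x' (u k))]
  simp only [Finset.sum_ite_eq', Finset.mem_univ, if_true, mul_one]
  rw [sum_prod_eq_one (fun l => P.pX l q) hpX]
  change _ = _ * (_ * (_ * (_ * partProb (fun l => P.pX l q) (marginal W)
    (fun k b => P.pU k b q) T S x u)))
  field_simp

/-- The right-hand side of the single-letter bound is the average of `rateFun` over `Q`. -/
theorem bound_eq (hW : IsChannel W) (C : Fin K → ℝ) (T : Finset (Fin L)) (S : Finset (Fin K)) :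
    ∑ s ∈ S, (C s - P.relayInfo W s) + P.userInfo W T S =
      ∑ q, P.pQ q * rateFun C (marginal W) (fun l => P.pX l q) (fun k b => P.pU k b q) T S := by
  have h1 : ∀ q, P.pQ q * rateFun C (marginal W) (fun l => P.pX l q) (fun k b => P.pU k b q) T S =
      P.pQ q * ∑ s ∈ S, C s + ∑ x, ∑ y, ∑ u, P.joint W (q, x, y, u) *
        Real.logb 2 (lawRatio (fun l => P.pX l q) (marginal W) (fun k b => P.pU k b q)
          T S x y u) := by
    intro q
    simp_rw [rateFun, joint_eq, mul_add, Finset.mul_sum, mul_assoc]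
  simp_rw [h1]
  rw [Finset.sum_add_distrib, ← Finset.sum_mul, P.pQ_mem.2, one_mul, Finset.sum_sub_distrib,
    userInfo_eq P hW]
  simp_rw [relayInfo_eq P hW]
  rw [Finset.sum_comm (s := S), sub_add, sub_eq_add_neg, add_right_inj, neg_sub,
    ← Finset.sum_sub_distrib]
  simp_rw [Fintype.sum_prod_type]
  refine Finset.sum_congr rfl fun q _ => Finset.sum_congr rfl fun x _ =>
    Finset.sum_congr rfl fun y _ => Finset.sum_congr rfl fun u _ => ?_
  have h := P.isLaw hW q
  rw [joint_eq]
  rcases (h.lawProb_nonneg x y u).eq_or_lt with h0 | h0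
  · simp [← h0]
  · have h1 : ∀ k, 0 < outProb (marginal W) (fun k b => P.pU k b q) k x (u k) := fun k =>
      h0.trans_le (h.lawProb_le_outProb k x y u)
    have h2 : ∀ k, 0 < P.pU k (y k) q (u k) := fun k => h0.trans_le (h.lawProb_le_test k x y u)
    have h3 := h0.trans_le (h.lawProb_le_partProb T S x y u)
    have h4 : ∑ s ∈ S, Real.logb 2 (P.pU s (y s) q (u s) /
        outProb (marginal W) (fun k b => P.pU k b q) s x (u s)) =
        ∑ s ∈ S, Real.logb 2 (P.pU s (y s) q (u s)) -
          ∑ s ∈ S, Real.logb 2 (outProb (marginal W) (fun k b => P.pU k b q) s x (u s)) := by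
      rw [← Finset.sum_sub_distrib]
      exact Finset.sum_congr rfl fun s _ => Real.logb_div (h2 s).ne' (h1 s).ne'
    -- The factors `p(u_s|x)`, `s ∈ S`, of the relay terms complete the product over `Sᶜ` from the
    -- user term to a product over all relays.
    rw [← Finset.mul_sum, ← mul_sub, lawRatio, h4,
      Real.logb_div (Finset.prod_pos fun k _ => h1 k).ne'
        (mul_pos (Finset.prod_pos fun k _ => h2 k) h3).ne',
      Real.logb_div (Finset.prod_pos fun k _ => h1 k).ne' h3.ne',
      Real.logb_mul (Finset.prod_pos fun k _ => h2 k).ne' h3.ne',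
      Real.logb_prod _ _ fun k _ => (h1 k).ne', Real.logb_prod _ _ fun k _ => (h1 k).ne',
      Real.logb_prod _ _ fun k _ => (h2 k).ne', ← Finset.sum_add_sum_compl S]
    ring

end TestLaw

end Bridge

/-! ## Compactness of the set of single-letter bounds -/

section Convexity

/-- A conic form of Carathéodory's theorem. -/
theorem exists_sparse_sum {F : Type*} [AddCommGroup F] [Module ℝ F] [FiniteDimensional ℝ F]
    {U : Type*} [Fintype U] (v : U → F) :
    ∃ t : U → ℝ, (∀ u, 0 ≤ t u) ∧ ∑ u, t u • v u = ∑ u, v u ∧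
      {u | t u ≠ 0}.ncard ≤ Module.finrank ℝ F + 1 := by
  classical
  rcases isEmpty_or_nonempty U with hU | hU
  · exact ⟨fun _ => 0, by simp, by simp, by simp⟩
  have hN : (Fintype.card U : ℝ) ≠ 0 := by
    exact_mod_cast Fintype.card_ne_zero
  -- Carathéodory applies to the barycentre of the vectors; multiplying the weights by the
  -- cardinality recovers their sum.
  have hc : ∑ u, (Fintype.card U : ℝ)⁻¹ • v u ∈ convexHull ℝ (Set.range v) :=
    mem_convexHull_of_exists_fintype (fun _ => (Fintype.card U : ℝ)⁻¹) v
      (fun _ => by positivity) (by simp [hN]) (fun u => ⟨u, rfl⟩) rfl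
  obtain ⟨ι, _, z, w, hz, hz', hw, hw1, hwz⟩ := eq_pos_convex_span_of_mem_convexHull hc
  choose σ hσ using fun i => hz ⟨i, rfl⟩
  refine ⟨fun u => Fintype.card U * ∑ i, if σ i = u then w i else 0, fun u => ?_, ?_, ?_⟩
  · refine mul_nonneg (by positivity) (Finset.sum_nonneg fun i _ => ?_)
    split_ifs
    exacts [(hw i).le, le_rfl]
  · simp_rw [mul_smul, ← Finset.smul_sum, Finset.sum_smul, ite_smul, zero_smul]
    rw [Finset.sum_comm]
    simp only [Finset.sum_ite_eq, Finset.mem_univ, if_true, hσ, hwz]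
    rw [← Finset.smul_sum, smul_inv_smul₀ hN]
  · refine le_trans ?_ (hz'.card_le_finrank_succ.trans
      (Nat.add_le_add_right (Submodule.finrank_le _) 1))
    have : {u | (Fintype.card U : ℝ) * (∑ i, if σ i = u then w i else 0) ≠ 0} ⊆
        ((Finset.univ.image σ : Finset U) : Set U) := by
      intro u hu
      by_contra h
      refine hu ?_
      rw [Finset.sum_eq_zero, mul_zero]
      intro i _
      rw [if_neg]
      rintro rfl
      exact h (by simp)
    refine (Set.ncard_le_ncard this (Finset.finite_toSet _)).trans ?_
    rw [Set.ncard_coe_finset]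
    exact Finset.card_image_le.trans (by simp)

/-- The convex hull of a compact set in a finite-dimensional space is compact. -/
theorem isCompact_convexHull_of_finiteDimensional {F : Type*} [NormedAddCommGroup F]
    [NormedSpace ℝ F] [FiniteDimensional ℝ F] {s : Set F} (hs : IsCompact s) :
    IsCompact (convexHull ℝ s) := by
  classical
  set n := Module.finrank ℝ F + 1 with hn
  -- By Carathéodory, combinations of dimension plus one points suffice, so the hull is a continuous
  -- image of a simplex times a power of `s`.
  have himg : convexHull ℝ s = (fun p : (Fin n → ℝ) × (Fin n → F) => ∑ i, p.1 i • p.2 i) ''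
      (stdSimplex ℝ (Fin n) ×ˢ Set.univ.pi fun _ => s) := by
    ext x
    constructor
    · intro hx
      obtain ⟨ι, _, z, w, hz, hz', hw, hw1, hwz⟩ := eq_pos_convex_span_of_mem_convexHull hx
      have hcard : Fintype.card ι ≤ Fintype.card (Fin n) := by
        rw [Fintype.card_fin]
        exact hz'.card_le_finrank_succ.trans
          (Nat.add_le_add_right (Submodule.finrank_le _) 1)
      obtain ⟨f⟩ := Function.Embedding.nonempty_of_card_le hcard
      have hne : Nonempty ι := by
        by_contra h
        rw [not_nonempty_iff] at h
        simp at hw1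
      obtain ⟨i₀⟩ := hne
      -- Slots not hit by the embedding receive weight zero and the dummy point `z i₀`.
      refine ⟨(fun j => ∑ i, if f i = j then w i else 0,
        fun j => if h : ∃ i, f i = j then z h.choose else z i₀), ⟨⟨fun j => ?_, ?_⟩, ?_⟩, ?_⟩
      · refine Finset.sum_nonneg fun i _ => ?_
        split_ifs
        exacts [(hw i).le, le_rfl]
      · rw [Finset.sum_comm]
        simpa using hw1
      · intro j _
        dsimp only
        split_ifs
        · exact hz ⟨_, rfl⟩
        · exact hz ⟨_, rfl⟩
      · dsimp only
        simp_rw [Finset.sum_smul, ite_smul, zero_smul]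
        rw [Finset.sum_comm]
        simp only [Finset.sum_ite_eq, Finset.mem_univ, if_true]
        rw [← hwz]
        refine Finset.sum_congr rfl fun i _ => ?_
        have h : ∃ i', f i' = f i := ⟨i, rfl⟩
        rw [dif_pos h, f.injective h.choose_spec]
    · rintro ⟨⟨w, z⟩, ⟨hw, hz⟩, rfl⟩
      exact mem_convexHull_of_exists_fintype w z hw.1 hw.2 (fun i => hz i trivial) rfl
  rw [himg]
  refine ((isCompact_stdSimplex ℝ (Fin n)).prod (isCompact_univ_pi fun _ => hs)).image ?_
  fun_prop

/-- Where `g` vanishes so does `f`, and `|f log g| ≤ |g log g|` tends to zero; elsewhere the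
logarithm is continuous. The convention `log 0 = 0` is therefore harmless. -/
theorem continuousOn_mul_logb {Z : Type*} [TopologicalSpace Z] {s : Set Z} {f g : Z → ℝ}
    (hf : ContinuousOn f s) (hg : ContinuousOn g s) (h0 : ∀ z ∈ s, 0 ≤ f z)
    (h1 : ∀ z ∈ s, f z ≤ g z) : ContinuousOn (fun z => f z * Real.logb 2 (g z)) s := by
  intro z hz
  rcases ((h0 z hz).trans (h1 z hz)).eq_or_lt with h | h
  · have hgl : ContinuousWithinAt (fun z => |g z * Real.log (g z)| / Real.log 2) s z :=
      ((Real.continuous_mul_log.comp_continuousOn hg).abs.div_const _) z hz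
    have hfz : f z = 0 := le_antisymm (h ▸ h1 z hz) (h0 z hz)
    rw [ContinuousWithinAt] at hgl ⊢
    rw [← h, zero_mul, abs_zero, zero_div] at hgl
    rw [hfz, zero_mul]
    refine squeeze_zero_norm' ?_ hgl
    filter_upwards [self_mem_nhdsWithin] with y hy
    have hl2 : 0 < Real.log 2 := Real.log_pos (by norm_num)
    rw [Real.norm_eq_abs, Real.logb, ← mul_div_assoc, abs_div, abs_of_pos hl2, abs_mul, abs_mul,
      abs_of_nonneg (h0 y hy), abs_of_nonneg ((h0 y hy).trans (h1 y hy))]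
    gcongr
    exact h1 y hy
  · exact (hf z hz).mul (ContinuousWithinAt.div_const ((hg z hz).log h.ne') _)

end Convexity

/-! ### Continuity of the bounds and compactness for alphabets of fixed size -/

section Compactness

variable {L K : ℕ} {X : Fin L → Type*} {Y : Fin K → Type*} {U : Fin K → Type*}
  [∀ l, Fintype (X l)] [∀ k, Fintype (Y k)] [∀ k, Fintype (U k)]

/-- The vector of all single-letter bounds. -/
def rateVec (C : Fin K → ℝ) (V : ∀ k, (∀ l, X l) → Y k → ℝ) (pX : ∀ l, X l → ℝ)
    (pU : ∀ k, Y k → U k → ℝ) (z : Finset (Fin L) × Finset (Fin K)) : ℝ :=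
  rateFun C V pX pU z.1 z.2

/-- The single-letter bounds of all laws whose auxiliary alphabets have `d` elements. -/
def rateSet (C : Fin K → ℝ) (V : ∀ k, (∀ l, X l) → Y k → ℝ) (d : ℕ) :
    Set (Finset (Fin L) × Finset (Fin K) → ℝ) :=
  {v | ∃ (pX : ∀ l, X l → ℝ) (pU : ∀ k, Y k → Fin d → ℝ), IsLaw pX V pU ∧ rateVec C V pX pU = v}

omit [∀ l, Fintype (X l)] [∀ k, Fintype (U k)] in
theorem continuous_outProb (V : ∀ k, (∀ l, X l) → Y k → ℝ) (k : Fin K) (x : ∀ l, X l) (u : U k) :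
    Continuous fun z : (∀ l, X l → ℝ) × (∀ k, Y k → U k → ℝ) => outProb V z.2 k x u := by
  unfold outProb
  refine continuous_finsetSum _ fun b _ => continuous_const.mul ?_
  exact (continuous_apply_apply b u).comp ((continuous_apply k).comp continuous_snd)

omit [∀ l, Fintype (X l)] [∀ k, Fintype (Y k)] [∀ k, Fintype (U k)] in
theorem continuous_input (x : ∀ l, X l) :
    Continuous fun z : (∀ l, X l → ℝ) × (∀ k, Y k → U k → ℝ) => ∏ l, z.1 l (x l) :=
  continuous_finsetProd _ fun l _ =>
    (continuous_apply (x l)).comp ((continuous_apply l).comp continuous_fst)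

omit [∀ l, Fintype (X l)] [∀ k, Fintype (Y k)] [∀ k, Fintype (U k)] in
theorem continuous_test (k : Fin K) (b : Y k) (u : U k) :
    Continuous fun z : (∀ l, X l → ℝ) × (∀ k, Y k → U k → ℝ) => z.2 k b u :=
  (continuous_apply_apply b u).comp ((continuous_apply k).comp continuous_snd)

omit [∀ k, Fintype (U k)] in
theorem continuous_partProb (V : ∀ k, (∀ l, X l) → Y k → ℝ) (T : Finset (Fin L))
    (S : Finset (Fin K)) (x : ∀ l, X l) (u : ∀ k, U k) :
    Continuous fun z : (∀ l, X l → ℝ) × (∀ k, Y k → U k → ℝ) => partProb z.1 V z.2 T S x u := by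
  unfold partProb
  exact continuous_finsetSum _ fun x' _ => (continuous_input x').mul
    (continuous_finsetProd _ fun k _ => continuous_outProb V k _ _)

omit [∀ l, Fintype (X l)] [∀ k, Fintype (Y k)] [∀ k, Fintype (U k)] in
theorem continuous_lawProb (V : ∀ k, (∀ l, X l) → Y k → ℝ) (x : ∀ l, X l) (y : ∀ k, Y k)
    (u : ∀ k, U k) :
    Continuous fun z : (∀ l, X l → ℝ) × (∀ k, Y k → U k → ℝ) => lawProb z.1 V z.2 x y u := by
  unfold lawProb
  exact ((continuous_input x).mul continuous_const).mul
    (continuous_finsetProd _ fun k _ => continuous_test k _ _)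

/-- The ratio itself misbehaves where its factors vanish, so its logarithm is first split: each term
is then the law times the logarithm of a kernel dominating the law. -/
theorem continuousOn_mul_logb_lawRatio (V : ∀ k, (∀ l, X l) → Y k → ℝ) (T : Finset (Fin L))
    (S : Finset (Fin K)) (x : ∀ l, X l) (y : ∀ k, Y k) (u : ∀ k, U k) :
    ContinuousOn (fun z : (∀ l, X l → ℝ) × (∀ k, Y k → U k → ℝ) =>
      lawProb z.1 V z.2 x y u * Real.logb 2 (lawRatio z.1 V z.2 T S x y u))
      {z | IsLaw z.1 V z.2} := by
  have h : ContinuousOn (fun z : (∀ l, X l → ℝ) × (∀ k, Y k → U k → ℝ) =>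
      ∑ k, lawProb z.1 V z.2 x y u * Real.logb 2 (outProb V z.2 k x (u k)) -
      ∑ s ∈ S, lawProb z.1 V z.2 x y u * Real.logb 2 (z.2 s (y s) (u s)) -
      lawProb z.1 V z.2 x y u * Real.logb 2 (partProb z.1 V z.2 T S x u))
      {z | IsLaw z.1 V z.2} := by
    have hl : ContinuousOn (fun z : (∀ l, X l → ℝ) × (∀ k, Y k → U k → ℝ) =>
      lawProb z.1 V z.2 x y u) {z | IsLaw z.1 V z.2} := (continuous_lawProb V x y u).continuousOn
    have h0 : ∀ z ∈ {z : (∀ l, X l → ℝ) × (∀ k, Y k → U k → ℝ) | IsLaw z.1 V z.2},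
        0 ≤ lawProb z.1 V z.2 x y u := fun z hz => IsLaw.lawProb_nonneg hz x y u
    refine ((continuousOn_finsetSum _ fun k _ => ?_).sub
      (continuousOn_finsetSum _ fun s _ => ?_)).sub ?_
    · exact continuousOn_mul_logb hl (continuous_outProb V k x (u k)).continuousOn h0
        (fun z hz => IsLaw.lawProb_le_outProb hz k x y u)
    · exact continuousOn_mul_logb hl (continuous_test s (y s) (u s)).continuousOn h0
        (fun z hz => IsLaw.lawProb_le_test hz s x y u)
    · exact continuousOn_mul_logb hl (continuous_partProb V T S x u).continuousOn h0
        (fun z hz => IsLaw.lawProb_le_partProb hz T S x y u)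
  exact h.congr fun z hz => IsLaw.mul_logb_lawRatio hz T S x y u

theorem continuousOn_rateVec (C : Fin K → ℝ) (V : ∀ k, (∀ l, X l) → Y k → ℝ) :
    ContinuousOn (fun z : (∀ l, X l → ℝ) × (∀ k, Y k → U k → ℝ) => rateVec C V z.1 z.2)
      {z | IsLaw z.1 V z.2} := by
  refine continuousOn_pi.2 fun TS => ?_
  unfold rateVec rateFun
  exact continuousOn_const.add (continuousOn_finsetSum _ fun x _ => continuousOn_finsetSum _
    fun y _ => continuousOn_finsetSum _ fun u _ =>
      continuousOn_mul_logb_lawRatio V TS.1 TS.2 x y u)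

/-- The admissible kernels form a product of simplices, on which the bounds are continuous. -/
theorem isCompact_rateSet (C : Fin K → ℝ) {V : ∀ k, (∀ l, X l) → Y k → ℝ}
    (hV : ∀ k x, V k x ∈ stdSimplex ℝ (Y k)) (d : ℕ) : IsCompact (rateSet C V d) := by
  have h1 : {z : (∀ l, X l → ℝ) × (∀ k, Y k → Fin d → ℝ) | IsLaw z.1 V z.2} =
      (Set.univ.pi fun l => stdSimplex ℝ (X l)) ×ˢ
        (Set.univ.pi fun k => Set.univ.pi fun _ : Y k => stdSimplex ℝ (Fin d)) := by
    ext ⟨pX, pU⟩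
    constructor
    · intro h
      exact ⟨fun l _ => h.input_mem l, fun k _ b _ => h.test_mem k b⟩
    · rintro ⟨h, h'⟩
      exact ⟨fun l => h l trivial, hV, fun k b => h' k trivial b trivial⟩
  have h2 : IsCompact {z : (∀ l, X l → ℝ) × (∀ k, Y k → Fin d → ℝ) | IsLaw z.1 V z.2} := by
    rw [h1]
    exact (isCompact_univ_pi fun l => isCompact_stdSimplex ℝ _).prod
      (isCompact_univ_pi fun k => isCompact_univ_pi fun _ => isCompact_stdSimplex ℝ _)
  convert h2.image_of_continuousOn (continuousOn_rateVec C V) using 1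
  ext v
  constructor
  · rintro ⟨pX, pU, h, rfl⟩
    exact ⟨(pX, pU), h, rfl⟩
  · rintro ⟨⟨pX, pU⟩, h, rfl⟩
    exact ⟨pX, pU, h, rfl⟩

end Compactness

/-! ## Bounding the auxiliary alphabets -/

section Reduction

variable {L K : ℕ} {X : Fin L → Type*} {Y : Fin K → Type*} {U : Fin K → Type*}

/-- Rescale the columns of the `k₀`-th test channel. -/
def scaleTest (pU : ∀ k, Y k → U k → ℝ) (k₀ : Fin K) (t : U k₀ → ℝ) : ∀ k, Y k → U k → ℝ :=
  Function.update pU k₀ fun b u => t u * pU k₀ b u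

theorem scaleTest_apply (pU : ∀ k, Y k → U k → ℝ) (k₀ : Fin K) (t : U k₀ → ℝ) (k : Fin K)
    (b : Y k) (u : ∀ k, U k) :
    scaleTest pU k₀ t k b (u k) = (if k = k₀ then t (u k₀) else 1) * pU k b (u k) := by
  unfold scaleTest
  by_cases h : k = k₀
  · subst h; simp
  · simp [h]

theorem prod_scale (S : Finset (Fin K)) (k₀ : Fin K) (c : ℝ) (f : Fin K → ℝ) :
    ∏ k ∈ S, (if k = k₀ then c else 1) * f k = (if k₀ ∈ S then c else 1) * ∏ k ∈ S, f k := by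
  rw [Finset.prod_mul_distrib, Finset.prod_ite_eq']

section

variable [∀ k, Fintype (Y k)]

theorem outProb_scaleTest (V : ∀ k, (∀ l, X l) → Y k → ℝ) (pU : ∀ k, Y k → U k → ℝ) (k₀ : Fin K)
    (t : U k₀ → ℝ) (k : Fin K) (x : ∀ l, X l) (u : ∀ k, U k) :
    outProb V (scaleTest pU k₀ t) k x (u k) =
      (if k = k₀ then t (u k₀) else 1) * outProb V pU k x (u k) := by
  simp_rw [outProb, scaleTest_apply, Finset.mul_sum]
  exact Finset.sum_congr rfl fun b _ => by ring

variable [∀ l, Fintype (X l)]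

theorem partProb_scaleTest (pX : ∀ l, X l → ℝ) (V : ∀ k, (∀ l, X l) → Y k → ℝ)
    (pU : ∀ k, Y k → U k → ℝ) (k₀ : Fin K) (t : U k₀ → ℝ) (T : Finset (Fin L))
    (S : Finset (Fin K)) (x : ∀ l, X l) (u : ∀ k, U k) :
    partProb pX V (scaleTest pU k₀ t) T S x u =
      (if k₀ ∈ Sᶜ then t (u k₀) else 1) * partProb pX V pU T S x u := by
  simp_rw [partProb, outProb_scaleTest, prod_scale, Finset.mul_sum]
  exact Finset.sum_congr rfl fun b _ => by ring

/-- The numerator of the ratio and its denominator each carry exactly one factor depending on `u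
k₀`: in the denominator it is the test channel if `k₀ ∈ S` and the mixed kernel otherwise. The scale
cancels, so only the law is rescaled and the bounds become linear in `t`. -/
theorem lawProb_mul_lawRatio_scaleTest (pX : ∀ l, X l → ℝ) (V : ∀ k, (∀ l, X l) → Y k → ℝ)
    (pU : ∀ k, Y k → U k → ℝ) (k₀ : Fin K) (t : U k₀ → ℝ) (T : Finset (Fin L))
    (S : Finset (Fin K)) (x : ∀ l, X l) (y : ∀ k, Y k) (u : ∀ k, U k) :
    lawProb pX V (scaleTest pU k₀ t) x y u *
      Real.logb 2 (lawRatio pX V (scaleTest pU k₀ t) T S x y u) =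
    t (u k₀) * (lawProb pX V pU x y u * Real.logb 2 (lawRatio pX V pU T S x y u)) := by
  have h1 : lawProb pX V (scaleTest pU k₀ t) x y u = t (u k₀) * lawProb pX V pU x y u := by
    simp_rw [lawProb, scaleTest_apply, prod_scale]
    simp only [Finset.mem_univ, if_true]; ring
  rcases eq_or_ne (t (u k₀)) 0 with h0 | h0
  · rw [h1, h0]; simp
  · have h2 : lawRatio pX V (scaleTest pU k₀ t) T S x y u = lawRatio pX V pU T S x y u := by
      simp_rw [lawRatio, partProb_scaleTest, outProb_scaleTest, scaleTest_apply, prod_scale]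
      simp only [Finset.mem_univ, if_true, Finset.mem_compl]
      by_cases h : k₀ ∈ S
      · simp only [h, if_true, not_true_eq_false, if_false, one_mul]
        rw [mul_assoc, mul_div_mul_left _ _ h0]
      · simp only [h, if_false, not_false_eq_true, if_true, one_mul]
        rw [mul_left_comm, mul_div_mul_left _ _ h0]
    rw [h1, h2]; ring

variable [∀ k, Fintype (U k)]

open Classical in
/-- The contribution of one value of `U_{k₀}` to the single-letter bounds. -/
def colVec (V : ∀ k, (∀ l, X l) → Y k → ℝ) (pX : ∀ l, X l → ℝ)
    (pU : ∀ k, Y k → U k → ℝ) (k₀ : Fin K) (w : U k₀)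
    (z : Finset (Fin L) × Finset (Fin K)) : ℝ :=
  ∑ x, ∑ y, ∑ u : ∀ k, U k, if u k₀ = w then
    lawProb pX V pU x y u * Real.logb 2 (lawRatio pX V pU z.1 z.2 x y u) else 0

theorem rateVec_scaleTest (C : Fin K → ℝ) (V : ∀ k, (∀ l, X l) → Y k → ℝ) (pX : ∀ l, X l → ℝ)
    (pU : ∀ k, Y k → U k → ℝ) (k₀ : Fin K) (t : U k₀ → ℝ)
    (z : Finset (Fin L) × Finset (Fin K)) :
    rateVec C V pX (scaleTest pU k₀ t) z =
      ∑ s ∈ z.2, C s + (∑ w, t w • colVec V pX pU k₀ w) z := by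
  classical
  simp_rw [rateVec, rateFun, lawProb_mul_lawRatio_scaleTest]
  congr 1
  simp only [Finset.sum_apply, Pi.smul_apply, smul_eq_mul, colVec, Finset.mul_sum]
  symm
  rw [Finset.sum_comm]
  refine Finset.sum_congr rfl fun x _ => ?_
  rw [Finset.sum_comm]
  refine Finset.sum_congr rfl fun y _ => ?_
  rw [Finset.sum_comm]
  refine Finset.sum_congr rfl fun u _ => ?_
  simp

omit [∀ l, Fintype (X l)] [∀ k, Fintype (Y k)] [∀ k, Fintype (U k)] in
theorem scaleTest_one (pU : ∀ k, Y k → U k → ℝ) (k₀ : Fin K) :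
    scaleTest pU k₀ (fun _ => 1) = pU := by
  simp [scaleTest]

/-- One test channel can be replaced by one with few outputs. -/
theorem exists_sparse_test (C : Fin K → ℝ) {V : ∀ k, (∀ l, X l) → Y k → ℝ} {pX : ∀ l, X l → ℝ}
    {pU : ∀ k, Y k → U k → ℝ} (h : IsLaw pX V pU) (k₀ : Fin K) :
    ∃ t : U k₀ → ℝ, IsLaw pX V (scaleTest pU k₀ t) ∧
      rateVec C V pX (scaleTest pU k₀ t) = rateVec C V pX pU ∧
      {u | t u ≠ 0}.ncard ≤ Module.finrank ℝ ((Y k₀ → ℝ) ×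
        (Finset (Fin L) × Finset (Fin K) → ℝ)) + 1 := by
  -- Preserving the sum of the first components keeps every row of the test channel stochastic;
  -- preserving that of the second components keeps all the bounds.
  obtain ⟨t, ht0, ht1, ht2⟩ := exists_sparse_sum
    (fun w : U k₀ => ((fun b => pU k₀ b w : Y k₀ → ℝ), colVec V pX pU k₀ w))
  refine ⟨t, ⟨h.input_mem, h.channel_mem, fun k b => ?_⟩, ?_, ht2⟩
  · rcases eq_or_ne k k₀ with rfl | hk
    · refine ⟨fun u => ?_, ?_⟩
      · simpa [scaleTest] using mul_nonneg (ht0 u) ((h.test_mem k b).1 u)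
      · have := congrFun (congrArg Prod.fst ht1) b
        simp only [Prod.smul_mk, Prod.fst_sum, Finset.sum_apply, Pi.smul_apply, smul_eq_mul] at this
        simpa [scaleTest, (h.test_mem k b).2] using this
    · simpa [scaleTest, hk] using h.test_mem k b
  · ext z
    have := congrFun (congrArg Prod.snd ht1) z
    simp only [Prod.smul_mk, Prod.snd_sum] at this
    rw [rateVec_scaleTest, this]
    conv_rhs => rw [← scaleTest_one pU k₀, rateVec_scaleTest]
    simp

/-- A number of outputs that suffices for every test channel. -/
def testCard (L : ℕ) {K : ℕ} (Y : Fin K → Type*) [∀ k, Fintype (Y k)] : ℕ :=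
  -- The last `+ 1` keeps the alphabet nonempty even without relays.
  ∑ k, (Module.finrank ℝ ((Y k → ℝ) × (Finset (Fin L) × Finset (Fin K) → ℝ)) + 1) + 1

/-- The relays are treated one at a time: rescaling one test channel leaves the sparsity already
achieved for the others intact. -/
theorem exists_sparse_tests (C : Fin K → ℝ) {V : ∀ k, (∀ l, X l) → Y k → ℝ} {pX : ∀ l, X l → ℝ}
    {pU : ∀ k, Y k → U k → ℝ} (h : IsLaw pX V pU) :
    ∃ pU' : ∀ k, Y k → U k → ℝ, IsLaw pX V pU' ∧ rateVec C V pX pU' = rateVec C V pX pU ∧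
      ∀ k, {u | ∃ b, pU' k b u ≠ 0}.ncard ≤ testCard L Y := by
  suffices H : ∀ B : Finset (Fin K), ∃ pU' : ∀ k, Y k → U k → ℝ, IsLaw pX V pU' ∧
      rateVec C V pX pU' = rateVec C V pX pU ∧
      ∀ k ∈ B, {u | ∃ b, pU' k b u ≠ 0}.ncard ≤ testCard L Y by
    obtain ⟨pU', h1, h2, h3⟩ := H Finset.univ
    exact ⟨pU', h1, h2, fun k => h3 k (Finset.mem_univ k)⟩
  intro B
  induction B using Finset.induction_on with
  | empty => exact ⟨pU, h, rfl, by simp⟩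
  | insert k₀ B _ ih =>
    obtain ⟨pU', h1, h2, h3⟩ := ih
    obtain ⟨t, ht1, ht2, ht3⟩ := exists_sparse_test C h1 k₀
    refine ⟨_, ht1, ht2.trans h2, fun k hk => ?_⟩
    rcases eq_or_ne k k₀ with rfl | hk'
    · refine (Set.ncard_le_ncard (t := {u | t u ≠ 0}) ?_ (Set.toFinite _)).trans (ht3.trans ?_)
      · rintro u ⟨b, hb⟩ h0
        simp [scaleTest, h0] at hb
      · exact (Finset.single_le_sum (f := fun k => Module.finrank ℝ ((Y k → ℝ) ×
          (Finset (Fin L) × Finset (Fin K) → ℝ)) + 1) (fun _ _ => Nat.zero_le _)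
          (Finset.mem_univ k)).trans (Nat.le_succ _)
    · have := h3 k (Finset.mem_of_mem_insert_of_ne hk hk')
      simpa [scaleTest, hk'] using this

/-- Relabelling the outputs of the test channels injectively on their supports. -/
theorem rateVec_mem_rateSet_of_sparse (C : Fin K → ℝ) {V : ∀ k, (∀ l, X l) → Y k → ℝ}
    {pX : ∀ l, X l → ℝ} {pU : ∀ k, Y k → U k → ℝ} (h : IsLaw pX V pU) {d : ℕ} (hd : 0 < d)
    (hcard : ∀ k, {u | ∃ b, pU k b u ≠ 0}.ncard ≤ d) :
    rateVec C V pX pU ∈ rateSet C V d := by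
  classical
  have : Nonempty (Fin d) := ⟨⟨0, hd⟩⟩
  have hex : ∀ k, ∃ e : U k → Fin d, Set.InjOn e {u | ∃ b, pU k b u ≠ 0} := by
    intro k
    obtain ⟨e, -, he⟩ := (Set.toFinite {u | ∃ b, pU k b u ≠ 0}).exists_injOn_of_encard_le
      (t := (Set.univ : Set (Fin d))) (by
        rw [← Set.Finite.cast_ncard_eq (Set.toFinite _),
          ← Set.Finite.cast_ncard_eq (Set.toFinite _), Set.ncard_univ, Nat.card_fin]
        exact_mod_cast hcard k)
    exact ⟨e, he⟩
  choose e he using hex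
  set pU' : ∀ k, Y k → Fin d → ℝ := fun k b j => ∑ u, if e k u = j then pU k b u else 0 with hpU'
  have hlaw : IsLaw pX V pU' := by
    refine ⟨h.input_mem, h.channel_mem, fun k b => ⟨fun j => Finset.sum_nonneg fun u _ => ?_, ?_⟩⟩
    · split_ifs
      exacts [(h.test_mem k b).1 u, le_rfl]
    · simp_rw [hpU']
      rw [Finset.sum_comm]
      simpa using (h.test_mem k b).2
  have htest : ∀ k b u, (∃ b', pU k b' u ≠ 0) → pU' k b (e k u) = pU k b u := by
    intro k b u hu
    simp_rw [hpU']
    rw [Finset.sum_eq_single u]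
    · simp
    · intro u' _ hne
      split_ifs with heq
      · by_contra h0
        exact hne (he k ⟨b, h0⟩ hu heq)
      · rfl
    · simp
  have hout : ∀ k x u, (∃ b', pU k b' u ≠ 0) → outProb V pU' k x (e k u) = outProb V pU k x u := by
    intro k x u hu
    exact Finset.sum_congr rfl fun b _ => by rw [htest k b u hu]
  refine ⟨pX, pU', hlaw, ?_⟩
  ext ⟨T, S⟩
  simp only [rateVec, rateFun]
  congr 1
  refine Finset.sum_congr rfl fun x _ => Finset.sum_congr rfl fun y _ => ?_
  have h1 := sum_prod_mul_comp (fun k => pU k (y k)) e (fun j =>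
    ((∏ l, pX l (x l)) * ∏ k, V k x (y k)) * Real.logb 2 (lawRatio pX V pU' T S x y j))
  have h2 : ∀ j : ∀ _ : Fin K, Fin d, lawProb pX V pU' x y j = (∏ k, ∑ u, if e k u = j k then
      pU k (y k) u else 0) * ((∏ l, pX l (x l)) * ∏ k, V k x (y k)) := fun j => mul_comm _ _
  simp_rw [h2, mul_assoc] at h1 ⊢
  rw [← h1]
  refine Finset.sum_congr rfl fun u _ => ?_
  by_cases hu : ∀ k, pU k (y k) (u k) ≠ 0
  · have hu' : ∀ k, ∃ b', pU k b' (u k) ≠ 0 := fun k => ⟨_, hu k⟩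
    have h3 : lawRatio pX V pU' T S x y (fun k => e k (u k)) = lawRatio pX V pU T S x y u := by
      unfold lawRatio partProb
      simp_rw [fun k x => hout k x (u k) (hu' k), fun k b => htest k b (u k) (hu' k)]
    rw [h3, lawProb]; ring
  -- A letter of probability zero contributes nothing, so only letters on which the relabelling is
  -- injective matter.
  · push Not at hu
    obtain ⟨k, hk⟩ := hu
    have h4 : ∏ k, pU k (y k) (u k) = 0 := Finset.prod_eq_zero (Finset.mem_univ k) hk
    rw [lawProb, h4]; ring

theorem rateVec_mem_rateSet (C : Fin K → ℝ) {V : ∀ k, (∀ l, X l) → Y k → ℝ}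
    {pX : ∀ l, X l → ℝ} {pU : ∀ k, Y k → U k → ℝ} (h : IsLaw pX V pU) :
    rateVec C V pX pU ∈ rateSet C V (testCard L Y) := by
  obtain ⟨pU', h1, h2, h3⟩ := exists_sparse_tests C h
  rw [← h2]
  exact rateVec_mem_rateSet_of_sparse C h1 (Nat.succ_pos _) h3

end

/-! ### Mixtures of laws and vanishing slack -/

section

variable [∀ k, Fintype (Y k)] [∀ l, Fintype (X l)]

/-- Rates that satisfy the bounds of a mixture of laws up to every positive slack lie in the
single-letter region. -/
theorem mem_singleLetterRegion_of_approx {W : (∀ l, X l) → (∀ k, Y k) → ℝ} (hW : IsChannel W)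
    {C : Fin K → ℝ} {R : Fin L → ℝ} (hR : ∀ l, 0 ≤ R l)
    (h : ∀ η : ℝ, 0 < η → ∃ v ∈ convexHull ℝ (rateSet C (marginal W) (testCard L Y)),
      ∀ T : Finset (Fin L), T.Nonempty → ∀ S : Finset (Fin K), ∑ t ∈ T, R t ≤ v (T, S) + η) :
    R ∈ singleLetterRegion W C := by
  set A := convexHull ℝ (rateSet C (marginal W) (testCard L Y)) with hA
  have hAc : IsCompact A :=
    isCompact_convexHull_of_finiteDimensional (isCompact_rateSet C (marginal_mem hW) _)
  obtain ⟨v, hvA, hv⟩ : ∃ v ∈ A, ∀ T : Finset (Fin L), T.Nonempty → ∀ S : Finset (Fin K),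
      ∑ t ∈ T, R t ≤ v (T, S) := by
    have hne : A.Nonempty := by
      obtain ⟨v, hv, -⟩ := h 1 one_pos
      exact ⟨v, hv⟩
    -- The total violation of the bounds is continuous and attains its minimum on the compact hull.
    -- It takes values below every positive `η` there, so a minimiser violates nothing.
    have hcont : Continuous fun v : Finset (Fin L) × Finset (Fin K) → ℝ =>
        ∑ z : Finset (Fin L) × Finset (Fin K),
          (if z.1.Nonempty then max (∑ t ∈ z.1, R t - v z) 0 else 0) := by
      refine continuous_finsetSum _ fun z _ => ?_
      split_ifs
      · fun_prop
      · fun_prop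
    obtain ⟨v, hv, hmin⟩ := hAc.exists_isMinOn hne hcont.continuousOn
    refine ⟨v, hv, fun T hT S => ?_⟩
    refine le_of_forall_pos_le_add fun η hη => ?_
    have hn : (0 : ℝ) < Fintype.card (Finset (Fin L) × Finset (Fin K)) := by
      exact_mod_cast Fintype.card_pos
    obtain ⟨v', hv', hb⟩ := h (η / Fintype.card (Finset (Fin L) × Finset (Fin K))) (by positivity)
    have h1 := hmin hv'
    simp only [Set.mem_ofPred_eq] at h1
    have h2 : ∑ z : Finset (Fin L) × Finset (Fin K),
        (if z.1.Nonempty then max (∑ t ∈ z.1, R t - v' z) 0 else 0) ≤ η := by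
      calc _ ≤ ∑ z : Finset (Fin L) × Finset (Fin K),
            η / Fintype.card (Finset (Fin L) × Finset (Fin K)) := by
            refine Finset.sum_le_sum fun z _ => ?_
            split_ifs with hz
            · exact max_le (by linarith [hb z.1 hz z.2]) (by positivity)
            · positivity
        _ = η := by
            rw [Finset.sum_const, Finset.card_univ, nsmul_eq_mul, mul_div_cancel₀ _ hn.ne']
    have h3 := Finset.single_le_sum (f := fun z : Finset (Fin L) × Finset (Fin K) =>
        (if z.1.Nonempty then max (∑ t ∈ z.1, R t - v z) 0 else 0)) (fun z _ => by
          split_ifs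
          exacts [le_max_right _ _, le_rfl]) (Finset.mem_univ (T, S))
    simp only [hT, if_true] at h3
    have h4 := le_max_left (∑ t ∈ T, R t - v (T, S)) 0
    linarith
  obtain ⟨ι, _, w, z, hw0, hw1, hz, rfl⟩ := mem_convexHull_iff_exists_fintype.1 hvA
  choose pX pU hlaw hrate using hz
  set e := Fintype.equivFin ι
  -- A point of the hull is a finite mixture of laws; the mixture index becomes `Q`.
  let P : TestLaw X Y :=
    { nQ := Fintype.card ι
      nU := fun _ => testCard L Y
      pQ := fun q => w (e.symm q)
      pQ_mem := ⟨fun q => hw0 _, by rw [Equiv.sum_comp e.symm w]; exact hw1⟩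
      pX := fun l q => pX (e.symm q) l
      pX_mem := fun l q => (hlaw _).input_mem l
      pU := fun k b q => pU (e.symm q) k b
      pU_mem := fun k b q => (hlaw _).test_mem k b }
  refine ⟨hR, P, fun T hT S => ?_⟩
  rw [P.bound_eq hW]
  refine (hv T hT S).trans (le_of_eq ?_)
  rw [Finset.sum_apply]
  simp only [Pi.smul_apply, smul_eq_mul, ← hrate]
  exact (Equiv.sum_comp e.symm fun i => w i * rateFun C (marginal W) (pX i) (pU i) T S).symm

end

end Reduction

/-! ## Exponential concentration for product laws -/

/-- The indicator of a proposition. -/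
def ind (Q : Prop) : ℝ := open Classical in if Q then 1 else 0

theorem ind_of {Q : Prop} (h : Q) : ind Q = 1 := by simp [ind, h]

theorem ind_of_not {Q : Prop} (h : ¬Q) : ind Q = 0 := by simp [ind, h]

theorem ind_nonneg (Q : Prop) : 0 ≤ ind Q := by
  by_cases h : Q
  · simp [ind_of h]
  · simp [ind_of_not h]

theorem ind_le_one (Q : Prop) : ind Q ≤ 1 := by
  by_cases h : Q
  · simp [ind_of h]
  · simp [ind_of_not h]

theorem ind_eq_ite (Q : Prop) [Decidable Q] : ind Q = if Q then 1 else 0 := by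
  by_cases h : Q
  · rw [ind_of h, if_pos h]
  · rw [ind_of_not h, if_neg h]

theorem ind_congr {Q Q' : Prop} (h : Q ↔ Q') : ind Q = ind Q' := by rw [propext h]

theorem ind_and (Q Q' : Prop) : ind (Q ∧ Q') = ind Q * ind Q' := by
  by_cases h : Q <;> by_cases h' : Q' <;> simp [ind, h, h']

theorem ind_forall {ι : Type*} [Fintype ι] (Q : ι → Prop) : ind (∀ i, Q i) = ∏ i, ind (Q i) := by
  classical
  by_cases h : ∀ i, Q i
  · rw [ind_of h, Finset.prod_eq_one fun i _ => ind_of (h i)]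
  · rw [ind_of_not h]
    push Not at h
    obtain ⟨i, hi⟩ := h
    rw [Finset.prod_eq_zero (Finset.mem_univ i) (ind_of_not hi)]

theorem ind_exists_le {ι : Type*} [Fintype ι] (Q : ι → Prop) : ind (∃ i, Q i) ≤ ∑ i, ind (Q i) := by
  by_cases h : ∃ i, Q i
  · obtain ⟨i, hi⟩ := h
    rw [ind_of ⟨i, hi⟩, ← ind_of hi]
    exact Finset.single_le_sum (f := fun i => ind (Q i)) (fun i _ => ind_nonneg _)
      (Finset.mem_univ i)
  · rw [ind_of_not h]
    exact Finset.sum_nonneg fun i _ => ind_nonneg _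

/-- Chernoff's bound: if `log g` has negative mean, the product of `g` along an i.i.d. sequence is at
least one with exponentially small probability. -/
theorem exists_chernoff {Ω : Type*} [Fintype Ω] {p : Ω → ℝ} (hp : p ∈ stdSimplex ℝ Ω)
    {g : Ω → ℝ} (hg : ∀ ω, 0 < p ω → 0 < g ω) (hneg : ∑ ω, p ω * Real.log (g ω) < 0) :
    ∃ ρ : ℝ, 0 ≤ ρ ∧ ρ < 1 ∧ ∀ n : ℕ,
      ∑ ω : Fin n → Ω, (∏ i, p (ω i)) * ind (1 ≤ ∏ i, g (ω i)) ≤ ρ ^ n := by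
  classical
  -- The moment generating function of `log g` has value one and negative slope at zero, hence is
  -- below one at some small `s > 0`; Markov's inequality with this `s` gives the rate. Writing `exp
  -- (s log g)` needs no sign of `g` off the support.
  set φ : ℝ → ℝ := fun s => ∑ ω, p ω * Real.exp (s * Real.log (g ω)) with hφ
  have hd : HasDerivAt φ (∑ ω, p ω * Real.log (g ω)) 0 := by
    have : ∀ ω, HasDerivAt (fun s : ℝ => p ω * Real.exp (s * Real.log (g ω)))
        (p ω * Real.log (g ω)) 0 := by
      intro ω
      have h1 : HasDerivAt (fun s : ℝ => s * Real.log (g ω)) (Real.log (g ω)) 0 := by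
        simpa using (hasDerivAt_id (0 : ℝ)).mul_const (Real.log (g ω))
      simpa using h1.exp.const_mul (p ω)
    exact HasDerivAt.fun_sum fun ω _ => this ω
  have h0 : φ 0 = 1 := by simp [hφ, hp.2]
  have hev := hd.tendsto_slope_zero_right.eventually (gt_mem_nhds hneg)
  obtain ⟨s, hs, hspos⟩ := (hev.and self_mem_nhdsWithin).exists
  have hspos : 0 < s := hspos
  have hlt : φ s < 1 := by
    rw [zero_add, h0, smul_eq_mul] at hs
    have := (mul_neg_iff.1 hs).resolve_right (fun h => absurd h.1 (by simpa using hspos.le))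
    linarith [this.2]
  refine ⟨φ s, Finset.sum_nonneg fun ω _ => mul_nonneg (hp.1 ω) (Real.exp_pos _).le, hlt,
    fun n => ?_⟩
  calc ∑ ω : Fin n → Ω, (∏ i, p (ω i)) * ind (1 ≤ ∏ i, g (ω i))
      ≤ ∑ ω : Fin n → Ω, ∏ i, (p (ω i) * Real.exp (s * Real.log (g (ω i)))) := by
        refine Finset.sum_le_sum fun ω _ => ?_
        rw [Finset.prod_mul_distrib]
        have hP : 0 ≤ ∏ i, p (ω i) := Finset.prod_nonneg fun i _ => hp.1 _
        rcases hP.eq_or_lt with h | h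
        · rw [← h]; simp
        refine mul_le_mul_of_nonneg_left ?_ hP
        by_cases h1 : 1 ≤ ∏ i, g (ω i)
        · rw [ind_of h1, ← Real.exp_sum, ← Finset.mul_sum]
          refine Real.one_le_exp (mul_nonneg hspos.le ?_)
          rw [← Real.log_prod]
          · exact Real.log_nonneg h1
          · intro i _
            refine (hg _ ((hp.1 _).lt_of_ne fun h2 => h.ne' ?_)).ne'
            exact Finset.prod_eq_zero (Finset.mem_univ i) h2.symm
        · rw [ind_of_not h1]
          exact Finset.prod_nonneg fun i _ => (Real.exp_pos _).le
    _ = φ s ^ n := by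
        rw [← Fintype.prod_sum (f := fun (_ : Fin n) ω => p ω * Real.exp (s * Real.log (g ω)))]
        simp [hφ]

/-! ## Random hashing -/

section Hash

variable {U : Type*} [Fintype U] {N G : ℕ}

/-- The uniform weight on `Fin N × Fin (G + 1)`. -/
def unif (N G : ℕ) (_ : Fin N × Fin (G + 1)) : ℝ := ((N : ℝ) * (G + 1))⁻¹

theorem sum_unif (hN : 0 < N) (G : ℕ) : ∑ z, unif N G z = 1 := by
  have : (N : ℝ) ≠ 0 := by exact_mod_cast hN.ne'
  have h' : (G : ℝ) + 1 ≠ 0 := by positivity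
  simp [unif]
  field_simp

theorem unif_nonneg (N G : ℕ) (z) : 0 ≤ unif N G z := by unfold unif; positivity

theorem sum_unif_mul_ind (hN : 0 < N) (G : ℕ) :
    ∑ z, unif N G z * ind (z.2 = 0) = ((G : ℝ) + 1)⁻¹ := by
  have : (N : ℝ) ≠ 0 := by exact_mod_cast hN.ne'
  simp only [ind_eq_ite, unif, Fintype.sum_prod_type, mul_ite, mul_one, mul_zero,
    Finset.sum_ite_eq', Finset.mem_univ, if_true, Finset.sum_const, Finset.card_univ,
    Fintype.card_fin, nsmul_eq_mul]
  field_simp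

variable [DecidableEq U]

/-- The probability that `u` survives and that `u'` survives in the same bin. -/
theorem sum_hash_pair (hN : 0 < N) (G : ℕ) (u u' : U) :
    ∑ h : U → Fin N × Fin (G + 1), (∏ a, unif N G (h a)) *
      (ind ((h u).2 = 0) * ind (h u' = ((h u).1, 0))) =
    ((G : ℝ) + 1)⁻¹ * if u' = u then 1 else ((N : ℝ) * (G + 1))⁻¹ := by
  have hN' : (N : ℝ) ≠ 0 := by exact_mod_cast hN.ne'
  rcases eq_or_ne u' u with rfl | hu
  · rw [if_pos rfl, mul_one, ← sum_unif_mul_ind hN G,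
      ← sum_prod_mul_eval (fun _ : U => unif N G) (fun _ => sum_unif hN G) u'
        (fun z => ind (z.2 = 0))]
    refine Finset.sum_congr rfl fun h _ => ?_
    congr 1
    rw [← ind_and]
    exact ind_congr ⟨fun h => h.1, fun h => ⟨h, Prod.ext rfl h⟩⟩
  · rw [if_neg hu, sum_prod_mul_eval₂ (fun _ : U => unif N G) (fun _ => sum_unif hN G) hu.symm
      (fun a b => ind (a.2 = 0) * ind (b = (a.1, 0)))]
    simp only [ind_eq_ite, unif, mul_ite, mul_one, mul_zero, Finset.sum_ite_eq', Finset.mem_univ,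
      if_true, Fintype.sum_prod_type, Finset.sum_const, Finset.card_univ, Fintype.card_fin,
      nsmul_eq_mul]
    field_simp

theorem sum_hash_single (hN : 0 < N) (G : ℕ) (u : U) :
    ∑ h : U → Fin N × Fin (G + 1), (∏ a, unif N G (h a)) * ind ((h u).2 = 0) =
    ((G : ℝ) + 1)⁻¹ := by
  rw [sum_prod_mul_eval (fun _ : U => unif N G) (fun _ => sum_unif hN G) u
        (fun z => ind (z.2 = 0)), sum_unif_mul_ind hN]

/-- The mass that survives hashing is rarely below half of its mean. -/
theorem sum_hash_bad_le (hN : 0 < N) (G : ℕ) {v : U → ℝ} (hv : v ∈ stdSimplex ℝ U) {τ : ℝ}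
    (hτ : 0 ≤ τ) :
    ∑ h : U → Fin N × Fin (G + 1), (∏ a, unif N G (h a)) *
      ind (∑ u, v u * ind (v u ≤ τ) * ind ((h u).2 = 0) < ((G : ℝ) + 1)⁻¹ / 2) ≤
    4 * ∑ u, v u * ind (τ < v u) + 16 * (G * τ) := by
  set θ : ℝ := ((G : ℝ) + 1)⁻¹ with hθ
  have hθ0 : 0 < θ := by positivity
  have hG : (G : ℝ) * θ = 1 - θ := by rw [hθ]; field_simp; ring
  set a : U → ℝ := fun u => v u * ind (v u ≤ τ) with ha
  set ε := ∑ u, v u * ind (τ < v u) with hε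
  have ha0 : ∀ u, 0 ≤ a u := fun u => mul_nonneg (hv.1 u) (ind_nonneg _)
  have hsum : ∑ u, a u = 1 - ε := by
    rw [eq_sub_iff_add_eq, ← Finset.sum_add_distrib, ← hv.2]
    refine Finset.sum_congr rfl fun u _ => ?_
    rw [ha]
    rcases le_or_gt (v u) τ with h | h
    · simp [ind_of h, ind_of_not h.not_gt]
    · simp [ind_of h, ind_of_not h.not_ge]
  have haτ : ∀ u, a u ≤ τ := by
    intro u
    rw [ha]
    by_cases h : v u ≤ τ
    · simpa [ind_of h] using h
    · simpa [ind_of_not h] using hτ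
  have hW : ∀ h : U → Fin N × Fin (G + 1), 0 ≤ ∏ a, unif N G (h a) := fun h =>
    Finset.prod_nonneg fun _ _ => unif_nonneg _ _ _
  have hε0 : 0 ≤ ε := Finset.sum_nonneg fun u _ => mul_nonneg (hv.1 u) (ind_nonneg _)
  set ξ : Fin N × Fin (G + 1) → ℝ := fun z => ind (z.2 = 0) - θ with hξ
  have hmean : ∑ z, unif N G z * ξ z = 0 := by
    simp_rw [hξ, mul_sub]
    rw [Finset.sum_sub_distrib, sum_unif_mul_ind hN, ← Finset.sum_mul, sum_unif hN, one_mul, sub_self]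
  have hvar : ∑ z, unif N G z * (ξ z * ξ z) = θ * (G * θ) := by
    have : ∀ z : Fin N × Fin (G + 1), unif N G z * (ξ z * ξ z) =
        unif N G z * ind (z.2 = 0) * (1 - 2 * θ) + unif N G z * θ ^ 2 := by
      intro z
      by_cases h : z.2 = 0
      · simp only [hξ, ind_of h]; ring
      · simp only [hξ, ind_of_not h]; ring
    simp_rw [this]
    rw [Finset.sum_add_distrib, ← Finset.sum_mul, ← Finset.sum_mul, sum_unif_mul_ind hN,
      sum_unif hN, hG]
    ring
  have hcov : ∀ u u', ∑ h : U → Fin N × Fin (G + 1), (∏ a, unif N G (h a)) *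
      (ξ (h u) * ξ (h u')) = if u = u' then θ * (G * θ) else 0 := by
    intro u u'
    split_ifs with huu
    · subst huu
      rw [sum_prod_mul_eval (fun _ : U => unif N G) (fun _ => sum_unif hN G) u
        (fun z => ξ z * ξ z), hvar]
    · rw [sum_prod_mul_eval₂ (fun _ : U => unif N G) (fun _ => sum_unif hN G) huu
        (fun z z' => ξ z * ξ z')]
      refine Finset.sum_eq_zero fun z _ => ?_
      have : ∀ b, unif N G z * unif N G b * (ξ z * ξ b) =
        unif N G z * ξ z * (unif N G b * ξ b) := fun b => by ring
      simp_rw [this]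
      rw [← Finset.mul_sum, hmean, mul_zero]
  have hpt : ∀ h : U → Fin N × Fin (G + 1),
      ind (∑ u, a u * ind ((h u).2 = 0) < θ / 2) ≤
        4 * ε + 16 / θ ^ 2 * ∑ u, ∑ u', a u * a u' * (ξ (h u) * ξ (h u')) := by
    intro h
    have hsq : ∑ u, ∑ u', a u * a u' * (ξ (h u) * ξ (h u')) = (∑ u, a u * ξ (h u)) ^ 2 := by
      rw [sq, Finset.sum_mul_sum]
      exact Finset.sum_congr rfl fun u _ => Finset.sum_congr rfl fun u' _ => by ring
    rw [hsq]
    by_cases hb : ∑ u, a u * ind ((h u).2 = 0) < θ / 2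
    · rw [ind_of hb]
      have hξs : ∑ u, a u * ξ (h u) = ∑ u, a u * ind ((h u).2 = 0) - (1 - ε) * θ := by
        rw [hξ, ← hsum, Finset.sum_mul, ← Finset.sum_sub_distrib]
        exact Finset.sum_congr rfl fun u _ => by ring
      -- For `ε ≥ 1/4` the bound is trivial. Otherwise the mean `(1-ε)θ` exceeds `3θ/4`, so falling
      -- below `θ/2` is a deviation of at least `θ/4`; this is the origin of the constants 4 and 16.
      rcases le_or_gt (1 / 4) ε with h4 | h4
      · have : 0 ≤ 16 / θ ^ 2 * (∑ u, a u * ξ (h u)) ^ 2 := by positivity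
        linarith
      · have h5 : ∑ u, a u * ξ (h u) ≤ -(θ / 4) := by
          rw [hξs]; nlinarith
        have h6 : (θ / 4) ^ 2 ≤ (∑ u, a u * ξ (h u)) ^ 2 := by nlinarith
        have h7 : 16 / θ ^ 2 * (θ / 4) ^ 2 = 1 := by field_simp; norm_num
        have h8 : 16 / θ ^ 2 * (θ / 4) ^ 2 ≤ 16 / θ ^ 2 * (∑ u, a u * ξ (h u)) ^ 2 := by gcongr
        linarith
    · rw [ind_of_not hb]; positivity
  calc _ ≤ ∑ h : U → Fin N × Fin (G + 1), (∏ a, unif N G (h a)) *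
        (4 * ε + 16 / θ ^ 2 * ∑ u, ∑ u', a u * a u' * (ξ (h u) * ξ (h u'))) :=
        Finset.sum_le_sum fun h _ => mul_le_mul_of_nonneg_left (hpt h) (hW h)
    _ = 4 * ε + 16 / θ ^ 2 * ∑ u, ∑ u', a u * a u' *
          ∑ h : U → Fin N × Fin (G + 1), (∏ a, unif N G (h a)) * (ξ (h u) * ξ (h u')) := by
        simp_rw [mul_add]
        rw [Finset.sum_add_distrib, ← Finset.sum_mul,
          sum_prod_eq_one (fun _ : U => unif N G) (fun _ => sum_unif hN G), one_mul]
        congr 1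
        simp_rw [Finset.mul_sum]
        rw [Finset.sum_comm]
        refine Finset.sum_congr rfl fun u _ => ?_
        rw [Finset.sum_comm]
        refine Finset.sum_congr rfl fun u' _ => Finset.sum_congr rfl fun h _ => ?_
        ring
    _ = 4 * ε + 16 * (G * ∑ u, a u * a u) := by
        simp_rw [hcov]
        simp only [mul_ite, mul_zero, Finset.sum_ite_eq, Finset.mem_univ, if_true]
        rw [← Finset.sum_mul]
        field_simp
    _ ≤ 4 * ε + 16 * (G * τ) := by
        gcongr
        calc ∑ u, a u * a u ≤ ∑ u, a u * τ :=
              Finset.sum_le_sum fun u _ => mul_le_mul_of_nonneg_left (haτ u) (ha0 u)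
          _ = (1 - ε) * τ := by rw [← Finset.sum_mul, hsum]
          _ ≤ τ := by nlinarith

omit [DecidableEq U] in
/-- A stochastic quantizer that only uses the surviving points. -/
theorem exists_quantizer {B : Type*} {v : B → U → ℝ} (hv : ∀ b, v b ∈ stdSimplex ℝ U) (τ : ℝ)
    (h : U → Fin N × Fin (G + 1)) :
    ∃ κ : B → U → ℝ, (∀ b, κ b ∈ stdSimplex ℝ U) ∧ ∀ b,
      ¬ ∑ u, v b u * ind (v b u ≤ τ) * ind ((h u).2 = 0) < ((G : ℝ) + 1)⁻¹ / 2 →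
      ∀ u, κ b u ≤ 2 * (G + 1) * v b u * ind ((h u).2 = 0) := by
  classical
  set Z : B → ℝ := fun b => ∑ u, v b u * ind (v b u ≤ τ) * ind ((h u).2 = 0) with hZ
  refine ⟨fun b => if Z b < ((G : ℝ) + 1)⁻¹ / 2 then v b else
    fun u => v b u * ind (v b u ≤ τ) * ind ((h u).2 = 0) / Z b, fun b => ?_, fun b hb u => ?_⟩
  · dsimp only
    split_ifs with hb
    · exact hv b
    · have hpos : 0 < Z b := lt_of_lt_of_le (by positivity) (not_lt.1 hb)
      refine ⟨fun u => div_nonneg (mul_nonneg (mul_nonneg ((hv b).1 u) (ind_nonneg _))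
        (ind_nonneg _)) hpos.le, ?_⟩
      rw [← Finset.sum_div, div_self hpos.ne']
  · have hb' : ¬ Z b < ((G : ℝ) + 1)⁻¹ / 2 := hb
    simp only [hb', if_false]
    have hle : ((G : ℝ) + 1)⁻¹ / 2 ≤ Z b := not_lt.1 hb
    have hpos : 0 < Z b := lt_of_lt_of_le (by positivity) hle
    rw [div_le_iff₀ hpos]
    have h1 : 1 ≤ 2 * ((G : ℝ) + 1) * Z b := by
      have : 2 * ((G : ℝ) + 1) * (((G : ℝ) + 1)⁻¹ / 2) = 1 := by field_simp
      exact this.ge.trans (mul_le_mul_of_nonneg_left hle (by positivity))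
    have h2 : 0 ≤ v b u * ind ((h u).2 = 0) := mul_nonneg ((hv b).1 u) (ind_nonneg _)
    calc v b u * ind (v b u ≤ τ) * ind ((h u).2 = 0)
        = v b u * ind ((h u).2 = 0) * ind (v b u ≤ τ) := by ring
      _ ≤ v b u * ind ((h u).2 = 0) * 1 := mul_le_mul_of_nonneg_left (ind_le_one _) h2
      _ ≤ v b u * ind ((h u).2 = 0) * (2 * ((G : ℝ) + 1) * Z b) :=
          mul_le_mul_of_nonneg_left h1 h2
      _ = _ := by ring

end Hash

/-- Stochastic relays can be replaced by deterministic ones. -/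
theorem exists_deterministic {Z : Type*} [Fintype Z] {K : ℕ} {B : Fin K → Type*} {U : Fin K → Type*}
    [∀ k, Fintype (B k)] [∀ k, Fintype (U k)] (w : Z → (∀ k, B k) → ℝ) (ℓ : Z → (∀ k, U k) → ℝ)
    {κ : ∀ k, B k → U k → ℝ} (hκ : ∀ k b, κ k b ∈ stdSimplex ℝ (U k)) :
    ∃ A : ∀ k, B k → U k, ∑ z, ∑ b, w z b * ℓ z (fun k => A k (b k)) ≤
      ∑ z, ∑ b, w z b * ∑ u : ∀ k, U k, (∏ k, κ k (b k) (u k)) * ℓ z u := by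
  classical
  -- Draw the answer of every relay to every observation independently. Each realised observation
  -- consults only its own answer, so the mean loss is that of the stochastic relays.
  refine exists_le_of_sum_le (fun A : ∀ k, B k → U k => ∏ k, ∏ b, κ k b (A k b))
    (fun A => ∑ z, ∑ b, w z b * ℓ z (fun k => A k (b k)))
    (fun A => Finset.prod_nonneg fun k _ => Finset.prod_nonneg fun b _ => (hκ k b).1 _) ?_
    (le_of_eq ?_)
  · rw [← Fintype.prod_sum (f := fun k (A : B k → U k) => ∏ b, κ k b (A b))]
    exact Finset.prod_eq_one fun k _ => sum_prod_eq_one (κ k) fun b => (hκ k b).2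
  · simp_rw [Finset.mul_sum]
    rw [Finset.sum_comm]
    refine Finset.sum_congr rfl fun z _ => ?_
    rw [Finset.sum_comm]
    refine Finset.sum_congr rfl fun b _ => ?_
    have h1 := sum_prod_mul_comp (fun k (A : B k → U k) => ∏ b, κ k b (A b)) (fun k A => A (b k))
      (ℓ z)
    have h2 : ∀ k (u : U k), (∑ A : B k → U k, if A (b k) = u then ∏ b, κ k b (A b) else 0) =
        κ k (b k) u := by
      intro k u
      have := sum_prod_mul_eval (κ k) (fun b => (hκ k b).2) (b k) (fun a => if a = u then 1 else 0)
      simpa using this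
    simp_rw [h2] at h1
    rw [← Finset.mul_sum, ← h1, Finset.mul_sum]
    exact Finset.sum_congr rfl fun A _ => by ring

/-! ## A one-shot coding theorem -/

section OneShot

variable {L K : ℕ} {A : Fin L → Type*} {B : Fin K → Type*} {U : Fin K → Type*}
  [∀ l, Fintype (A l)] [∀ k, Fintype (B k)] [∀ k, Fintype (U k)]
  {M : Fin L → ℕ} {N G : Fin K → ℕ}

/-- The codewords selected by the messages. -/
def codeword (c : ∀ l, Fin (M l) → A l) (m : ∀ l, Fin (M l)) : ∀ l, A l := fun l => c l (m l)

/-- The messages are consistent with the bins: some surviving points in the bins are typical with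
the codewords. -/
def Consistent (typ : (∀ l, A l) → (∀ k, U k) → Prop) (h : ∀ k, U k → Fin (N k) × Fin (G k + 1))
    (c : ∀ l, Fin (M l) → A l) (j : ∀ k, Fin (N k)) (m : ∀ l, Fin (M l)) : Prop :=
  ∃ u, (∀ k, h k (u k) = (j k, 0)) ∧ typ (codeword c m) u

open Classical in
/-- Decode to any consistent messages. -/
def decode (typ : (∀ l, A l) → (∀ k, U k) → Prop) (h : ∀ k, U k → Fin (N k) × Fin (G k + 1))
    (m₀ : ∀ l, Fin (M l)) (c : ∀ l, Fin (M l) → A l) (j : ∀ k, Fin (N k)) : ∀ l, Fin (M l) :=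
  if hm : ∃ m, Consistent typ h c j m then hm.choose else m₀

/-- A bound on the indicator of a decoding error. -/
def confusion (typ : (∀ l, A l) → (∀ k, U k) → Prop) (h : ∀ k, U k → Fin (N k) × Fin (G k + 1))
    (c : ∀ l, Fin (M l) → A l) (m : ∀ l, Fin (M l)) (u : ∀ k, U k) : ℝ :=
  ind (¬ typ (codeword c m) u) + ∑ m', ind (m' ≠ m) * ∑ u',
    ind (typ (codeword c m') u') * ∏ k, ind (h k (u' k) = ((h k (u k)).1, 0))

omit [∀ l, Fintype (A l)] in
theorem confusion_nonneg (typ : (∀ l, A l) → (∀ k, U k) → Prop)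
    (h : ∀ k, U k → Fin (N k) × Fin (G k + 1))
    (c : ∀ l, Fin (M l) → A l) (m : ∀ l, Fin (M l)) (u : ∀ k, U k) :
    0 ≤ confusion typ h c m u :=
  add_nonneg (ind_nonneg _) (Finset.sum_nonneg fun _ _ => mul_nonneg (ind_nonneg _)
    (Finset.sum_nonneg fun _ _ => mul_nonneg (ind_nonneg _)
      (Finset.prod_nonneg fun _ _ => ind_nonneg _)))

omit [∀ l, Fintype (A l)] in
theorem ind_decode_le (typ : (∀ l, A l) → (∀ k, U k) → Prop)
    (h : ∀ k, U k → Fin (N k) × Fin (G k + 1)) (m₀ : ∀ l, Fin (M l))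
    (c : ∀ l, Fin (M l) → A l) (m : ∀ l, Fin (M l)) (u : ∀ k, U k) (hu : ∀ k, (h k (u k)).2 = 0) :
    ind (decode typ h m₀ c (fun k => (h k (u k)).1) ≠ m) ≤ confusion typ h c m u := by
  classical
  by_cases hd : decode typ h m₀ c (fun k => (h k (u k)).1) = m
  · rw [ind_of_not (not_not.2 hd)]
    exact confusion_nonneg typ h c m u
  rw [ind_of hd]
  have hnn : ∀ m' u', 0 ≤ ind (typ (codeword c m') u') *
      ∏ k, ind (h k (u' k) = ((h k (u k)).1, 0)) := fun m' u' =>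
    mul_nonneg (ind_nonneg _) (Finset.prod_nonneg fun _ _ => ind_nonneg _)
  have hnn' : ∀ m', 0 ≤ ind (m' ≠ m) * ∑ u',
    ind (typ (codeword c m') u') * ∏ k, ind (h k (u' k) = ((h k (u k)).1, 0)) := fun m' =>
    mul_nonneg (ind_nonneg _) (Finset.sum_nonneg fun u' _ => hnn m' u')
  by_cases ht : typ (codeword c m) u
  -- The true messages are consistent, so the decoder does choose; a wrong choice and its witness
  -- `u'` form one of the counted terms.
  · have hex : ∃ m, Consistent typ h c (fun k => (h k (u k)).1) m :=
      ⟨m, u, fun k => Prod.ext rfl (hu k), ht⟩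
    rw [decode, dif_pos hex] at hd
    obtain ⟨u', hu', ht'⟩ := hex.choose_spec
    unfold confusion
    have h1 := Finset.single_le_sum (fun m' _ => hnn' m') (Finset.mem_univ hex.choose)
    have h2 := Finset.single_le_sum (fun u' _ => hnn hex.choose u') (Finset.mem_univ u')
    rw [ind_of ht', one_mul, Finset.prod_eq_one fun k _ => ind_of (hu' k)] at h2
    rw [ind_of hd, one_mul] at h1
    have := ind_nonneg (¬ typ (codeword c m) u)
    linarith
  · unfold confusion
    rw [ind_of ht]
    have := Finset.sum_nonneg fun m' (_ : m' ∈ Finset.univ) => hnn' m'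
    linarith

/-- The error probability of a one-shot code, with random codebooks. -/
def oneShotError (pX : ∀ l, A l → ℝ) (V : ∀ k, (∀ l, A l) → B k → ℝ)
    (r : ∀ k, B k → Fin (N k))
    (g : (∀ l, Fin (M l) → A l) → (∀ k, Fin (N k)) → ∀ l, Fin (M l)) : ℝ :=
  ∑ z : (∀ l, Fin (M l) → A l) × (∀ l, Fin (M l)), ∑ b : ∀ k, B k,
    ((∏ l, ∏ i, pX l (z.1 l i)) * (∏ l, (M l : ℝ)⁻¹) * ∏ k, V k (codeword z.1 z.2) (b k)) *
      ind (g z.1 (fun k => r k (b k)) ≠ z.2)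

/-- The event that too little mass survives the hashing at relay `k`. -/
def Bad (pU : ∀ k, B k → U k → ℝ) (τ : Fin K → ℝ) (h : ∀ k, U k → Fin (N k) × Fin (G k + 1))
    (b : ∀ k, B k) (k : Fin K) : Prop :=
  ∑ u, pU k (b k) u * ind (pU k (b k) u ≤ τ k) * ind ((h k u).2 = 0) < ((G k : ℝ) + 1)⁻¹ / 2

variable {pX : ∀ l, A l → ℝ} {V : ∀ k, (∀ l, A l) → B k → ℝ} {pU : ∀ k, B k → U k → ℝ}

/-- For a fixed hash function there are deterministic relays whose error is at most the sum of the
probabilities of bad hashing and of confusion. -/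
theorem exists_relay_of_hash (hlaw : IsLaw pX V pU) (τ : Fin K → ℝ)
    (typ : (∀ l, A l) → (∀ k, U k) → Prop) (h : ∀ k, U k → Fin (N k) × Fin (G k + 1))
    (m₀ : ∀ l, Fin (M l)) :
    ∃ r : ∀ k, B k → Fin (N k), oneShotError pX V r (decode typ h m₀) ≤
      ∑ z : (∀ l, Fin (M l) → A l) × (∀ l, Fin (M l)), ∑ b : ∀ k, B k,
        ((∏ l, ∏ i, pX l (z.1 l i)) * (∏ l, (M l : ℝ)⁻¹) * ∏ k, V k (codeword z.1 z.2) (b k)) *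
        (∑ k, ind (Bad pU τ h b k) + ∑ u : ∀ k, U k,
          (∏ k, 2 * ((G k : ℝ) + 1) * pU k (b k) (u k) * ind ((h k (u k)).2 = 0)) *
            confusion typ h z.1 z.2 u) := by
  classical
  choose κ hκ hκ' using fun k => exists_quantizer (hlaw.test_mem k) (τ k) (h k)
  obtain ⟨a, ha⟩ := exists_deterministic
    (fun (z : (∀ l, Fin (M l) → A l) × (∀ l, Fin (M l))) b => (∏ l, ∏ i, pX l (z.1 l i)) *
      (∏ l, (M l : ℝ)⁻¹) * ∏ k, V k (codeword z.1 z.2) (b k))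
    (fun z u => ind (decode typ h m₀ z.1 (fun k => (h k (u k)).1) ≠ z.2)) hκ
  refine ⟨fun k b => (h k (a k b)).1, ha.trans ?_⟩
  refine Finset.sum_le_sum fun z _ => Finset.sum_le_sum fun b _ => mul_le_mul_of_nonneg_left ?_ ?_
  · have hbad : 0 ≤ ∑ k, ind (Bad pU τ h b k) := Finset.sum_nonneg fun _ _ => ind_nonneg _
    have hfac : ∀ k u, 0 ≤ 2 * ((G k : ℝ) + 1) * pU k (b k) u * ind ((h k u).2 = 0) := fun k u =>
      mul_nonneg (mul_nonneg (by positivity) ((hlaw.test_mem k _).1 _)) (ind_nonneg _)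
    have hconf : 0 ≤ ∑ u : ∀ k, U k,
        (∏ k, 2 * ((G k : ℝ) + 1) * pU k (b k) (u k) * ind ((h k (u k)).2 = 0)) *
            confusion typ h z.1 z.2 u :=
      Finset.sum_nonneg fun u _ => mul_nonneg (Finset.prod_nonneg fun k _ => hfac k _)
        (confusion_nonneg _ _ _ _ _)
    -- A bad relay is charged the trivial error one. Otherwise every quantizer is dominated by its
    -- rescaled test channel, which vanishes off the survivors.
    by_cases hb : ∃ k, Bad pU τ h b k
    · obtain ⟨k, hk⟩ := hb
      have h1 : 1 ≤ ∑ k, ind (Bad pU τ h b k) := by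
        rw [← ind_of hk]
        exact Finset.single_le_sum (f := fun k => ind (Bad pU τ h b k))
          (fun _ _ => ind_nonneg _) (Finset.mem_univ k)
      have h2 : ∑ u : ∀ k, U k, (∏ k, κ k (b k) (u k)) *
          ind (decode typ h m₀ z.1 (fun k => (h k (u k)).1) ≠ z.2) ≤
          ∑ u : ∀ k, U k, ∏ k, κ k (b k) (u k) :=
        Finset.sum_le_sum fun u _ => mul_le_of_le_one_right
          (Finset.prod_nonneg fun k _ => (hκ k _).1 _) (ind_le_one _)
      rw [sum_prod_eq_one (fun k => κ k (b k)) fun k => (hκ k _).2] at h2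
      linarith
    · push Not at hb
      refine le_trans (Finset.sum_le_sum fun u _ => ?_) (le_add_of_nonneg_left hbad)
      by_cases hu : ∀ k, (h k (u k)).2 = 0
      · exact mul_le_mul (Finset.prod_le_prod (fun k _ => (hκ k _).1 _)
          fun k _ => hκ' k (b k) (hb k) (u k)) (ind_decode_le typ h m₀ z.1 z.2 u hu)
          (ind_nonneg _) (Finset.prod_nonneg fun k _ => hfac k _)
      · push Not at hu
        obtain ⟨k, hk⟩ := hu
        have h0 : κ k (b k) (u k) = 0 := by
          refine le_antisymm ?_ ((hκ k _).1 _)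
          have := hκ' k (b k) (hb k) (u k)
          rwa [ind_of_not hk, mul_zero] at this
        rw [Finset.prod_eq_zero (Finset.mem_univ k) h0, zero_mul]
        exact mul_nonneg (Finset.prod_nonneg fun k _ => hfac k _) (confusion_nonneg _ _ _ _ _)
  · exact mul_nonneg (mul_nonneg (Finset.prod_nonneg fun l _ => Finset.prod_nonneg fun i _ =>
      (hlaw.input_mem l).1 _) (Finset.prod_nonneg fun l _ => by positivity))
      (Finset.prod_nonneg fun k _ => (hlaw.channel_mem k _).1 _)

variable [∀ k, DecidableEq (U k)]

/-- The weight of a family of uniformly random hash functions. -/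
def hashWeight (h : ∀ k, U k → Fin (N k) × Fin (G k + 1)) : ℝ :=
  ∏ k, ∏ a, unif (N k) (G k) (h k a)

/-- The confusion averaged over the hash functions, relative to the survival probability. -/
def avgConfusion (N G : Fin K → ℕ) (typ : (∀ l, A l) → (∀ k, U k) → Prop)
    (c : ∀ l, Fin (M l) → A l) (m : ∀ l, Fin (M l)) (u : ∀ k, U k) : ℝ :=
  ind (¬ typ (codeword c m) u) + ∑ m', ind (m' ≠ m) * ∑ u',
    ind (typ (codeword c m') u') * ∏ k, if u' k = u k then 1 else ((N k : ℝ) * (G k + 1))⁻¹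

theorem sum_hashWeight (hN : ∀ k, 0 < N k) :
    ∑ h : ∀ k, U k → Fin (N k) × Fin (G k + 1), hashWeight h = 1 := by
  classical
  unfold hashWeight
  rw [← Fintype.prod_sum (f := fun k (h : U k → Fin (N k) × Fin (G k + 1)) =>
    ∏ a, unif (N k) (G k) (h a))]
  exact Finset.prod_eq_one fun k _ => sum_prod_eq_one (fun _ : U k => unif (N k) (G k))
    fun _ => sum_unif (hN k) _

theorem sum_hashWeight_mul_prod (F : ∀ k, (U k → Fin (N k) × Fin (G k + 1)) → ℝ) :
    ∑ h : ∀ k, U k → Fin (N k) × Fin (G k + 1), hashWeight h * ∏ k, F k (h k) =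
      ∏ k, ∑ h : U k → Fin (N k) × Fin (G k + 1), (∏ a, unif (N k) (G k) (h a)) * F k h := by
  classical
  rw [Fintype.prod_sum]
  exact Finset.sum_congr rfl fun h _ => by rw [hashWeight, Finset.prod_mul_distrib]

theorem sum_hashWeight_bad_le (hlaw : IsLaw pX V pU) (hN : ∀ k, 0 < N k) {τ : Fin K → ℝ}
    (hτ : ∀ k, 0 ≤ τ k) (b : ∀ k, B k) (k : Fin K) :
    ∑ h : ∀ k, U k → Fin (N k) × Fin (G k + 1), hashWeight h * ind (Bad pU τ h b k) ≤
      4 * ∑ u, pU k (b k) u * ind (τ k < pU k (b k) u) + 16 * (G k * τ k) := by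
  classical
  refine le_trans (le_of_eq ?_) (sum_hash_bad_le (hN k) (G k) (hlaw.test_mem k (b k)) (hτ k))
  have h1 := sum_hashWeight_mul_prod (N := N) (G := G) (U := U) (fun k' h => if k' = k then
    ind (∑ u, pU k' (b k') u * ind (pU k' (b k') u ≤ τ k') * ind ((h u).2 = 0) <
      ((G k' : ℝ) + 1)⁻¹ / 2) else 1)
  rw [Finset.prod_eq_single (a := k)] at h1
  · simp only [if_true, Finset.prod_ite_eq', Finset.mem_univ] at h1
    exact h1
  · intro k' _ hk'
    simp only [hk', if_false, mul_one]
    exact sum_prod_eq_one (fun _ : U k' => unif (N k') (G k')) fun _ => sum_unif (hN k') _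
  · simp

-- Given that `u k` survives, a different `u' k` survives in the same bin with probability
-- `1/(N_k(G_k+1))`, while `u' k = u k` comes for free; the relays hash independently.
omit [∀ l, Fintype (A l)] in
theorem sum_hashWeight_confusion (hN : ∀ k, 0 < N k) (typ : (∀ l, A l) → (∀ k, U k) → Prop)
    (c : ∀ l, Fin (M l) → A l) (m : ∀ l, Fin (M l)) (u : ∀ k, U k) :
    ∑ h : ∀ k, U k → Fin (N k) × Fin (G k + 1), hashWeight h *
      ((∏ k, ind ((h k (u k)).2 = 0)) * confusion typ h c m u) =
      (∏ k, ((G k : ℝ) + 1)⁻¹) * avgConfusion N G typ c m u := by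
  classical
  have h1 : ∀ u' : ∀ k, U k, ∑ h : ∀ k, U k → Fin (N k) × Fin (G k + 1), hashWeight h *
      ∏ k, (ind ((h k (u k)).2 = 0) * ind (h k (u' k) = ((h k (u k)).1, 0))) =
      (∏ k, ((G k : ℝ) + 1)⁻¹) * ∏ k, if u' k = u k then 1 else ((N k : ℝ) * (G k + 1))⁻¹ := by
    intro u'
    rw [sum_hashWeight_mul_prod (fun k h =>
      ind ((h (u k)).2 = 0) * ind (h (u' k) = ((h (u k)).1, 0))), ← Finset.prod_mul_distrib]
    exact Finset.prod_congr rfl fun k _ => sum_hash_pair (hN k) (G k) (u k) (u' k)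
  have h2 : ∑ h : ∀ k, U k → Fin (N k) × Fin (G k + 1), hashWeight h *
      ∏ k, ind ((h k (u k)).2 = 0) = ∏ k, ((G k : ℝ) + 1)⁻¹ := by
    rw [sum_hashWeight_mul_prod (fun k h => ind ((h (u k)).2 = 0))]
    exact Finset.prod_congr rfl fun k _ => sum_hash_single (hN k) (G k) (u k)
  simp_rw [confusion, avgConfusion, mul_add (Finset.prod _ _), mul_add (hashWeight _)]
  rw [Finset.sum_add_distrib, ← h2]
  congr 1
  · rw [Finset.sum_mul]
    exact Finset.sum_congr rfl fun h _ => by ring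
  · rw [h2]
    simp_rw [Finset.mul_sum]
    rw [Finset.sum_comm]
    refine Finset.sum_congr rfl fun m' _ => ?_
    rw [Finset.sum_comm]
    refine Finset.sum_congr rfl fun u' _ => ?_
    rw [mul_left_comm (∏ k, ((G k : ℝ) + 1)⁻¹), mul_left_comm (∏ k, ((G k : ℝ) + 1)⁻¹), ← h1 u',
      Finset.mul_sum, Finset.mul_sum]
    refine Finset.sum_congr rfl fun h _ => ?_
    rw [Finset.prod_mul_distrib]; ring

/-- There are relays and a decoder whose error is bounded by the hashing and confusion terms averaged
over the hash functions. -/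
theorem exists_code_avg (hlaw : IsLaw pX V pU) (hN : ∀ k, 0 < N k) {τ : Fin K → ℝ}
    (hτ : ∀ k, 0 ≤ τ k) (typ : (∀ l, A l) → (∀ k, U k) → Prop) (m₀ : ∀ l, Fin (M l)) :
    ∃ (r : ∀ k, B k → Fin (N k))
      (g : (∀ l, Fin (M l) → A l) → (∀ k, Fin (N k)) → ∀ l, Fin (M l)),
      oneShotError pX V r g ≤
      ∑ z : (∀ l, Fin (M l) → A l) × (∀ l, Fin (M l)), ∑ b : ∀ k, B k,
        ((∏ l, ∏ i, pX l (z.1 l i)) * (∏ l, (M l : ℝ)⁻¹) * ∏ k, V k (codeword z.1 z.2) (b k)) *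
        (∑ k, (4 * ∑ u, pU k (b k) u * ind (τ k < pU k (b k) u) + 16 * (G k * τ k)) +
          2 ^ K * ∑ u : ∀ k, U k, (∏ k, pU k (b k) (u k)) * avgConfusion N G typ z.1 z.2 u) := by
  classical
  have hh := exists_le_of_sum_le (α := ∀ k, U k → Fin (N k) × Fin (G k + 1)) hashWeight
    (fun h => ∑ z : (∀ l, Fin (M l) → A l) × (∀ l, Fin (M l)), ∑ b : ∀ k, B k,
        ((∏ l, ∏ i, pX l (z.1 l i)) * (∏ l, (M l : ℝ)⁻¹) * ∏ k, V k (codeword z.1 z.2) (b k)) *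
        (∑ k, ind (Bad pU τ h b k) + ∑ u : ∀ k, U k,
          (∏ k, 2 * ((G k : ℝ) + 1) * pU k (b k) (u k) * ind ((h k (u k)).2 = 0)) *
            confusion typ h z.1 z.2 u))
    (fun h => Finset.prod_nonneg fun k _ => Finset.prod_nonneg fun a _ => unif_nonneg _ _ _)
    (sum_hashWeight hN) (B := ∑ z : (∀ l, Fin (M l) → A l) × (∀ l, Fin (M l)), ∑ b : ∀ k, B k,
        ((∏ l, ∏ i, pX l (z.1 l i)) * (∏ l, (M l : ℝ)⁻¹) * ∏ k, V k (codeword z.1 z.2) (b k)) *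
        (∑ k, (4 * ∑ u, pU k (b k) u * ind (τ k < pU k (b k) u) + 16 * (G k * τ k)) +
          2 ^ K * ∑ u : ∀ k, U k, (∏ k, pU k (b k) (u k)) * avgConfusion N G typ z.1 z.2 u)) ?_
  · obtain ⟨h, hh⟩ := hh
    obtain ⟨r, hr⟩ := exists_relay_of_hash hlaw τ typ h m₀
    exact ⟨r, decode typ h m₀, hr.trans hh⟩
  · rw [Finset.sum_congr rfl fun h _ => Finset.mul_sum _ _ _, Finset.sum_comm]
    refine Finset.sum_le_sum fun z _ => ?_
    rw [Finset.sum_congr rfl fun h _ => Finset.mul_sum _ _ _]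
    rw [Finset.sum_comm]
    refine Finset.sum_le_sum fun b _ => ?_
    simp_rw [mul_left_comm (hashWeight _)]
    rw [← Finset.mul_sum]
    refine mul_le_mul_of_nonneg_left ?_ ?_
    · simp_rw [mul_add (hashWeight _)]
      rw [Finset.sum_add_distrib]
      refine add_le_add ?_ (le_of_eq ?_)
      · simp_rw [Finset.mul_sum]
        rw [Finset.sum_comm]
        refine Finset.sum_le_sum fun k _ => ?_
        rw [← Finset.mul_sum]
        exact sum_hashWeight_bad_le hlaw hN hτ b k
      · simp_rw [Finset.mul_sum]
        rw [Finset.sum_comm]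
        refine Finset.sum_congr rfl fun u _ => ?_
        have h1 : ∀ h : ∀ k, U k → Fin (N k) × Fin (G k + 1), hashWeight h *
            ((∏ k, 2 * ((G k : ℝ) + 1) * pU k (b k) (u k) * ind ((h k (u k)).2 = 0)) *
              confusion typ h z.1 z.2 u) =
            ((∏ k, 2 * ((G k : ℝ) + 1)) * ∏ k, pU k (b k) (u k)) * (hashWeight h *
              ((∏ k, ind ((h k (u k)).2 = 0)) * confusion typ h z.1 z.2 u)) := by
          intro h
          rw [Finset.prod_mul_distrib, Finset.prod_mul_distrib]; ring
        simp_rw [h1]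
        -- The survival probabilities cancel the normalisations `G_k + 1` of the quantizers, and
        -- only `2 ^ K` remains.
        rw [← Finset.mul_sum, sum_hashWeight_confusion hN, Finset.prod_mul_distrib,
          Finset.prod_const, Finset.card_univ, Fintype.card_fin, Finset.prod_inv_distrib]
        have h2 : ∏ k, ((G k : ℝ) + 1) ≠ 0 := Finset.prod_ne_zero_iff.2 fun k _ => by positivity
        field_simp
    · exact mul_nonneg (mul_nonneg (Finset.prod_nonneg fun l _ => Finset.prod_nonneg fun i _ =>
        (hlaw.input_mem l).1 _) (Finset.prod_nonneg fun l _ => by positivity))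
        (Finset.prod_nonneg fun k _ => (hlaw.channel_mem k _).1 _)

end OneShot

/-! ### Averaging over random codebooks -/

section OneShotBound

variable {L K : ℕ} {A : Fin L → Type*} {B : Fin K → Type*} {U : Fin K → Type*}
  [∀ l, Fintype (A l)] [∀ k, Fintype (B k)] [∀ k, Fintype (U k)]
  {M : Fin L → ℕ} {N G : Fin K → ℕ}

open Classical in
/-- The users whose messages differ. -/
def diffSet (m m' : ∀ l, Fin (M l)) : Finset (Fin L) := Finset.univ.filter fun l => m' l ≠ m l

/-- The codewords of two message tuples are independent except for shared messages. -/
theorem sum_codeword_pair {pX : ∀ l, A l → ℝ} (hX : ∀ l, ∑ a, pX l a = 1) (m m' : ∀ l, Fin (M l))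
    (F : (∀ l, A l) → (∀ l, A l) → ℝ) :
    ∑ c : ∀ l, Fin (M l) → A l, (∏ l, ∏ i, pX l (c l i)) * F (codeword c m) (codeword c m') =
      ∑ x : ∀ l, A l, ∑ x' : ∀ l, A l, (∏ l, pX l (x l)) * (∏ l, pX l (x' l)) *
        F x ((diffSet m m').piecewise x' x) := by
  classical
  have h1 := sum_prod_mul_comp (fun l (c : Fin (M l) → A l) => ∏ i, pX l (c i))
    (fun l c => (c (m l), c (m' l))) (fun b => F (fun l => (b l).1) (fun l => (b l).2))
  have h2 := sum_prod_mul_comp (fun l (a : A l × A l) => pX l a.1 * pX l a.2)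
    (fun l a => (a.1, if l ∈ diffSet m m' then a.2 else a.1))
    (fun b => F (fun l => (b l).1) (fun l => (b l).2))
  -- User by user: equal messages give one codeword and the unused copy integrates out; different
  -- messages give two independent codewords.
  have h3 : ∀ l (b : A l × A l),
      (∑ c : Fin (M l) → A l, if (c (m l), c (m' l)) = b then ∏ i, pX l (c i) else 0) =
      ∑ a : A l × A l, if (a.1, if l ∈ diffSet m m' then a.2 else a.1) = b then
        pX l a.1 * pX l a.2 else 0 := by
    intro l b
    by_cases hl : m' l = m l
    · have := sum_prod_mul_eval (fun _ : Fin (M l) => pX l) (fun _ => hX l) (m l)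
        (fun a => if (a, a) = b then 1 else 0)
      simp only [mul_ite, mul_one, mul_zero] at this
      have hl' : l ∉ diffSet m m' := by simp [diffSet, hl]
      simp only [hl, hl', if_false, this, Fintype.sum_prod_type]
      refine Finset.sum_congr rfl fun a _ => ?_
      split_ifs
      · rw [← Finset.mul_sum, hX, mul_one]
      · simp
    · have := sum_prod_mul_eval₂ (fun _ : Fin (M l) => pX l) (fun _ => hX l) (Ne.symm hl)
        (fun a a' => if (a, a') = b then 1 else 0)
      simp only [mul_ite, mul_one, mul_zero] at this
      have hl' : l ∈ diffSet m m' := by simp [diffSet, hl]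
      simp only [hl', if_true, this, Fintype.sum_prod_type]
  simp_rw [h3] at h1
  rw [← h2] at h1
  refine h1.trans ?_
  rw [← Fintype.sum_prod_type']
  refine Fintype.sum_equiv (Equiv.arrowProdEquivProdArrow (Fin L) A A) _ _ fun a => ?_
  rw [Finset.prod_mul_distrib]
  congr 2

theorem sum_codeword {pX : ∀ l, A l → ℝ} (hX : ∀ l, ∑ a, pX l a = 1) (m : ∀ l, Fin (M l))
    (F : (∀ l, A l) → ℝ) :
    ∑ c : ∀ l, Fin (M l) → A l, (∏ l, ∏ i, pX l (c l i)) * F (codeword c m) =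
      ∑ x : ∀ l, A l, (∏ l, pX l (x l)) * F x := by
  classical
  rw [sum_codeword_pair hX m m (fun x _ => F x)]
  refine Finset.sum_congr rfl fun x _ => ?_
  rw [← Finset.sum_mul, ← Finset.mul_sum, sum_prod_eq_one pX hX, mul_one]

/-- Group the wrong messages by the set of users whose message is wrong. -/
theorem sum_wrong_messages (m : ∀ l, Fin (M l)) (Φ : Finset (Fin L) → ℝ) :
    ∑ m', ind (m' ≠ m) * Φ (diffSet m m') =
      ∑ T, ind T.Nonempty * ((∏ t ∈ T, ((M t : ℝ) - 1)) * Φ T) := by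
  classical
  -- Each user in `T` has `M_t - 1` wrong messages and the others none. The exact count matters: it
  -- vanishes when some user in `T` has a single message.
  have hcount : ∀ T : Finset (Fin L), ∏ t ∈ T, ((M t : ℝ) - 1) =
      ∑ m' : ∀ l, Fin (M l), ind (diffSet m m' = T) := by
    intro T
    have h1 : ∀ m' : ∀ l, Fin (M l), ind (diffSet m m' = T) =
        ∏ l, ind (m' l ≠ m l ↔ l ∈ T) := by
      intro m'
      rw [← ind_forall]
      exact ind_congr (by simp [diffSet, Finset.ext_iff])
    simp_rw [h1]
    rw [← Fintype.prod_sum (f := fun l (i : Fin (M l)) => ind (i ≠ m l ↔ l ∈ T)),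
      ← Finset.prod_mul_prod_compl T, Finset.prod_eq_one (s := Tᶜ), mul_one]
    · refine Finset.prod_congr rfl fun l hl => ?_
      have : ∀ i : Fin (M l), ind (i ≠ m l ↔ l ∈ T) = 1 - ind (i = m l) := by
        intro i
        by_cases h : i = m l
        · rw [ind_of h, ind_of_not (by simp [h, hl]), sub_self]
        · rw [ind_of_not h, ind_of (by simp [h, hl]), sub_zero]
      simp_rw [this]
      rw [Finset.sum_sub_distrib]
      simp [ind_eq_ite]
    · intro l hl
      have hl' : l ∉ T := by simpa using hl
      have : ∀ i : Fin (M l), ind (i ≠ m l ↔ l ∈ T) = ind (i = m l) := by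
        intro i
        exact ind_congr (by simp [hl'])
      simp_rw [this]
      simp [ind_eq_ite]
  simp_rw [hcount, Finset.sum_mul, Finset.mul_sum]
  rw [Finset.sum_comm]
  refine Finset.sum_congr rfl fun m' _ => ?_
  rw [Finset.sum_eq_single (diffSet m m')]
  · rw [ind_of rfl, one_mul, ind_congr (Q := m' ≠ m) (Q' := (diffSet m m').Nonempty)]
    simp [diffSet, Finset.Nonempty, funext_iff]
  · intro T _ hT
    rw [ind_of_not hT.symm]; ring
  · simp

/-- The weight of confusing typical points when the users in `T` and the relays in `S` are wrong. -/
def confusionMass (pX : ∀ l, A l → ℝ) (V : ∀ k, (∀ l, A l) → B k → ℝ) (pU : ∀ k, B k → U k → ℝ)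
    (typ : (∀ l, A l) → (∀ k, U k) → Prop) (T : Finset (Fin L)) (S : Finset (Fin K)) : ℝ :=
  ∑ x : ∀ l, A l, ∑ u, (∏ l, pX l (x l)) * (ind (typ x u) * partProb pX V pU T S x u)

variable {pX : ∀ l, A l → ℝ} {V : ∀ k, (∀ l, A l) → B k → ℝ} {pU : ∀ k, B k → U k → ℝ}

/-- For each relay the factor is at most `ρ_k` plus the indicator of `u'_k = u_k`, with mean `ρ_k +
p(u'_k|x)` given `x`. Expanding the product over the relays produces the set `S` of relays charged
`ρ_k`. -/
theorem sum_test_confusion_le [∀ k, DecidableEq (U k)] (hlaw : IsLaw pX V pU) (x : ∀ l, A l)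
    (u' : ∀ k, U k) {ρ : Fin K → ℝ} (hρ : ∀ k, 0 ≤ ρ k) :
    ∑ b : ∀ k, B k, (∏ k, V k x (b k)) * ∑ u : ∀ k, U k, (∏ k, pU k (b k) (u k)) *
      (∏ k, if u' k = u k then 1 else ρ k) ≤
    ∑ S : Finset (Fin K), (∏ k ∈ S, ρ k) * ∏ k ∈ Sᶜ, outProb V pU k x (u' k) := by
  classical
  have h1 : ∀ b : ∀ k, B k, (∏ k, V k x (b k)) * ∑ u : ∀ k, U k, (∏ k, pU k (b k) (u k)) *
      (∏ k, if u' k = u k then 1 else ρ k) =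
      ∏ k, V k x (b k) * ∑ u, pU k (b k) u * if u' k = u then 1 else ρ k := by
    intro b
    rw [Finset.prod_mul_distrib, Fintype.prod_sum]
    simp_rw [Finset.prod_mul_distrib]
  simp_rw [h1]
  rw [← Fintype.prod_sum (f := fun k b => V k x b * ∑ u, pU k b u * if u' k = u then 1 else ρ k)]
  calc _ ≤ ∏ k, (ρ k + outProb V pU k x (u' k)) := by
        refine Finset.prod_le_prod (fun k _ => Finset.sum_nonneg fun b _ =>
          mul_nonneg ((hlaw.channel_mem k x).1 b) (Finset.sum_nonneg fun u _ =>
          mul_nonneg ((hlaw.test_mem k b).1 u) (by split_ifs; exacts [zero_le_one, hρ k])))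
          fun k _ => ?_
        calc _ ≤ ∑ b, V k x b * (ρ k + pU k b (u' k)) := by
              refine Finset.sum_le_sum fun b _ =>
                mul_le_mul_of_nonneg_left ?_ ((hlaw.channel_mem k x).1 b)
              calc _ ≤ ∑ u, (pU k b u * ρ k + pU k b u * if u' k = u then 1 else 0) := by
                    refine Finset.sum_le_sum fun u _ => ?_
                    have h0 := mul_nonneg ((hlaw.test_mem k b).1 u) (hρ k)
                    split_ifs <;> linarith
                _ = _ := by
                    rw [Finset.sum_add_distrib, ← Finset.sum_mul, (hlaw.test_mem k b).2]
                    simp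
          _ = _ := by
              simp_rw [mul_add]
              rw [Finset.sum_add_distrib, ← Finset.sum_mul, (hlaw.channel_mem k x).2, one_mul]
              rfl
    _ = _ := by
        rw [Finset.prod_add]
        simp only [Finset.powerset_univ, Finset.compl_eq_univ_sdiff]

/-- Exchanging the `T`-coordinates of the two independent input tuples makes the wrong codewords the
reference point `x` and the true ones `x` with `T` drawn afresh. Averaging over the fresh inputs
produces `p(u'_{Sᶜ}|x_{Tᶜ})`. -/
theorem sum_pair_confusion_le [∀ k, DecidableEq (U k)] (hlaw : IsLaw pX V pU)
    (typ : (∀ l, A l) → (∀ k, U k) → Prop) (T : Finset (Fin L)) {ρ : Fin K → ℝ}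
    (hρ : ∀ k, 0 ≤ ρ k) :
    ∑ x : ∀ l, A l, ∑ x' : ∀ l, A l, (∏ l, pX l (x l)) * (∏ l, pX l (x' l)) *
      ∑ b : ∀ k, B k, (∏ k, V k x (b k)) * ∑ u : ∀ k, U k, (∏ k, pU k (b k) (u k)) *
        ∑ u', ind (typ (T.piecewise x' x) u') * ∏ k, (if u' k = u k then 1 else ρ k) ≤
    ∑ S : Finset (Fin K), (∏ k ∈ S, ρ k) * confusionMass pX V pU typ T S := by
  classical
  have hswap := sum_prod_piecewise pX T (fun z z' =>
    ∑ b : ∀ k, B k, (∏ k, V k (T.piecewise z' z) (b k)) * ∑ u : ∀ k, U k, (∏ k, pU k (b k) (u k)) *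
        ∑ u', ind (typ z u') * ∏ k, (if u' k = u k then 1 else ρ k))
  have hpw : ∀ x x' : ∀ l, A l, T.piecewise (T.piecewise x x') (T.piecewise x' x) = x := by
    intro x x'
    ext l
    by_cases hl : l ∈ T <;> simp [hl]
  simp_rw [hpw] at hswap
  rw [hswap]
  have h1 : ∀ z z' : ∀ l, A l,
      ∑ b : ∀ k, B k, (∏ k, V k (T.piecewise z' z) (b k)) * ∑ u : ∀ k, U k, (∏ k, pU k (b k) (u k)) *
        ∑ u', ind (typ z u') * ∏ k, (if u' k = u k then 1 else ρ k) ≤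
      ∑ u', ind (typ z u') * ∑ S : Finset (Fin K), (∏ k ∈ S, ρ k) *
        ∏ k ∈ Sᶜ, outProb V pU k (T.piecewise z' z) (u' k) := by
    intro z z'
    calc _ = ∑ u', ind (typ z u') * ∑ b : ∀ k, B k, (∏ k, V k (T.piecewise z' z) (b k)) *
          ∑ u : ∀ k, U k, (∏ k, pU k (b k) (u k)) *
            (∏ k, if u' k = u k then 1 else ρ k) := by
          simp_rw [Finset.mul_sum]
          rw [Finset.sum_comm' (t' := Finset.univ) (s' := fun _ => Finset.univ) (by simp)]
          rw [Finset.sum_comm]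
          symm
          rw [Finset.sum_comm]
          refine Finset.sum_congr rfl fun b _ => ?_
          rw [Finset.sum_comm]
          refine Finset.sum_congr rfl fun u _ => Finset.sum_congr rfl fun u' _ => ?_
          ring
      _ ≤ _ := Finset.sum_le_sum fun u' _ =>
          mul_le_mul_of_nonneg_left (sum_test_confusion_le hlaw _ u' hρ) (ind_nonneg _)
  calc _ ≤ ∑ z : ∀ l, A l, ∑ z' : ∀ l, A l, (∏ l, pX l (z l)) * (∏ l, pX l (z' l)) *
        ∑ u', ind (typ z u') * ∑ S : Finset (Fin K), (∏ k ∈ S, ρ k) *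
          ∏ k ∈ Sᶜ, outProb V pU k (T.piecewise z' z) (u' k) :=
        Finset.sum_le_sum fun z _ => Finset.sum_le_sum fun z' _ =>
          mul_le_mul_of_nonneg_left (h1 z z')
            (mul_nonneg (hlaw.input_nonneg z) (hlaw.input_nonneg z'))
    _ = _ := by
        simp_rw [confusionMass, partProb, Finset.mul_sum]
        symm
        rw [Finset.sum_comm]
        refine Finset.sum_congr rfl fun z _ => ?_
        have h2 : ∀ f : Finset (Fin K) → (∀ k, U k) → (∀ l, A l) → ℝ,
            ∑ S, ∑ u, ∑ z', f S u z' = ∑ z', ∑ u, ∑ S, f S u z' := by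
          intro f
          rw [Finset.sum_comm]
          simp_rw [Finset.sum_comm (s := (Finset.univ : Finset (Finset (Fin K))))]
          rw [Finset.sum_comm]
        rw [h2]
        refine Finset.sum_congr rfl fun z' _ => Finset.sum_congr rfl fun u _ =>
          Finset.sum_congr rfl fun S _ => ?_
        ring

/-- Linearity of the mean over codebooks, observations and auxiliary letters, isolated so that
hashing, atypicality and confusion can be estimated separately. -/
theorem sum_weight_linear {ι₁ ι₂ ι₃ ι₄ : Type*} [Fintype ι₁] [Fintype ι₂] [Fintype ι₃] [Fintype ι₄]
    (w : ι₁ → ℝ) (v f : ι₁ → ι₂ → ℝ) (p : ι₂ → ι₃ → ℝ) (i : ι₁ → ι₃ → ℝ) (d : ι₄ → ℝ)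
    (g : ι₄ → ι₁ → ι₃ → ℝ) (κ : ℝ) :
    ∑ c, w c * ∑ b, v c b * (f c b + κ * ∑ u, p b u * (i c u + ∑ m, d m * g m c u)) =
      ∑ c, w c * ∑ b, v c b * f c b + κ * (∑ c, w c * ∑ b, v c b * ∑ u, p b u * i c u +
        ∑ m, d m * ∑ c, w c * ∑ b, v c b * ∑ u, p b u * g m c u) := by
  simp only [mul_add, Finset.sum_add_distrib, Finset.mul_sum]
  congr 2
  · refine Finset.sum_congr rfl fun c _ => Finset.sum_congr rfl fun b _ =>
      Finset.sum_congr rfl fun u _ => by ring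
  · symm
    rw [Finset.sum_comm]
    refine Finset.sum_congr rfl fun c _ => ?_
    rw [Finset.sum_comm]
    refine Finset.sum_congr rfl fun b _ => ?_
    rw [Finset.sum_comm]
    refine Finset.sum_congr rfl fun u _ => Finset.sum_congr rfl fun m _ => by ring

/-- The one-shot coding theorem. -/
theorem exists_oneShot (hlaw : IsLaw pX V pU) (hM : ∀ l, 0 < M l) (hN : ∀ k, 0 < N k)
    {τ : Fin K → ℝ} (hτ : ∀ k, 0 ≤ τ k) (typ : (∀ l, A l) → (∀ k, U k) → Prop) :
    ∃ (r : ∀ k, B k → Fin (N k))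
      (g : (∀ l, Fin (M l) → A l) → (∀ k, Fin (N k)) → ∀ l, Fin (M l)),
      oneShotError pX V r g ≤
        ∑ k, (4 * ∑ x, ∑ b, ∑ u, lawProb pX V pU x b u * ind (τ k < pU k (b k) (u k)) +
          16 * (G k * τ k)) +
        2 ^ K * (∑ x, ∑ b, ∑ u, lawProb pX V pU x b u * ind (¬ typ x u) +
          ∑ T, ind T.Nonempty * ((∏ t ∈ T, ((M t : ℝ) - 1)) *
            ∑ S : Finset (Fin K), (∏ k ∈ S, ((N k : ℝ) * (G k + 1))⁻¹) *
              confusionMass pX V pU typ T S)) := by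
  classical
  obtain ⟨r, g, hrg⟩ := exists_code_avg (G := G) hlaw hN hτ typ (fun l => ⟨0, hM l⟩)
  refine ⟨r, g, hrg.trans ?_⟩
  have hX : ∀ l, ∑ a, pX l a = 1 := fun l => (hlaw.input_mem l).2
  have hMsum : ∑ m : ∀ l, Fin (M l), ∏ l, (M l : ℝ)⁻¹ = 1 := by
    rw [← Fintype.prod_sum (f := fun l (_ : Fin (M l)) => (M l : ℝ)⁻¹)]
    refine Finset.prod_eq_one fun l _ => ?_
    have : (M l : ℝ) ≠ 0 := by exact_mod_cast (hM l).ne'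
    simp [this]
  set ρ : Fin K → ℝ := fun k => ((N k : ℝ) * (G k + 1))⁻¹ with hρ
  have hρ0 : ∀ k, 0 ≤ ρ k := fun k => by positivity
  have hM0 : 0 ≤ ∏ l, (M l : ℝ)⁻¹ := Finset.prod_nonneg fun l _ => by positivity
  set bnd : ℝ := ∑ x, ∑ b, ∑ u, lawProb pX V pU x b u * ind (¬ typ x u) +
          ∑ T, ind T.Nonempty * ((∏ t ∈ T, ((M t : ℝ) - 1)) *
            ∑ S : Finset (Fin K), (∏ k ∈ S, ρ k) * confusionMass pX V pU typ T S) with hbnd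
  -- Random codebooks are symmetric in the messages, so one bound serves all message tuples and the
  -- average over messages is trivial.
  have hper : ∀ m : ∀ l, Fin (M l), ∑ c : ∀ l, Fin (M l) → A l, (∏ l, ∏ i, pX l (c l i)) *
      ∑ b : ∀ k, B k, (∏ k, V k (codeword c m) (b k)) *
        (∑ k, (4 * ∑ u, pU k (b k) u * ind (τ k < pU k (b k) u) + 16 * (G k * τ k)) +
          2 ^ K * ∑ u : ∀ k, U k, (∏ k, pU k (b k) (u k)) * avgConfusion N G typ c m u) ≤
      ∑ k, (4 * ∑ x, ∑ b, ∑ u, lawProb pX V pU x b u * ind (τ k < pU k (b k) (u k)) +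
          16 * (G k * τ k)) + 2 ^ K * bnd := by
    intro m
    have e1 : ∑ c : ∀ l, Fin (M l) → A l, (∏ l, ∏ i, pX l (c l i)) *
        ∑ b : ∀ k, B k, (∏ k, V k (codeword c m) (b k)) *
          ∑ k, (4 * ∑ u, pU k (b k) u * ind (τ k < pU k (b k) u) + 16 * (G k * τ k)) =
        ∑ k, (4 * ∑ x, ∑ b, ∑ u, lawProb pX V pU x b u * ind (τ k < pU k (b k) (u k)) +
          16 * (G k * τ k)) := by
      rw [sum_codeword hX m (fun x => ∑ b : ∀ k, B k, (∏ k, V k x (b k)) *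
          ∑ k, (4 * ∑ u, pU k (b k) u * ind (τ k < pU k (b k) u) + 16 * (G k * τ k)))]
      have hV : ∀ x, ∑ b : ∀ k, B k, ∏ k, V k x (b k) = 1 := fun x =>
        sum_prod_eq_one (fun k => V k x) fun k => (hlaw.channel_mem k x).2
      have hk : ∀ k, ∑ x : ∀ l, A l, (∏ l, pX l (x l)) * ∑ b : ∀ k, B k, (∏ k, V k x (b k)) *
          (4 * ∑ u, pU k (b k) u * ind (τ k < pU k (b k) u) + 16 * (G k * τ k)) =
          4 * ∑ x, ∑ b, ∑ u, lawProb pX V pU x b u * ind (τ k < pU k (b k) (u k)) +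
          16 * (G k * τ k) := by
        intro k
        have hu : ∀ b : ∀ k, B k, ∑ u, pU k (b k) u * ind (τ k < pU k (b k) u) =
            ∑ u : ∀ k, U k, (∏ k, pU k (b k) (u k)) * ind (τ k < pU k (b k) (u k)) := fun b =>
          (sum_prod_mul_eval_pi (fun k => pU k (b k)) (fun k => (hlaw.test_mem k _).2) k
            (fun u => ind (τ k < pU k (b k) u))).symm
        simp_rw [hu, mul_add, Finset.sum_add_distrib, ← Finset.sum_mul, hV, one_mul]
        simp_rw [mul_add]
        rw [Finset.sum_add_distrib, ← Finset.sum_mul, sum_prod_eq_one pX hX, one_mul]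
        congr 1
        simp_rw [lawProb, Finset.mul_sum]
        refine Finset.sum_congr rfl fun x _ => Finset.sum_congr rfl fun b _ =>
          Finset.sum_congr rfl fun u _ => by ring
      simp_rw [← hk]
      rw [Finset.sum_comm]
      refine Finset.sum_congr rfl fun x _ => ?_
      rw [← Finset.mul_sum, Finset.sum_comm]
      simp_rw [← Finset.mul_sum]
    have e2 : ∑ c : ∀ l, Fin (M l) → A l, (∏ l, ∏ i, pX l (c l i)) *
        ∑ b : ∀ k, B k, (∏ k, V k (codeword c m) (b k)) *
          ∑ u : ∀ k, U k, (∏ k, pU k (b k) (u k)) * ind (¬ typ (codeword c m) u) =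
        ∑ x, ∑ b, ∑ u, lawProb pX V pU x b u * ind (¬ typ x u) := by
      rw [sum_codeword hX m (fun x => ∑ b : ∀ k, B k, (∏ k, V k x (b k)) *
          ∑ u : ∀ k, U k, (∏ k, pU k (b k) (u k)) * ind (¬ typ x u))]
      simp_rw [lawProb, Finset.mul_sum, mul_assoc]
    have e3 : ∀ m', ∑ c : ∀ l, Fin (M l) → A l, (∏ l, ∏ i, pX l (c l i)) *
        ∑ b : ∀ k, B k, (∏ k, V k (codeword c m) (b k)) *
          ∑ u : ∀ k, U k, (∏ k, pU k (b k) (u k)) * ∑ u', ind (typ (codeword c m') u') *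
            ∏ k, (if u' k = u k then 1 else ρ k) ≤
        ∑ S : Finset (Fin K), (∏ k ∈ S, ρ k) * confusionMass pX V pU typ (diffSet m m') S := by
      intro m'
      rw [sum_codeword_pair hX m m' (fun x x' => ∑ b : ∀ k, B k, (∏ k, V k x (b k)) *
          ∑ u : ∀ k, U k, (∏ k, pU k (b k) (u k)) * ∑ u', ind (typ x' u') *
            ∏ k, (if u' k = u k then 1 else ρ k))]
      exact sum_pair_confusion_le hlaw typ _ hρ0
    simp only [avgConfusion]
    rw [sum_weight_linear (fun c : ∀ l, Fin (M l) → A l => ∏ l, ∏ i, pX l (c l i))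
      (fun c (b : ∀ k, B k) => ∏ k, V k (codeword c m) (b k))
      (fun _ b => ∑ k, (4 * ∑ u, pU k (b k) u * ind (τ k < pU k (b k) u) + 16 * (G k * τ k)))
      (fun b (u : ∀ k, U k) => ∏ k, pU k (b k) (u k))
      (fun c u => ind (¬ typ (codeword c m) u)) (fun m' => ind (m' ≠ m))
      (fun m' c u => ∑ u', ind (typ (codeword c m') u') * ∏ k, (if u' k = u k then 1 else ρ k)),
      e1, e2, hbnd, ← sum_wrong_messages m
        (fun T => ∑ S : Finset (Fin K), (∏ k ∈ S, ρ k) * confusionMass pX V pU typ T S)]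
    gcongr with m' _
    · exact ind_nonneg _
    · exact e3 m'
  calc _ = ∑ m : ∀ l, Fin (M l), (∏ l, (M l : ℝ)⁻¹) *
        ∑ c : ∀ l, Fin (M l) → A l, (∏ l, ∏ i, pX l (c l i)) *
        ∑ b : ∀ k, B k, (∏ k, V k (codeword c m) (b k)) *
        (∑ k, (4 * ∑ u, pU k (b k) u * ind (τ k < pU k (b k) u) + 16 * (G k * τ k)) +
          2 ^ K * ∑ u : ∀ k, U k, (∏ k, pU k (b k) (u k)) * avgConfusion N G typ c m u) := by
        rw [Fintype.sum_prod_type, Finset.sum_comm]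
        refine Finset.sum_congr rfl fun m _ => ?_
        rw [Finset.mul_sum]
        refine Finset.sum_congr rfl fun c _ => ?_
        rw [Finset.mul_sum, Finset.mul_sum]
        refine Finset.sum_congr rfl fun b _ => ?_
        ring
    _ ≤ ∑ m : ∀ l, Fin (M l), (∏ l, (M l : ℝ)⁻¹) *
        (∑ k, (4 * ∑ x, ∑ b, ∑ u, lawProb pX V pU x b u * ind (τ k < pU k (b k) (u k)) +
          16 * (G k * τ k)) + 2 ^ K * bnd) :=
        Finset.sum_le_sum fun m _ => mul_le_mul_of_nonneg_left (hper m) hM0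
    _ = _ := by rw [← Finset.sum_mul, hMsum, one_mul]

end OneShotBound

/-! ## Block laws -/

section Block

variable {L K n : ℕ} {X : Fin L → Type*} {Y : Fin K → Type*} {U : Fin K → Type*}

/-- Independent, time-dependent inputs. -/
def blockInput (pX : Fin n → ∀ l, X l → ℝ) (l : Fin L) (x : Fin n → X l) : ℝ :=
  ∏ i, pX i l (x i)

/-- The memoryless channel to a relay. -/
def blockChannel (V : ∀ k, (∀ l, X l) → Y k → ℝ) (k : Fin K) (x : ∀ l, Fin n → X l)
    (y : Fin n → Y k) : ℝ := ∏ i, V k (fun l => x l i) (y i)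

/-- Independent, time-dependent test channels. -/
def blockTest (pU : Fin n → ∀ k, Y k → U k → ℝ) (k : Fin K) (y : Fin n → Y k)
    (u : Fin n → U k) : ℝ := ∏ i, pU i k (y i) (u i)

theorem block_mem {α β : Type*} [Fintype β] {f : Fin n → α → β → ℝ}
    (hf : ∀ i a, f i a ∈ stdSimplex ℝ β) (a : Fin n → α) :
    (fun b : Fin n → β => ∏ i, f i (a i) (b i)) ∈ stdSimplex ℝ (Fin n → β) :=
  ⟨fun _ => Finset.prod_nonneg fun i _ => (hf i _).1 _,
    sum_prod_eq_one (fun i => f i (a i)) fun i => (hf i _).2⟩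

variable [∀ l, Fintype (X l)] [∀ k, Fintype (Y k)] [∀ k, Fintype (U k)]
  {pX : Fin n → ∀ l, X l → ℝ} {V : ∀ k, (∀ l, X l) → Y k → ℝ} {pU : Fin n → ∀ k, Y k → U k → ℝ}

theorem isLaw_block (h : ∀ i, IsLaw (pX i) V (pU i))
    (hV : ∀ k x, V k x ∈ stdSimplex ℝ (Y k)) :
    IsLaw (blockInput pX) (blockChannel V) (blockTest pU) where
  input_mem l := block_mem (α := Unit) (fun i _ => (h i).input_mem l) (fun _ => ())
  channel_mem k x := block_mem (α := ∀ l, X l) (f := fun _ => V k) (fun _ => hV k)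
    (fun i l => x l i)
  test_mem k y := block_mem (fun i => (h i).test_mem k) y

omit [∀ l, Fintype (X l)] [∀ k, Fintype (U k)] in
theorem outProb_block (k : Fin K) (x : ∀ l, Fin n → X l) (u : Fin n → U k) :
    outProb (blockChannel V) (blockTest pU) k x u =
      ∏ i, outProb V (pU i) k (fun l => x l i) (u i) := by
  simp_rw [outProb, blockChannel, blockTest, ← Finset.prod_mul_distrib, Fintype.prod_sum]

omit [∀ k, Fintype (U k)] in
theorem partProb_block (T : Finset (Fin L)) (S : Finset (Fin K)) (x : ∀ l, Fin n → X l)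
    (u : ∀ k, Fin n → U k) :
    partProb (blockInput pX) (blockChannel V) (blockTest pU) T S x u =
      ∏ i, partProb (pX i) V (pU i) T S (fun l => x l i) (fun k => u k i) := by
  classical
  simp_rw [partProb, outProb_block]
  rw [← sum_prod_prod_comm (fun i (a : ∀ l, X l) => (∏ l, pX i l (a l)) *
    ∏ k ∈ Sᶜ, outProb V (pU i) k (T.piecewise a fun l => x l i) (u k i))]
  refine Finset.sum_congr rfl fun x' _ => ?_
  rw [Finset.prod_mul_distrib]
  congr 1
  · exact Finset.prod_comm
  · rw [Finset.prod_comm]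
    refine Finset.prod_congr rfl fun i _ => Finset.prod_congr rfl fun k _ => ?_
    congr 1
    ext l
    by_cases hl : l ∈ T <;> simp [hl]

omit [∀ l, Fintype (X l)] [∀ k, Fintype (Y k)] [∀ k, Fintype (U k)] in
theorem lawProb_block (x : ∀ l, Fin n → X l) (y : ∀ k, Fin n → Y k)
    (u : ∀ k, Fin n → U k) :
    lawProb (blockInput pX) (blockChannel V) (blockTest pU) x y u =
      ∏ i, lawProb (pX i) V (pU i) (fun l => x l i) (fun k => y k i) (fun k => u k i) := by
  simp_rw [lawProb, blockInput, blockChannel, blockTest]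
  rw [Finset.prod_mul_distrib, Finset.prod_mul_distrib, Finset.prod_comm,
    Finset.prod_comm (γ := Fin K), Finset.prod_comm (γ := Fin K)]

end Block

/-! ## From one-shot codes to codes for the channel -/

section Assemble

variable {L K : ℕ} {X : Fin L → Type*} {Y : Fin K → Type*} [∀ l, Fintype (X l)] [∀ k, Fintype (Y k)]

/-- An enumeration of all codebooks. -/
def codebookEquiv (α : Type*) [Fintype α] (n M : ℕ) :
    Fin (Fintype.card α ^ (n * M)) ≃ (Fin M → Fin n → α) :=
  open Classical in
  (finCongr (by simp [pow_mul])).trans (Fintype.equivFin (Fin M → Fin n → α)).symm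

/-- The encoder may ignore the time-sharing sequence: under the prescribed index law, averaging over
the enumerated codebooks already means independent letters with laws `p(x_l|q_i)`. Conditional
independence of the outputs turns the memoryless channel into one block channel per relay. -/
theorem exists_code {W : (∀ l, X l) → (∀ k, Y k) → ℝ} (hCI : CondIndepOutputs W)
    (C : Fin K → ℝ) (n : ℕ) (R : Fin L → ℝ) (P : TestLaw X Y)
    (r : (Fin n → Fin P.nQ) → ∀ k, (Fin n → Y k) → Fin (numIdx n (C k)))
    (g : (Fin n → Fin P.nQ) → (∀ l, Fin (numIdx n (R l)) → Fin n → X l) →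
      (∀ k, Fin (numIdx n (C k))) → ∀ l, Fin (numIdx n (R l))) :
    ∃ c : Code X Y C n R, c.errorProb W = ∑ q : Fin n → Fin P.nQ, (∏ i, P.pQ (q i)) *
      oneShotError (blockInput fun i l => P.pX l (q i)) (blockChannel (marginal W)) (r q) (g q) := by
  classical
  refine ⟨{ nQ := P.nQ, pQ := P.pQ, pQ_mem := P.pQ_mem, pX := P.pX, pX_mem := P.pX_mem
            enc := fun l f m _ => codebookEquiv (X l) n (numIdx n (R l)) f m
            enc_bijective := fun l q => (codebookEquiv (X l) n (numIdx n (R l))).bijective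
            relay := fun k y q => r q k y
            dec := fun f j q => g q (fun l => codebookEquiv (X l) n (numIdx n (R l)) (f l)) j }, ?_⟩
  simp only [Code.errorProb]
  refine Finset.sum_congr rfl fun q _ => ?_
  rw [oneShotError, Fintype.sum_prod_type, Finset.mul_sum]
  refine Fintype.sum_equiv (Equiv.piCongrRight fun l => codebookEquiv (X l) n (numIdx n (R l)))
    _ _ fun f => ?_
  rw [Finset.mul_sum]
  refine Finset.sum_congr rfl fun m _ => ?_
  rw [Finset.mul_sum]
  refine Fintype.sum_equiv (Equiv.piComm fun (_ : Fin n) (k : Fin K) => Y k) _ _ fun y => ?_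
  have h1 : ∏ i, W (fun l => codebookEquiv (X l) n (numIdx n (R l)) (f l) (m l) i) (y i) =
      ∏ k, blockChannel (marginal W) k
        (fun l => codebookEquiv (X l) n (numIdx n (R l)) (f l) (m l)) (fun i => y i k) := by
    simp_rw [blockChannel]
    rw [Finset.prod_comm]
    exact Finset.prod_congr rfl fun i _ => hCI _ _
  change (∏ i, P.pQ (q i)) * (∏ l, ∏ m', ∏ i,
      P.pX l (q i) (codebookEquiv (X l) n (numIdx n (R l)) (f l) m' i)) *
    (∏ l, (numIdx n (R l) : ℝ)⁻¹) *
    (∏ i, W (fun l => codebookEquiv (X l) n (numIdx n (R l)) (f l) (m l) i) (y i)) *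
    (if g q (fun l => codebookEquiv (X l) n (numIdx n (R l)) (f l))
      (fun k => r q k fun i => y i k) = m then 0 else 1) = _ * (_ * _)
  rw [h1, ind_eq_ite]
  simp only [ne_eq, ite_not]
  simp only [mul_assoc]
  rfl

end Assemble

/-! ## Achievability -/

theorem ind_mono {Q Q' : Prop} (h : Q → Q') : ind Q ≤ ind Q' := by
  by_cases h1 : Q
  · rw [ind_of h1, ind_of (h h1)]
  · rw [ind_of_not h1]; exact ind_nonneg _

/-- Chernoff's bound for `g / 2 ^ a`, whose logarithm has negative mean. -/
theorem exists_chernoff_logb {Ω : Type*} [Fintype Ω] {p : Ω → ℝ} (hp : p ∈ stdSimplex ℝ Ω)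
    {g : Ω → ℝ} (hg : ∀ ω, 0 < p ω → 0 < g ω) {a : ℝ} (ha : ∑ ω, p ω * Real.logb 2 (g ω) < a) :
    ∃ ρ : ℝ, 0 ≤ ρ ∧ ρ < 1 ∧ ∀ n : ℕ,
      ∑ ω : Fin n → Ω, (∏ i, p (ω i)) * ind ((2 : ℝ) ^ (n * a) ≤ ∏ i, g (ω i)) ≤ ρ ^ n := by
  have h2 : (0 : ℝ) < 2 ^ a := Real.rpow_pos_of_pos two_pos _
  have hlog : 0 < Real.log 2 := Real.log_pos one_lt_two
  obtain ⟨ρ, h0, h1, h⟩ := exists_chernoff hp (g := fun ω => g ω / 2 ^ a)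
    (fun ω h => div_pos (hg ω h) h2) (by
      have : ∀ ω, p ω * Real.log (g ω / 2 ^ a) =
          (p ω * Real.logb 2 (g ω) - p ω * a) * Real.log 2 := by
        intro ω
        rcases (hp.1 ω).eq_or_lt with h | h
        · simp [← h]
        · rw [Real.log_div (hg ω h).ne' h2.ne', Real.log_rpow two_pos, Real.logb]
          field_simp
      simp_rw [this]
      rw [← Finset.sum_mul, Finset.sum_sub_distrib, ← Finset.sum_mul, hp.2, one_mul]
      exact mul_neg_of_neg_of_pos (by linarith) hlog)
  refine ⟨ρ, h0, h1, fun n => (h n).trans' (Finset.sum_le_sum fun ω _ => ?_)⟩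
  rw [Finset.prod_div_distrib, Finset.prod_const, Finset.card_univ, Fintype.card_fin,
    one_le_div (pow_pos h2 n), ← Real.rpow_natCast, ← Real.rpow_mul two_pos.le, mul_comm a]

/-- A change of measure: on typical points the mixed kernel is at most `t` times `p(u|x)`, and the
latter has total mass one under the input law. -/
theorem confusionMass_le {L K : ℕ} {A : Fin L → Type*} {B : Fin K → Type*} {U : Fin K → Type*}
    [∀ l, Fintype (A l)] [∀ k, Fintype (B k)] [∀ k, Fintype (U k)]
    {pX : ∀ l, A l → ℝ} {V : ∀ k, (∀ l, A l) → B k → ℝ} {pU : ∀ k, B k → U k → ℝ}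
    (hlaw : IsLaw pX V pU) {typ : (∀ l, A l) → (∀ k, U k) → Prop} {T : Finset (Fin L)}
    {S : Finset (Fin K)} {t : ℝ} (ht : 0 ≤ t)
    (htyp : ∀ x u, typ x u → partProb pX V pU T S x u ≤ t * ∏ k, outProb V pU k x (u k)) :
    confusionMass pX V pU typ T S ≤ t := by
  have hb : ∀ x u, ind (typ x u) * partProb pX V pU T S x u ≤ t * ∏ k, outProb V pU k x (u k) := by
    intro x u
    by_cases h : typ x u
    · rw [ind_of h, one_mul]; exact htyp x u h
    · rw [ind_of_not h, zero_mul]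
      exact mul_nonneg ht (Finset.prod_nonneg fun k _ => hlaw.outProb_nonneg k x _)
  calc confusionMass pX V pU typ T S
      ≤ ∑ x : ∀ l, A l, ∑ u : ∀ k, U k,
          (∏ l, pX l (x l)) * (t * ∏ k, outProb V pU k x (u k)) :=
        Finset.sum_le_sum fun x _ => Finset.sum_le_sum fun u _ =>
          mul_le_mul_of_nonneg_left (hb x u) (hlaw.input_nonneg x)
    _ = t := by
        simp_rw [← Finset.mul_sum]
        have : ∀ x, ∑ u : ∀ k, U k, ∏ k, outProb V pU k x (u k) = 1 := fun x =>
          sum_prod_eq_one (fun k => outProb V pU k x) fun k => hlaw.sum_outProb k x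
        simp_rw [this]
        rw [← Finset.sum_mul, sum_prod_eq_one pX fun l => (hlaw.input_mem l).2]
        ring

/-! ### Sizes of the index sets -/

section Numerics

theorem numIdx_le (n : ℕ) (r : ℝ) : (numIdx n r : ℝ) ≤ 2 ^ (n * r) :=
  Nat.floor_le (Real.rpow_pos_of_pos two_pos _).le

theorem numIdx_pos (n : ℕ) {r : ℝ} (hr : 0 ≤ r) : 0 < numIdx n r :=
  Nat.floor_pos.2 (Real.one_le_rpow one_le_two (by positivity))

theorem half_le_numIdx (n : ℕ) {r : ℝ} (hr : 0 ≤ r) : (2 : ℝ) ^ (n * r) / 2 ≤ numIdx n r := by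
  have h1 := Nat.lt_floor_add_one ((2 : ℝ) ^ (n * r))
  have h2 : (1 : ℝ) ≤ numIdx n r := by exact_mod_cast numIdx_pos n hr
  change _ < (numIdx n r : ℝ) + 1 at h1
  linarith

theorem numIdx_zero (n : ℕ) : numIdx n 0 = 1 := by simp [numIdx]

end Numerics

/-! ### Error exponents and the direct part -/

section Achievability

variable {L K : ℕ} {X : Fin L → Type*} {Y : Fin K → Type*} [∀ l, Fintype (X l)] [∀ k, Fintype (Y k)]

namespace TestLaw

/-- The inputs of a block, given the time-sharing sequence. -/
def inputAt (P : TestLaw X Y) {n : ℕ} (q : Fin n → Fin P.nQ) (i : Fin n) (l : Fin L) : X l → ℝ :=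
  P.pX l (q i)

/-- The test channels of a block, given the time-sharing sequence. -/
def testAt (P : TestLaw X Y) {n : ℕ} (q : Fin n → Fin P.nQ) (i : Fin n) (k : Fin K) (b : Y k) :
    Fin (P.nU k) → ℝ := P.pU k b (q i)

/-- Sequences of outcomes, rearranged. -/
def outcomeEquiv (P : TestLaw X Y) (n : ℕ) : (Fin n → P.Outcome) ≃
    (Fin n → Fin P.nQ) × (∀ l, Fin n → X l) × (∀ k, Fin n → Y k) × (∀ k, Fin n → Fin (P.nU k)) where
  toFun ω := (fun i => (ω i).1, fun l i => (ω i).2.1 l, fun k i => (ω i).2.2.1 k,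
    fun k i => (ω i).2.2.2 k)
  invFun z i := (z.1 i, fun l => z.2.1 l i, fun k => z.2.2.1 k i, fun k => z.2.2.2 k i)
  left_inv _ := rfl
  right_inv _ := rfl

theorem isLaw_blockAt (P : TestLaw X Y) {W : (∀ l, X l) → (∀ k, Y k) → ℝ} (hW : IsChannel W)
    {n : ℕ} (q : Fin n → Fin P.nQ) :
    IsLaw (blockInput (P.inputAt q)) (blockChannel (marginal W)) (blockTest (P.testAt q)) :=
  isLaw_block (fun i => P.isLaw hW (q i)) fun k x => marginal_mem hW k x

theorem sum_block (P : TestLaw X Y) {W : (∀ l, X l) → (∀ k, Y k) → ℝ} (n : ℕ)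
    (f : (Fin n → P.Outcome) → ℝ) :
    ∑ ω : Fin n → P.Outcome, (∏ i, P.joint W (ω i)) * f ω =
      ∑ q : Fin n → Fin P.nQ, (∏ i, P.pQ (q i)) * ∑ x, ∑ y, ∑ u,
        lawProb (blockInput (P.inputAt q)) (blockChannel (marginal W)) (blockTest (P.testAt q))
          x y u * f ((P.outcomeEquiv n).symm (q, x, y, u)) := by
  rw [Fintype.sum_equiv (P.outcomeEquiv n) _
    (fun z => (∏ i, P.joint W ((P.outcomeEquiv n).symm z i)) * f ((P.outcomeEquiv n).symm z))
    (fun ω => by rw [Equiv.symm_apply_apply])]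
  rw [Fintype.sum_prod_type]
  refine Finset.sum_congr rfl fun q _ => ?_
  rw [Fintype.sum_prod_type, Finset.mul_sum]
  refine Finset.sum_congr rfl fun x _ => ?_
  rw [Fintype.sum_prod_type, Finset.mul_sum]
  refine Finset.sum_congr rfl fun y _ => ?_
  rw [Finset.mul_sum]
  refine Finset.sum_congr rfl fun u _ => ?_
  rw [lawProb_block, ← mul_assoc, ← Finset.prod_mul_distrib]
  congr 1
  refine Finset.prod_congr rfl fun i _ => ?_
  exact TestLaw.joint_eq ..

theorem joint_mem (P : TestLaw X Y) {W : (∀ l, X l) → (∀ k, Y k) → ℝ} (hW : IsChannel W) :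
    P.joint W ∈ stdSimplex ℝ P.Outcome := by
  refine ⟨P.joint_nonneg hW, ?_⟩
  simp_rw [Fintype.sum_prod_type, P.joint_eq, ← Finset.mul_sum]
  have : ∀ q, ∑ x, ∑ y, ∑ u, lawProb (fun l => P.pX l q) (marginal W) (fun k b => P.pU k b q)
      x y u = 1 := by
    intro q
    simp_rw [lawProb, ← Finset.mul_sum]
    have h1 : ∀ y : ∀ k, Y k, ∑ u : ∀ k, Fin (P.nU k), ∏ k, P.pU k (y k) q (u k) = 1 := fun y =>
      sum_prod_eq_one (fun k => P.pU k (y k) q) fun k => (P.pU_mem k _ q).2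
    have h2 : ∀ x : ∀ l, X l, ∑ y : ∀ k, Y k, ∏ k, marginal W k x (y k) = 1 := fun x =>
      sum_prod_eq_one (fun k => marginal W k x) fun k => (marginal_mem hW k x).2
    simp_rw [h1, mul_one, ← Finset.mul_sum, h2, mul_one]
    exact sum_prod_eq_one (fun l => P.pX l q) fun l => (P.pX_mem l q).2
  simp_rw [this, mul_one]
  exact P.pQ_mem.2

/-- The expected logarithm of `p(u_k | y_k, q)`. -/
def testExponent (P : TestLaw X Y) (W : (∀ l, X l) → (∀ k, Y k) → ℝ) (k : Fin K) : ℝ :=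
  ∑ ω : P.Outcome, P.joint W ω * Real.logb 2 (P.pU k (ω.2.2.1 k) ω.1 (ω.2.2.2 k))

/-- The ratio of `p(u_{Sᶜ} | x_{Tᶜ}, q)` and `p(u_𝒦 | x_ℒ, q)`. -/
def partRatio (P : TestLaw X Y) (W : (∀ l, X l) → (∀ k, Y k) → ℝ) (T : Finset (Fin L))
    (S : Finset (Fin K)) (ω : P.Outcome) : ℝ :=
  partProb (fun l => P.pX l ω.1) (marginal W) (fun k b => P.pU k b ω.1) T S ω.2.1 ω.2.2.2 /
    ∏ k, outProb (marginal W) (fun k b => P.pU k b ω.1) k ω.2.1 (ω.2.2.2 k)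

/-- The expected logarithm of `partRatio`. -/
def partExponent (P : TestLaw X Y) (W : (∀ l, X l) → (∀ k, Y k) → ℝ) (T : Finset (Fin L))
    (S : Finset (Fin K)) : ℝ :=
  ∑ ω : P.Outcome, P.joint W ω * Real.logb 2 (P.partRatio W T S ω)

theorem test_pos (P : TestLaw X Y) {W : (∀ l, X l) → (∀ k, Y k) → ℝ} (hW : IsChannel W)
    {ω : P.Outcome} (h : 0 < P.joint W ω) (k : Fin K) :
    0 < P.pU k (ω.2.2.1 k) ω.1 (ω.2.2.2 k) := by
  obtain ⟨q, x, y, u⟩ := ω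
  rw [joint_eq] at h
  exact (pos_of_mul_pos_right h (P.pQ_mem.1 q)).trans_le
    ((P.isLaw hW q).lawProb_le_test k x y u)

theorem outProb_pos (P : TestLaw X Y) {W : (∀ l, X l) → (∀ k, Y k) → ℝ} (hW : IsChannel W)
    {ω : P.Outcome} (h : 0 < P.joint W ω) (k : Fin K) :
    0 < outProb (marginal W) (fun k b => P.pU k b ω.1) k ω.2.1 (ω.2.2.2 k) := by
  obtain ⟨q, x, y, u⟩ := ω
  rw [joint_eq] at h
  exact (pos_of_mul_pos_right h (P.pQ_mem.1 q)).trans_le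
    ((P.isLaw hW q).lawProb_le_outProb k x y u)

theorem partProb_pos (P : TestLaw X Y) {W : (∀ l, X l) → (∀ k, Y k) → ℝ} (hW : IsChannel W)
    {ω : P.Outcome} (h : 0 < P.joint W ω) (T : Finset (Fin L)) (S : Finset (Fin K)) :
    0 < partProb (fun l => P.pX l ω.1) (marginal W) (fun k b => P.pU k b ω.1) T S
      ω.2.1 ω.2.2.2 := by
  obtain ⟨q, x, y, u⟩ := ω
  rw [joint_eq] at h
  exact (pos_of_mul_pos_right h (P.pQ_mem.1 q)).trans_le
    ((P.isLaw hW q).lawProb_le_partProb T S x y u)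

/-- The same log-likelihood ratio, regrouped for the direct part: the test exponents govern the
hashing and the part exponent governs the confusion of codewords. -/
theorem bound_eq_exponents (P : TestLaw X Y) {W : (∀ l, X l) → (∀ k, Y k) → ℝ} (hW : IsChannel W)
    (C : Fin K → ℝ) (T : Finset (Fin L)) (S : Finset (Fin K)) :
    ∑ s ∈ S, (C s - P.relayInfo W s) + P.userInfo W T S =
      ∑ s ∈ S, (C s - P.testExponent W s) - P.partExponent W T S := by
  have h1 : ∀ q, P.pQ q * rateFun C (marginal W) (fun l => P.pX l q) (fun k b => P.pU k b q) T S =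
      P.pQ q * ∑ s ∈ S, C s + ∑ x, ∑ y, ∑ u, P.joint W (q, x, y, u) *
        Real.logb 2 (lawRatio (fun l => P.pX l q) (marginal W) (fun k b => P.pU k b q)
          T S x y u) := by
    intro q
    simp_rw [rateFun, joint_eq, mul_add, Finset.mul_sum, mul_assoc]
  rw [P.bound_eq hW]
  simp_rw [h1]
  rw [Finset.sum_add_distrib, ← Finset.sum_mul, P.pQ_mem.2, one_mul, Finset.sum_sub_distrib]
  simp_rw [testExponent, partExponent]
  rw [Finset.sum_comm (s := S), sub_sub, sub_eq_add_neg, add_right_inj, ← Finset.sum_add_distrib,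
    ← Finset.sum_neg_distrib]
  simp_rw [Fintype.sum_prod_type (α₁ := Fin P.nQ), Fintype.sum_prod_type (α₁ := ∀ l, X l),
    Fintype.sum_prod_type (α₁ := ∀ k, Y k)]
  refine Finset.sum_congr rfl fun q _ => Finset.sum_congr rfl fun x _ =>
    Finset.sum_congr rfl fun y _ => Finset.sum_congr rfl fun u _ => ?_
  rcases (P.joint_nonneg hW (q, x, y, u)).eq_or_lt with h0 | h0
  · simp [← h0]
  · have h1 := P.outProb_pos hW h0
    have h2 := P.test_pos hW h0
    have h3 := P.partProb_pos hW h0 T S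
    dsimp only at h1 h2 h3
    rw [← Finset.mul_sum, ← Real.logb_prod _ _ fun k _ => (h2 k).ne', partRatio, lawRatio,
      ← mul_add, ← mul_neg, Real.logb_div (Finset.prod_pos fun k _ => h1 k).ne'
        (mul_pos (Finset.prod_pos fun k _ => h2 k) h3).ne',
      Real.logb_mul (Finset.prod_pos fun k _ => h2 k).ne' h3.ne',
      Real.logb_div h3.ne' (Finset.prod_pos fun k _ => h1 k).ne']
    ring

/-- `Q` is one component of the i.i.d. outcomes, so the average over time-sharing sequences is part
of the Chernoff bound and no typicality of `q^n` is needed. -/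
theorem exists_test_decay (P : TestLaw X Y) {W : (∀ l, X l) → (∀ k, Y k) → ℝ} (hW : IsChannel W)
    (k : Fin K) {δ : ℝ} (hδ : 0 < δ) :
    ∃ ρ : ℝ, 0 ≤ ρ ∧ ρ < 1 ∧ ∀ n : ℕ, ∑ q : Fin n → Fin P.nQ, (∏ i, P.pQ (q i)) * ∑ x, ∑ y, ∑ u,
        lawProb (blockInput (P.inputAt q)) (blockChannel (marginal W)) (blockTest (P.testAt q))
          x y u * ind ((2 : ℝ) ^ (n * (P.testExponent W k + δ)) <
            blockTest (P.testAt q) k (y k) (u k)) ≤ ρ ^ n := by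
  obtain ⟨ρ, h0, h1, h⟩ := exists_chernoff_logb (P.joint_mem hW)
    (g := fun ω => P.pU k (ω.2.2.1 k) ω.1 (ω.2.2.2 k)) (fun ω hω => P.test_pos hW hω k)
    (a := P.testExponent W k + δ) (lt_add_of_pos_right _ hδ)
  refine ⟨ρ, h0, h1, fun n => (h n).trans' ?_⟩
  rw [sum_block]
  refine Finset.sum_le_sum fun q _ => mul_le_mul_of_nonneg_left ?_
    (Finset.prod_nonneg fun i _ => P.pQ_mem.1 _)
  refine Finset.sum_le_sum fun x _ => Finset.sum_le_sum fun y _ => Finset.sum_le_sum fun u _ =>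
    mul_le_mul_of_nonneg_left (ind_mono fun h => ?_) ((P.isLaw_blockAt hW q).lawProb_nonneg x y u)
  exact h.le

theorem exists_part_decay (P : TestLaw X Y) {W : (∀ l, X l) → (∀ k, Y k) → ℝ} (hW : IsChannel W)
    (T : Finset (Fin L)) (S : Finset (Fin K)) {δ : ℝ} (hδ : 0 < δ) :
    ∃ ρ : ℝ, 0 ≤ ρ ∧ ρ < 1 ∧ ∀ n : ℕ, ∑ q : Fin n → Fin P.nQ, (∏ i, P.pQ (q i)) * ∑ x, ∑ y, ∑ u,
        lawProb (blockInput (P.inputAt q)) (blockChannel (marginal W)) (blockTest (P.testAt q))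
          x y u * ind ((2 : ℝ) ^ (n * (P.partExponent W T S + δ)) *
            ∏ k, outProb (blockChannel (marginal W)) (blockTest (P.testAt q)) k x (u k) <
            partProb (blockInput (P.inputAt q)) (blockChannel (marginal W))
              (blockTest (P.testAt q)) T S x u) ≤ ρ ^ n := by
  obtain ⟨ρ, h0, h1, h⟩ := exists_chernoff_logb (P.joint_mem hW)
    (g := P.partRatio W T S) (fun ω hω => div_pos (P.partProb_pos hW hω T S)
      (Finset.prod_pos fun k _ => P.outProb_pos hW hω k))
    (a := P.partExponent W T S + δ) (lt_add_of_pos_right _ hδ)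
  refine ⟨ρ, h0, h1, fun n => (h n).trans' ?_⟩
  rw [sum_block]
  refine Finset.sum_le_sum fun q _ => mul_le_mul_of_nonneg_left ?_
    (Finset.prod_nonneg fun i _ => P.pQ_mem.1 _)
  refine Finset.sum_le_sum fun x _ => Finset.sum_le_sum fun y _ => Finset.sum_le_sum fun u _ => ?_
  have hb := P.isLaw_blockAt hW q
  rcases (hb.lawProb_nonneg x y u).eq_or_lt with h2 | h2
  · simp [← h2]
  refine mul_le_mul_of_nonneg_left (ind_mono fun h => ?_) h2.le
  have h3 : 0 < ∏ k, outProb (blockChannel (marginal W)) (blockTest (P.testAt q)) k x (u k) :=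
    Finset.prod_pos fun k _ => h2.trans_le (hb.lawProb_le_outProb k x y u)
  have h4 : ∏ i, P.partRatio W T S ((P.outcomeEquiv n).symm (q, x, y, u) i) =
      partProb (blockInput (P.inputAt q)) (blockChannel (marginal W))
        (blockTest (P.testAt q)) T S x u /
      ∏ k, outProb (blockChannel (marginal W)) (blockTest (P.testAt q)) k x (u k) := by
    simp_rw [partRatio, partProb_block, outProb_block]
    rw [Finset.prod_div_distrib, Finset.prod_comm (γ := Fin K)]
    rfl
  rw [h4, le_div_iff₀ h3]
  exact h.le

end TestLaw

/-- The error of the one-shot code for a block, averaged over the time-sharing sequence. -/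
theorem exists_code_le {W : (∀ l, X l) → (∀ k, Y k) → ℝ} (hW : IsChannel W)
    (hCI : CondIndepOutputs W) {C : Fin K → ℝ} (hC : ∀ k, 0 ≤ C k) {R : Fin L → ℝ}
    (hR : ∀ l, 0 ≤ R l) (P : TestLaw X Y) {δ : ℝ} (hδ : 0 < δ)
    (h : ∀ T : Finset (Fin L), T.Nonempty → (∀ t ∈ T, 0 < R t) → ∀ S : Finset (Fin K),
      ∑ t ∈ T, R t + (2 * K + 2) * δ ≤
        ∑ s ∈ S, (C s - P.testExponent W s) - P.partExponent W T S)
    {ρ : Fin K → ℝ} {σ : Finset (Fin L) → Finset (Fin K) → ℝ} (n : ℕ)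
    (hρ : ∀ k, ∑ q : Fin n → Fin P.nQ, (∏ i, P.pQ (q i)) * ∑ x, ∑ y, ∑ u,
        lawProb (blockInput (P.inputAt q)) (blockChannel (marginal W)) (blockTest (P.testAt q))
          x y u * ind ((2 : ℝ) ^ (n * (P.testExponent W k + δ)) <
            blockTest (P.testAt q) k (y k) (u k)) ≤ ρ k ^ n)
    (hσ : ∀ T S, ∑ q : Fin n → Fin P.nQ, (∏ i, P.pQ (q i)) * ∑ x, ∑ y, ∑ u,
        lawProb (blockInput (P.inputAt q)) (blockChannel (marginal W)) (blockTest (P.testAt q))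
          x y u * ind ((2 : ℝ) ^ (n * (P.partExponent W T S + δ)) *
            ∏ k, outProb (blockChannel (marginal W)) (blockTest (P.testAt q)) k x (u k) <
            partProb (blockInput (P.inputAt q)) (blockChannel (marginal W))
              (blockTest (P.testAt q)) T S x u) ≤ σ T S ^ n) :
    ∃ c : Code X Y C n R, c.errorProb W ≤ ∑ k, (4 * ρ k ^ n + 16 * ((2 : ℝ) ^ (-δ)) ^ n) +
      2 ^ K * (∑ T, ∑ S, σ T S ^ n +
        ∑ _T : Finset (Fin L), ∑ _S : Finset (Fin K), 2 ^ K * ((2 : ℝ) ^ (-δ)) ^ n) := by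
  classical
  have hpow : ∀ a : ℝ, 0 < (2 : ℝ) ^ a := fun a => Real.rpow_pos_of_pos two_pos a
  set β : ℝ := (2 : ℝ) ^ (-δ) with hβ
  have hβn : β ^ n = (2 : ℝ) ^ (-(n * δ)) := by
    rw [hβ, ← Real.rpow_natCast, ← Real.rpow_mul two_pos.le]; congr 1; ring
  -- The exponent `-testExponent` is the conditional entropy of `U_k`. Taking `2δ` here against `δ`
  -- in the threshold `τ` makes `G τ ≤ 2^(-nδ)`, which also holds when the floor is zero.
  set G : Fin K → ℕ := fun k => ⌊(2 : ℝ) ^ (n * (-P.testExponent W k - 2 * δ))⌋₊ with hG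
  set τ : Fin K → ℝ := fun k => (2 : ℝ) ^ (n * (P.testExponent W k + δ)) with hτ
  set typ : ∀ q : Fin n → Fin P.nQ, (∀ l, Fin n → X l) → (∀ k, Fin n → Fin (P.nU k)) → Prop :=
    fun q x u => ∀ T S, partProb (blockInput (P.inputAt q)) (blockChannel (marginal W))
      (blockTest (P.testAt q)) T S x u ≤ (2 : ℝ) ^ (n * (P.partExponent W T S + δ)) *
        ∏ k, outProb (blockChannel (marginal W)) (blockTest (P.testAt q)) k x (u k) with htyp
  have hM : ∀ l, 0 < numIdx n (R l) := fun l => numIdx_pos n (hR l)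
  have hN : ∀ k, 0 < numIdx n (C k) := fun k => numIdx_pos n (hC k)
  have hone := fun q => exists_oneShot (G := G) (P.isLaw_blockAt hW q) hM hN
    (τ := τ) (fun k => (hpow _).le) (typ q)
  choose r g hrg using hone
  obtain ⟨c, hc⟩ := exists_code hCI C n R P r g
  refine ⟨c, hc.le.trans ?_⟩
  have hGτ : ∀ k, G k * τ k ≤ β ^ n := by
    intro k
    calc G k * τ k ≤ (2 : ℝ) ^ (n * (-P.testExponent W k - 2 * δ)) * τ k :=
          mul_le_mul_of_nonneg_right (Nat.floor_le (hpow _).le) (hpow _).le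
      _ = β ^ n := by
          rw [hτ, hβn, ← Real.rpow_add two_pos]; congr 1; ring
  have hNG : ∀ k, ((numIdx n (C k) : ℝ) * (G k + 1))⁻¹ ≤
      2 * (2 : ℝ) ^ (-(n * (C k - P.testExponent W k - 2 * δ))) := by
    intro k
    have h1 := half_le_numIdx n (hC k)
    have h2 := (Nat.lt_floor_add_one ((2 : ℝ) ^ (n * (-P.testExponent W k - 2 * δ)))).le
    have h3 : (2 : ℝ) ^ (n * C k) / 2 * (2 : ℝ) ^ (n * (-P.testExponent W k - 2 * δ)) ≤
        (numIdx n (C k) : ℝ) * (G k + 1) :=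
      mul_le_mul h1 h2 (hpow _).le (by positivity)
    refine (inv_anti₀ (mul_pos (half_pos (hpow _)) (hpow _)) h3).trans_eq ?_
    rw [div_mul_eq_mul_div, ← Real.rpow_add two_pos, inv_div, div_eq_mul_inv,
      ← Real.rpow_neg two_pos.le]
    congr 2; ring
  have hterm : ∀ q T S, ind T.Nonempty * ((∏ t ∈ T, ((numIdx n (R t) : ℝ) - 1)) *
      ((∏ k ∈ S, ((numIdx n (C k) : ℝ) * (G k + 1))⁻¹) *
        confusionMass (blockInput (P.inputAt q)) (blockChannel (marginal W))
          (blockTest (P.testAt q)) (typ q) T S)) ≤ 2 ^ K * β ^ n := by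
    intro q T S
    have hnn : 0 ≤ 2 ^ K * β ^ n := by positivity
    by_cases hT : T.Nonempty
    swap
    · rwa [ind_of_not hT, zero_mul]
    -- A user of rate zero has a single message, so the factor `M_t - 1` vanishes; hence the bounds
    -- are needed only for sets of users with positive rates.
    by_cases hpos : ∀ t ∈ T, 0 < R t
    swap
    · push Not at hpos
      obtain ⟨t, ht, hle⟩ := hpos
      rw [Finset.prod_eq_zero ht (by rw [hle.antisymm (hR t), numIdx_zero]; simp), zero_mul,
        mul_zero]
      exact hnn
    have h1 : ∏ t ∈ T, ((numIdx n (R t) : ℝ) - 1) ≤ (2 : ℝ) ^ (n * ∑ t ∈ T, R t) := by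
      rw [Finset.mul_sum, Real.rpow_sum_of_pos two_pos]
      refine Finset.prod_le_prod (fun t _ => ?_) fun t _ => ?_
      · have : (1 : ℝ) ≤ numIdx n (R t) := by exact_mod_cast hM t
        linarith
      · linarith [numIdx_le n (R t)]
    have h2 : ∏ k ∈ S, ((numIdx n (C k) : ℝ) * (G k + 1))⁻¹ ≤
        2 ^ K * (2 : ℝ) ^ (-(n * (∑ s ∈ S, (C s - P.testExponent W s) - 2 * K * δ))) := by
      refine (Finset.prod_le_prod (fun k _ => by positivity) fun k _ => hNG k).trans ?_
      rw [Finset.prod_mul_distrib, Finset.prod_const, ← Real.rpow_sum_of_pos two_pos]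
      have hcard : (S.card : ℝ) ≤ K := by exact_mod_cast (card_finset_fin_le S)
      refine mul_le_mul (pow_le_pow_right₀ one_le_two (card_finset_fin_le S))
        (Real.rpow_le_rpow_of_exponent_le one_le_two ?_) (hpow _).le (by positivity)
      rw [Finset.sum_neg_distrib, ← Finset.mul_sum, Finset.sum_sub_distrib, Finset.sum_const,
        nsmul_eq_mul, neg_le_neg_iff]
      refine mul_le_mul_of_nonneg_left ?_ (Nat.cast_nonneg n)
      nlinarith [mul_le_mul_of_nonneg_right hcard hδ.le]
    have h3 := confusionMass_le (P.isLaw_blockAt hW q) (typ := typ q) (T := T) (S := S)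
      (hpow (n * (P.partExponent W T S + δ))).le fun x u hxu => hxu T S
    have h4 : 0 ≤ confusionMass (blockInput (P.inputAt q)) (blockChannel (marginal W))
          (blockTest (P.testAt q)) (typ q) T S :=
      Finset.sum_nonneg fun x _ => Finset.sum_nonneg fun u _ =>
        mul_nonneg ((P.isLaw_blockAt hW q).input_nonneg x)
          (mul_nonneg (ind_nonneg _) ((P.isLaw_blockAt hW q).partProb_nonneg T S x u))
    rw [ind_of hT, one_mul]
    have h5 : 0 ≤ ∏ k ∈ S, ((numIdx n (C k) : ℝ) * (G k + 1))⁻¹ :=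
      Finset.prod_nonneg fun k _ => by positivity
    -- Of the slack `(2K+2)δ`, at most `2Kδ` is lost in the numbers of bins and survivors and `δ` in
    -- the typicality threshold; the last `δ` is the decay exponent.
    refine (mul_le_mul h1 (mul_le_mul h2 h3 h4 (by positivity)) (mul_nonneg h5 h4)
      (hpow _).le).trans ?_
    rw [mul_assoc, mul_left_comm, ← Real.rpow_add two_pos, ← Real.rpow_add two_pos, hβn]
    refine mul_le_mul_of_nonneg_left (Real.rpow_le_rpow_of_exponent_le one_le_two ?_)
      (by positivity)
    have := mul_le_mul_of_nonneg_left (h T hT hpos S) (Nat.cast_nonneg (α := ℝ) n)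
    linarith
  set E : (Fin n → Fin P.nQ) → Fin K → ℝ := fun q k => ∑ x, ∑ y, ∑ u,
    lawProb (blockInput (P.inputAt q)) (blockChannel (marginal W)) (blockTest (P.testAt q))
      x y u * ind (τ k < blockTest (P.testAt q) k (y k) (u k)) with hE
  set F : (Fin n → Fin P.nQ) → Finset (Fin L) → Finset (Fin K) → ℝ := fun q T S =>
    ∑ x, ∑ y, ∑ u,
      lawProb (blockInput (P.inputAt q)) (blockChannel (marginal W)) (blockTest (P.testAt q))
        x y u * ind ((2 : ℝ) ^ (n * (P.partExponent W T S + δ)) *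
          ∏ k, outProb (blockChannel (marginal W)) (blockTest (P.testAt q)) k x (u k) <
          partProb (blockInput (P.inputAt q)) (blockChannel (marginal W))
            (blockTest (P.testAt q)) T S x u) with hF
  have htypF : ∀ q, ∑ x, ∑ y, ∑ u,
      lawProb (blockInput (P.inputAt q)) (blockChannel (marginal W)) (blockTest (P.testAt q))
        x y u * ind (¬ typ q x u) ≤ ∑ T, ∑ S, F q T S := by
    intro q
    have hsplit : ∀ x y u,
        lawProb (blockInput (P.inputAt q)) (blockChannel (marginal W)) (blockTest (P.testAt q))
          x y u * ind (¬ typ q x u) ≤ ∑ z : Finset (Fin L) × Finset (Fin K),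
        lawProb (blockInput (P.inputAt q)) (blockChannel (marginal W)) (blockTest (P.testAt q))
          x y u * ind ((2 : ℝ) ^ (n * (P.partExponent W z.1 z.2 + δ)) *
          ∏ k, outProb (blockChannel (marginal W)) (blockTest (P.testAt q)) k x (u k) <
          partProb (blockInput (P.inputAt q)) (blockChannel (marginal W))
            (blockTest (P.testAt q)) z.1 z.2 x u) := by
      intro x y u
      rw [← Finset.mul_sum]
      refine mul_le_mul_of_nonneg_left ((ind_mono fun hnt => ?_).trans (ind_exists_le _))
        ((P.isLaw_blockAt hW q).lawProb_nonneg x y u)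
      simp only [htyp] at hnt
      push Not at hnt
      obtain ⟨T, S, hTS⟩ := hnt
      exact ⟨(T, S), hTS⟩
    refine (Finset.sum_le_sum fun x _ => Finset.sum_le_sum fun y _ =>
      Finset.sum_le_sum fun u _ => hsplit x y u).trans_eq ?_
    rw [← Fintype.sum_prod_type' (f := F q), hF]
    symm
    rw [Finset.sum_comm]
    refine Finset.sum_congr rfl fun x _ => ?_
    rw [Finset.sum_comm]
    refine Finset.sum_congr rfl fun y _ => ?_
    rw [Finset.sum_comm]
  have hbound : ∀ q, oneShotError (blockInput (P.inputAt q)) (blockChannel (marginal W)) (r q)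
      (g q) ≤ ∑ k, (4 * E q k + 16 * β ^ n) + 2 ^ K * (∑ T, ∑ S, F q T S +
        ∑ _T : Finset (Fin L), ∑ _S : Finset (Fin K), 2 ^ K * β ^ n) := by
    intro q
    refine (hrg q).trans (add_le_add (Finset.sum_le_sum fun k _ => ?_)
      (mul_le_mul_of_nonneg_left (add_le_add (htypF q) (Finset.sum_le_sum fun T _ => ?_))
        (by positivity)))
    · have := hGτ k
      simp only [hE]
      linarith
    · rw [Finset.mul_sum, Finset.mul_sum]
      exact Finset.sum_le_sum fun S _ => hterm q T S
  have hp : ∀ q : Fin n → Fin P.nQ, 0 ≤ ∏ i, P.pQ (q i) := fun q =>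
    Finset.prod_nonneg fun i _ => P.pQ_mem.1 _
  have hp1 : ∑ q : Fin n → Fin P.nQ, ∏ i, P.pQ (q i) = 1 :=
    sum_prod_eq_one (fun _ => P.pQ) fun _ => P.pQ_mem.2
  calc _ ≤ ∑ q : Fin n → Fin P.nQ, (∏ i, P.pQ (q i)) *
        (∑ k, (4 * E q k + 16 * β ^ n) + 2 ^ K * (∑ T, ∑ S, F q T S +
        ∑ _T : Finset (Fin L), ∑ _S : Finset (Fin K), 2 ^ K * β ^ n)) :=
        Finset.sum_le_sum fun q _ => mul_le_mul_of_nonneg_left (hbound q) (hp q)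
    _ = ∑ k, (4 * (∑ q : Fin n → Fin P.nQ, (∏ i, P.pQ (q i)) * E q k) + 16 * β ^ n) +
        2 ^ K * (∑ T, ∑ S, ∑ q : Fin n → Fin P.nQ, (∏ i, P.pQ (q i)) * F q T S +
        ∑ _T : Finset (Fin L), ∑ _S : Finset (Fin K), 2 ^ K * β ^ n) := by
        simp_rw [mul_add, Finset.sum_add_distrib, mul_add, Finset.sum_add_distrib,
          ← Finset.sum_mul, hp1, one_mul]
        have e1 : ∑ q : Fin n → Fin P.nQ, (∏ i, P.pQ (q i)) * ∑ k, 4 * E q k =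
            ∑ k, 4 * ∑ q : Fin n → Fin P.nQ, (∏ i, P.pQ (q i)) * E q k := by
          simp_rw [Finset.mul_sum]
          rw [Finset.sum_comm]
          exact Finset.sum_congr rfl fun k _ => Finset.sum_congr rfl fun q _ => by ring
        have e2 : ∑ q : Fin n → Fin P.nQ, (∏ i, P.pQ (q i)) * (2 ^ K * ∑ T, ∑ S, F q T S) =
            2 ^ K * ∑ T, ∑ S, ∑ q : Fin n → Fin P.nQ, (∏ i, P.pQ (q i)) * F q T S := by
          simp_rw [Finset.mul_sum]
          rw [Finset.sum_comm]
          refine Finset.sum_congr rfl fun T _ => ?_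
          rw [Finset.sum_comm]
          exact Finset.sum_congr rfl fun S _ => Finset.sum_congr rfl fun q _ => by ring
        rw [e1, e2]
    _ ≤ _ := by
        refine add_le_add (Finset.sum_le_sum fun k _ => ?_) (mul_le_mul_of_nonneg_left
          (add_le_add (Finset.sum_le_sum fun T _ => Finset.sum_le_sum fun S _ => hσ T S) le_rfl)
          (by positivity))
        have := hρ k
        simp only [hE]
        linarith

theorem achievable_of_lt {W : (∀ l, X l) → (∀ k, Y k) → ℝ} (hW : IsChannel W)
    (hCI : CondIndepOutputs W) {C : Fin K → ℝ} (hC : ∀ k, 0 ≤ C k) {R : Fin L → ℝ}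
    (hR : ∀ l, 0 ≤ R l) (P : TestLaw X Y) {δ : ℝ} (hδ : 0 < δ)
    (h : ∀ T : Finset (Fin L), T.Nonempty → (∀ t ∈ T, 0 < R t) → ∀ S : Finset (Fin K),
      ∑ t ∈ T, R t + (2 * K + 2) * δ ≤
        ∑ s ∈ S, (C s - P.testExponent W s) - P.partExponent W T S) :
    Achievable W C R := by
  refine ⟨hR, fun ε hε => ?_⟩
  choose ρ hρ0 hρ1 hρ using fun k => P.exists_test_decay hW k hδ
  choose σ hσ0 hσ1 hσ using fun T S => P.exists_part_decay hW T S hδ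
  have hβ0 : (0 : ℝ) ≤ 2 ^ (-δ) := (Real.rpow_pos_of_pos two_pos _).le
  have hβ1 : (2 : ℝ) ^ (-δ) < 1 := Real.rpow_lt_one_of_one_lt_of_neg one_lt_two (neg_neg_of_pos hδ)
  have hβ := tendsto_pow_atTop_nhds_zero_of_lt_one hβ0 hβ1
  have hlim : Filter.Tendsto (fun n : ℕ => ∑ k, (4 * ρ k ^ n + 16 * ((2 : ℝ) ^ (-δ)) ^ n) +
      2 ^ K * (∑ T, ∑ S, σ T S ^ n +
        ∑ _T : Finset (Fin L), ∑ _S : Finset (Fin K), 2 ^ K * ((2 : ℝ) ^ (-δ)) ^ n))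
      Filter.atTop (nhds 0) := by
    have h1 : Filter.Tendsto (fun n : ℕ => ∑ k, (4 * ρ k ^ n + 16 * ((2 : ℝ) ^ (-δ)) ^ n))
        Filter.atTop (nhds (∑ _k : Fin K, (4 * 0 + 16 * 0))) :=
      tendsto_finsetSum _ fun k _ =>
        ((tendsto_pow_atTop_nhds_zero_of_lt_one (hρ0 k) (hρ1 k)).const_mul 4).add (hβ.const_mul 16)
    have h2 : Filter.Tendsto (fun n : ℕ => ∑ T, ∑ S, σ T S ^ n) Filter.atTop
        (nhds (∑ _T : Finset (Fin L), ∑ _S : Finset (Fin K), 0)) :=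
      tendsto_finsetSum _ fun T _ => tendsto_finsetSum _ fun S _ =>
        tendsto_pow_atTop_nhds_zero_of_lt_one (hσ0 T S) (hσ1 T S)
    have h3 : Filter.Tendsto (fun n : ℕ => ∑ _T : Finset (Fin L), ∑ _S : Finset (Fin K),
        2 ^ K * ((2 : ℝ) ^ (-δ)) ^ n) Filter.atTop
        (nhds (∑ _T : Finset (Fin L), ∑ _S : Finset (Fin K), 2 ^ K * 0)) :=
      tendsto_finsetSum _ fun T _ => tendsto_finsetSum _ fun S _ => hβ.const_mul _
    simpa using h1.add ((h2.add h3).const_mul (2 ^ K))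
  obtain ⟨N, hN⟩ := Filter.eventually_atTop.1 (hlim.eventually (ge_mem_nhds hε))
  refine ⟨N, fun n hn => ?_⟩
  obtain ⟨c, hc⟩ := exists_code_le hW hCI hC hR P hδ h n (fun k => hρ k n) fun T S => hσ T S n
  exact ⟨c, hc.trans (hN n hn)⟩

theorem mem_capacityRegion {W : (∀ l, X l) → (∀ k, Y k) → ℝ} (hW : IsChannel W)
    (hCI : CondIndepOutputs W) {C : Fin K → ℝ} (hC : ∀ k, 0 ≤ C k) {R : Fin L → ℝ}
    (hR : R ∈ singleLetterRegion W C) : R ∈ capacityRegion W C := by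
  obtain ⟨hR0, P, hP⟩ := hR
  rw [capacityRegion, Metric.mem_closure_iff]
  intro ε hε
  have hmax : ∀ l, R l - max (R l - ε / 2) 0 ≤ ε / 2 := fun l => by
    linarith [le_max_left (R l - ε / 2) 0]
  have hmax' : ∀ l, max (R l - ε / 2) 0 ≤ R l := fun l => max_le (by linarith) (hR0 l)
  have hK : (0 : ℝ) < 2 * K + 2 := by positivity
  -- Lower every rate by `ε/2`, truncating at zero. In a nonempty set of users whose new rates are
  -- positive, a single member already yields the slack `ε/2`, of which `δ` is the share `1/(2K+2)`.
  refine ⟨fun l => max (R l - ε / 2) 0, ?_, ?_⟩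
  · refine achievable_of_lt hW hCI hC (fun l => le_max_right _ _) P (δ := ε / 2 / (2 * K + 2))
      (by positivity) fun T hT hpos S => ?_
    rw [← P.bound_eq_exponents hW, mul_div_cancel₀ _ hK.ne']
    refine le_trans ?_ (hP T hT S)
    obtain ⟨t, ht⟩ := hT
    have h1 : max (R t - ε / 2) 0 = R t - ε / 2 := by
      rcases max_choice (R t - ε / 2) 0 with h | h
      · exact h
      · exact absurd (hpos t ht) (by rw [h]; exact lt_irrefl _)
    rw [← Finset.add_sum_erase _ _ ht, ← Finset.add_sum_erase _ _ ht, h1]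
    have := Finset.sum_le_sum fun l (_ : l ∈ T.erase t) => hmax' l
    linarith
  · rw [dist_pi_lt_iff hε]
    intro l
    rw [Real.dist_eq, abs_of_nonneg (by linarith [hmax' l])]
    linarith [hmax l]

end Achievability

/-! ## Entropies of product laws -/

section Chain

variable {Ω : Type*} [Fintype Ω] {α γ δ : Type*} {p : Ω → ℝ}

/-- Two chain-rule expansions of one joint entropy, that is, the symmetry of conditional mutual
information. -/
theorem condEnt_exchange (hp : ∀ ω, 0 ≤ p ω) (A : Ω → α) (J : Ω → δ) (C : Ω → γ) :
    condEnt p J C + condEnt p A (fun ω => (J ω, C ω)) =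
      condEnt p A C + condEnt p J (fun ω => (A ω, C ω)) := by
  rw [← condEnt_chain hp, ← condEnt_chain hp]
  exact condEnt_congr p (fun _ _ => Iff.rfl) fun ω ω' _ => by
    simp only [Prod.mk.injEq]; exact and_comm

/-- The entropies given all other coordinates add up to at most the joint entropy. -/
theorem sum_condEnt_others_le {ι : Type*} [Fintype ι] [DecidableEq ι] {β : ι → Type*}
    [∀ i, Fintype (β i)] [Fintype γ] (hp : ∀ ω, 0 ≤ p ω) (A : Ω → ∀ i, β i) (C : Ω → γ) :
    ∑ i, condEnt p (fun ω => A ω i) (fun ω => (({i}ᶜ : Finset ι).restrict (A ω), C ω)) ≤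
      condEnt p A C := by
  have key : ∀ D : Finset ι,
      ∑ i ∈ D, condEnt p (fun ω => A ω i) (fun ω => (({i}ᶜ : Finset ι).restrict (A ω), C ω)) ≤
        condEnt p (fun ω => D.restrict (A ω)) C := by
    intro D
    induction D using Finset.induction_on with
    | empty => simpa using condEnt_nonneg hp _ _
    | insert a D ha ih =>
      rw [Finset.sum_insert ha, add_comm]
      have h1 : condEnt p (fun ω => (insert a D).restrict (A ω)) C =
          condEnt p (fun ω => (D.restrict (A ω), A ω a)) C := by
        refine condEnt_congr p (fun _ _ => Iff.rfl) fun ω ω' _ => ?_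
        rw [restrict_eq_restrict_iff, Prod.mk.injEq, restrict_eq_restrict_iff,
          Finset.forall_mem_insert, and_comm]
      -- The chain rule conditions the new coordinate only on those in `D`; conditioning on all
      -- others can only lower its entropy.
      rw [h1, condEnt_chain hp]
      refine add_le_add ih (condEnt_anti hp _ _ _
        (fun z => (fun d : D => z.1 ⟨d, ?_⟩, z.2)) fun ω => rfl)
      simp only [Finset.mem_compl, Finset.mem_singleton]
      rintro h
      exact ha (h ▸ d.2)
  refine (key Finset.univ).trans_eq ?_
  exact condEnt_congr p (fun _ _ => Iff.rfl) fun ω ω' _ => by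
    rw [restrict_eq_restrict_iff, funext_iff]; simp

end Chain

/-! ### Informations about independent coordinates -/

section Resample

variable {ι : Type*} [Fintype ι] [DecidableEq ι] {α : ι → Type*} [∀ i, Fintype (α i)]
  {B J : Type*} [Fintype B]

/-- The law of independent coordinates followed by a kernel. -/
def kernelLaw (w : ∀ i, α i → ℝ) (v : (∀ i, α i) → B → ℝ) (ω : (∀ i, α i) × B) : ℝ :=
  (∏ i, w i (ω.1 i)) * v ω.1 ω.2

/-- The probability that `j` takes the value `u` when the coordinates in `T` are drawn afresh. -/
def resampled (w : ∀ i, α i → ℝ) (v : (∀ i, α i) → B → ℝ) (j : (∀ i, α i) → B → J)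
    (T : Finset ι) (z : ∀ i, α i) (u : J) : ℝ :=
  ∑ z' : ∀ i, α i, (∏ i, w i (z' i)) * mass (v (T.piecewise z' z)) (j (T.piecewise z' z)) u

variable {w : ∀ i, α i → ℝ} {v : (∀ i, α i) → B → ℝ}

omit [DecidableEq ι] in
theorem kernelLaw_nonneg (hw : ∀ i, w i ∈ stdSimplex ℝ (α i)) (hv : ∀ z, v z ∈ stdSimplex ℝ B)
    (ω : (∀ i, α i) × B) : 0 ≤ kernelLaw w v ω :=
  mul_nonneg (Finset.prod_nonneg fun i _ => (hw i).1 _) ((hv _).1 _)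

/-- Since the coordinates are independent, conditioning on those outside `T` means redrawing those
in `T`. Conditional entropies thus become expected logarithms of explicit kernels, the form taken by
the single-letter bounds. -/
theorem condEnt_resampled (hw : ∀ i, w i ∈ stdSimplex ℝ (α i))
    (hv : ∀ z, v z ∈ stdSimplex ℝ B) (j : (∀ i, α i) → B → J) (T : Finset ι) :
    condEnt (kernelLaw w v) (fun ω => j ω.1 ω.2) (fun ω => Tᶜ.restrict ω.1) =
      -∑ ω, kernelLaw w v ω * Real.logb 2 (resampled w v j T ω.1 (j ω.1 ω.2)) := by
  classical
  refine condEnt_eq_of_kernel (kernelLaw_nonneg hw hv) _ fun ω _ => ?_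
  have h1 := sum_prod_agree w (fun i => (hw i).2) T ω.1
    (fun z => mass (v z) (j z) (j ω.1 ω.2))
  have h2 := sum_prod_agree w (fun i => (hw i).2) T ω.1 (fun _ => 1)
  simp only [mul_one] at h2
  rw [sum_prod_eq_one w fun i => (hw i).2, mul_one] at h2
  have e1 : mass (kernelLaw w v) (fun ω => (j ω.1 ω.2, Tᶜ.restrict ω.1))
      (j ω.1 ω.2, Tᶜ.restrict ω.1) = ∑ x' : ∀ i, α i, if ∀ i ∈ Tᶜ, x' i = ω.1 i then
        (∏ i, w i (x' i)) * mass (v x') (j x') (j ω.1 ω.2) else 0 := by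
    rw [mass, Fintype.sum_prod_type]
    refine Finset.sum_congr rfl fun z _ => ?_
    simp only [Prod.mk.injEq, restrict_eq_restrict_iff, kernelLaw]
    by_cases h : ∀ i ∈ Tᶜ, z i = ω.1 i
    · rw [if_pos h, mass, Finset.mul_sum]
      refine Finset.sum_congr rfl fun b _ => ?_
      by_cases hb : j z b = j ω.1 ω.2
      · rw [if_pos hb, if_pos ⟨hb, h⟩]
      · rw [if_neg hb, if_neg fun hc => hb hc.1, mul_zero]
    · rw [if_neg h]
      exact Finset.sum_eq_zero fun b _ => if_neg fun hc => h hc.2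
  have e2 : mass (kernelLaw w v) (fun ω => Tᶜ.restrict ω.1) (Tᶜ.restrict ω.1) =
      ∑ x' : ∀ i, α i, if ∀ i ∈ Tᶜ, x' i = ω.1 i then ∏ i, w i (x' i) else 0 := by
    rw [mass, Fintype.sum_prod_type]
    refine Finset.sum_congr rfl fun z _ => ?_
    simp only [restrict_eq_restrict_iff, kernelLaw]
    by_cases h : ∀ i ∈ Tᶜ, z i = ω.1 i
    · rw [if_pos h]
      simp only [if_pos h]
      rw [← Finset.mul_sum, (hv z).2, mul_one]
    · rw [if_neg h]
      exact Finset.sum_eq_zero fun b _ => if_neg h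
  rw [e1, e2, h1, h2, resampled]

/-- By independence the value is the same for every `T` containing `i`; comparing `T = {i}` with `T
= univ` gives `H(Z_i | others) = H(Z_i)`. -/
theorem condEnt_coord (hw : ∀ i, w i ∈ stdSimplex ℝ (α i)) (hv : ∀ z, v z ∈ stdSimplex ℝ B)
    {i : ι} {T : Finset ι} (hi : i ∈ T) :
    condEnt (kernelLaw w v) (fun ω => ω.1 i) (fun ω => Tᶜ.restrict ω.1) =
      -∑ ω, kernelLaw w v ω * Real.logb 2 (w i (ω.1 i)) := by
  classical
  rw [condEnt_resampled hw hv (fun z _ => z i) T]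
  congr 1
  refine Finset.sum_congr rfl fun ω _ => ?_
  congr 2
  have : ∀ z' : ∀ i, α i, mass (v (T.piecewise z' ω.1)) (fun _ => T.piecewise z' ω.1 i) (ω.1 i) =
      if z' i = ω.1 i then 1 else 0 := by
    intro z'
    simp only [mass, Finset.piecewise_eq_of_mem _ _ _ hi]
    split_ifs
    · exact (hv _).2
    · simp
  simp_rw [resampled, this]
  rw [sum_prod_mul_eval_pi w (fun i => (hw i).2) i (fun a => if a = ω.1 i then 1 else 0)]
  simp

variable [Fintype J]

/-- The information carried by all coordinates is at most the sum of the information carried by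
each of them given the others. -/
theorem resampled_others_le (hw : ∀ i, w i ∈ stdSimplex ℝ (α i)) (hv : ∀ z, v z ∈ stdSimplex ℝ B)
    (j : (∀ i, α i) → B → J) :
    ∑ ω, kernelLaw w v ω * Real.logb 2 (resampled w v j ∅ ω.1 (j ω.1 ω.2)) -
        ∑ ω, kernelLaw w v ω * Real.logb 2 (resampled w v j Finset.univ ω.1 (j ω.1 ω.2)) ≤
      ∑ i, (∑ ω, kernelLaw w v ω * Real.logb 2 (resampled w v j ∅ ω.1 (j ω.1 ω.2)) -
        ∑ ω, kernelLaw w v ω * Real.logb 2 (resampled w v j {i} ω.1 (j ω.1 ω.2))) := by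
  classical
  have hp := kernelLaw_nonneg hw hv
  set p := kernelLaw w v
  have g := condEnt_resampled hw hv j
  set Jv : (∀ i, α i) × B → J := fun ω => j ω.1 ω.2
  set A : (∀ i, α i) × B → ∀ i, α i := fun ω => ω.1
  -- With `Z` the coordinates, `I(Z;J) = H(Z) - H(Z|J)`, where `H(Z) ≤ ∑ H(Z_i)` and `H(Z|J) ≥ ∑
  -- H(Z_i|J, others)`; by independence `H(Z_i) = H(Z_i|others)`. Restriction to `univᶜ` is a
  -- trivial conditioning.
  have e0 := condEnt_exchange hp A Jv (fun ω => (Finset.univᶜ : Finset ι).restrict (A ω))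
  have e1 : condEnt p Jv (fun ω => (A ω, (Finset.univᶜ : Finset ι).restrict (A ω))) =
      condEnt p Jv (fun ω => (∅ᶜ : Finset ι).restrict (A ω)) :=
    condEnt_congr p (fun ω ω' => by
      simp only [Prod.mk.injEq, funext_iff]; simp)
      fun _ _ _ => Iff.rfl
  have e2 := condEnt_pi_le hp A (fun ω => (Finset.univᶜ : Finset ι).restrict (A ω))
  have e3 := sum_condEnt_others_le hp A
    (fun ω => (Jv ω, (Finset.univᶜ : Finset ι).restrict (A ω)))
  have e4 : ∀ i, condEnt p Jv (fun ω => ({i}ᶜ : Finset ι).restrict (A ω)) +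
      condEnt p (fun ω => A ω i) (fun ω => (({i}ᶜ : Finset ι).restrict (A ω),
        Jv ω, (Finset.univᶜ : Finset ι).restrict (A ω))) =
      condEnt p (fun ω => A ω i) (fun ω => (Finset.univᶜ : Finset ι).restrict (A ω)) +
      condEnt p Jv (fun ω => (∅ᶜ : Finset ι).restrict (A ω)) := by
    intro i
    have f0 := condEnt_exchange hp (fun ω => A ω i) Jv (fun ω => ({i}ᶜ : Finset ι).restrict (A ω))
    have f1 : condEnt p (fun ω => A ω i) (fun ω => (({i}ᶜ : Finset ι).restrict (A ω),
        Jv ω, (Finset.univᶜ : Finset ι).restrict (A ω))) =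
        condEnt p (fun ω => A ω i) (fun ω => (Jv ω, ({i}ᶜ : Finset ι).restrict (A ω))) :=
      condEnt_congr p (fun ω ω' => by
        simp only [Prod.mk.injEq, restrict_eq_restrict_iff]; simp [and_comm])
        fun _ _ _ => Iff.rfl
    have f2 : condEnt p Jv (fun ω => (A ω i, ({i}ᶜ : Finset ι).restrict (A ω))) =
        condEnt p Jv (fun ω => (∅ᶜ : Finset ι).restrict (A ω)) :=
      condEnt_congr p (fun ω ω' => by
        simp only [Prod.mk.injEq, restrict_eq_restrict_iff]
        constructor
        · rintro ⟨h1, h2⟩ i' _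
          by_cases h : i' = i
          · subst h; exact h1
          · exact h2 i' (by simpa using h)
        · intro h
          exact ⟨h i (by simp), fun i' _ => h i' (by simp)⟩)
        fun _ _ _ => Iff.rfl
    have f3 : condEnt p (fun ω => A ω i) (fun ω => ({i}ᶜ : Finset ι).restrict (A ω)) =
        condEnt p (fun ω => A ω i) (fun ω => (Finset.univᶜ : Finset ι).restrict (A ω)) :=
      (condEnt_coord hw hv (Finset.mem_singleton_self i)).trans
        (condEnt_coord hw hv (Finset.mem_univ i)).symm
    rw [f1, f0, f2, f3]
  rw [e1] at e0
  have e5 : ∑ i, (condEnt p Jv (fun ω => ({i}ᶜ : Finset ι).restrict (A ω)) -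
      condEnt p Jv (fun ω => (∅ᶜ : Finset ι).restrict (A ω))) =
      ∑ i, condEnt p (fun ω => A ω i) (fun ω => (Finset.univᶜ : Finset ι).restrict (A ω)) -
      ∑ i, condEnt p (fun ω => A ω i) (fun ω => (({i}ᶜ : Finset ι).restrict (A ω),
        Jv ω, (Finset.univᶜ : Finset ι).restrict (A ω))) := by
    rw [← Finset.sum_sub_distrib]
    exact Finset.sum_congr rfl fun i _ => by linarith [e4 i]
  have e6 : ∀ T, ∑ ω, p ω * Real.logb 2 (resampled w v j T ω.1 (j ω.1 ω.2)) =
      -condEnt p Jv (fun ω => (Tᶜ : Finset ι).restrict (A ω)) := fun T => by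
    rw [g T, neg_neg]
  simp_rw [e6, neg_sub_neg]
  rw [e5]
  linarith

/-- The information a function carries about each of the independent coordinates adds up to at most
its entropy. -/
theorem sum_resampled_le (hw : ∀ i, w i ∈ stdSimplex ℝ (α i)) (hv : ∀ z, v z ∈ stdSimplex ℝ B)
    (j : (∀ i, α i) → B → J) :
    ∑ i, (∑ ω, kernelLaw w v ω * Real.logb 2 (resampled w v j {i}ᶜ ω.1 (j ω.1 ω.2)) -
        ∑ ω, kernelLaw w v ω * Real.logb 2 (resampled w v j Finset.univ ω.1 (j ω.1 ω.2))) ≤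
      -∑ ω, kernelLaw w v ω * Real.logb 2 (resampled w v j Finset.univ ω.1 (j ω.1 ω.2)) := by
  classical
  have hp := kernelLaw_nonneg hw hv
  set p := kernelLaw w v
  have g := condEnt_resampled hw hv j
  set Jv : (∀ i, α i) × B → J := fun ω => j ω.1 ω.2
  set A : (∀ i, α i) × B → ∀ i, α i := fun ω => ω.1
  set C : (∀ i, α i) × B → _ := fun ω => (Finset.univᶜ : Finset ι).restrict (A ω) with hC
  -- The roles are reversed: independence gives `H(Z) ≥ ∑ H(Z_i)` and subadditivity `H(Z|J) ≤ ∑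
  -- H(Z_i|J)`, so `∑ I(Z_i;J) ≤ I(Z;J) ≤ H(J)`.
  have e0 := condEnt_exchange hp A Jv C
  have e1 := condEnt_nonneg hp Jv (fun ω => (A ω, C ω))
  have e2 := condEnt_pi_le hp A (fun ω => (Jv ω, C ω))
  have e3 := sum_condEnt_others_le hp A C
  have e4 : ∀ i, condEnt p (fun ω => A ω i) (fun ω => (({i}ᶜ : Finset ι).restrict (A ω), C ω)) =
      condEnt p (fun ω => A ω i) C := by
    intro i
    have f1 : condEnt p (fun ω => A ω i) (fun ω => (({i}ᶜ : Finset ι).restrict (A ω), C ω)) =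
        condEnt p (fun ω => A ω i) (fun ω => ({i}ᶜ : Finset ι).restrict (A ω)) :=
      condEnt_congr p (fun ω ω' => by
        simp only [hC, Prod.mk.injEq, restrict_eq_restrict_iff]; simp)
        fun _ _ _ => Iff.rfl
    rw [f1]
    exact (condEnt_coord hw hv (Finset.mem_singleton_self i)).trans
        (condEnt_coord hw hv (Finset.mem_univ i)).symm
  have e5 : ∀ i, condEnt p Jv C - condEnt p Jv (fun ω => ({i}ᶜᶜ : Finset ι).restrict (A ω)) =
      condEnt p (fun ω => A ω i) C - condEnt p (fun ω => A ω i) (fun ω => (Jv ω, C ω)) := by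
    intro i
    have f0 := condEnt_exchange hp (fun ω => A ω i) Jv C
    have f1 : condEnt p Jv (fun ω => (A ω i, C ω)) =
        condEnt p Jv (fun ω => ({i}ᶜᶜ : Finset ι).restrict (A ω)) :=
      condEnt_congr p (fun ω ω' => by
        simp only [hC, Prod.mk.injEq, restrict_eq_restrict_iff]; simp)
        fun _ _ _ => Iff.rfl
    linarith
  have e6 : ∀ T, ∑ ω, p ω * Real.logb 2 (resampled w v j T ω.1 (j ω.1 ω.2)) =
      -condEnt p Jv (fun ω => (Tᶜ : Finset ι).restrict (A ω)) := fun T => by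
    rw [g T, neg_neg]
  simp_rw [e6, neg_sub_neg, neg_neg]
  rw [Finset.sum_congr rfl fun i _ => e5 i, Finset.sum_sub_distrib]
  simp_rw [e4] at e3
  linarith

end Resample

/-! ## The one-shot converse -/

section OneShotConverse

variable {L K : ℕ} {A : Fin L → Type*} {B : Fin K → Type*} [∀ l, Fintype (A l)] [∀ k, Fintype (B k)]
  {M : Fin L → ℕ} {N : Fin K → ℕ} {pX : ∀ l, A l → ℝ} {V : ∀ k, (∀ l, A l) → B k → ℝ}

theorem condEnt_kernel {Z B J : Type*} [Fintype Z] [Fintype B] {w : Z → ℝ} {v : Z → B → ℝ}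
    (hw : ∀ z, 0 ≤ w z) (hv : ∀ z, v z ∈ stdSimplex ℝ B) (j : B → J) :
    condEnt (fun ω : Z × B => w ω.1 * v ω.1 ω.2) (fun ω => j ω.2) (fun ω => ω.1) =
      -∑ ω : Z × B, w ω.1 * v ω.1 ω.2 * Real.logb 2 (mass (v ω.1) j (j ω.2)) := by
  classical
  refine condEnt_eq_of_kernel (fun ω => mul_nonneg (hw _) ((hv _).1 _)) _ fun ω _ => ?_
  rw [mass, mass, Fintype.sum_prod_type, Fintype.sum_prod_type, Finset.sum_eq_single ω.1,
    Finset.sum_eq_single ω.1, mass]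
  · simp only [if_true, Prod.mk.injEq, and_true]
    rw [← Finset.mul_sum, (hv _).2, mul_one, Finset.mul_sum]
    exact Finset.sum_congr rfl fun b _ => by split_ifs <;> simp
  · intro z _ hz
    simp [hz]
  · simp
  · intro z _ hz
    simp [hz]
  · simp

/-- The joint law of the inputs and the outputs. -/
def inputOutputLaw (pX : ∀ l, A l → ℝ) (V : ∀ k, (∀ l, A l) → B k → ℝ) :
    (∀ l, A l) × (∀ k, B k) → ℝ :=
  kernelLaw pX fun x (b : ∀ k, B k) => ∏ k, V k x (b k)

/-- The joint law of the codebooks, the messages and the relay observations. -/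
def codingLaw (M : Fin L → ℕ) (pX : ∀ l, A l → ℝ) (V : ∀ k, (∀ l, A l) → B k → ℝ)
    (ω : ((∀ l, Fin (M l) → A l) × (∀ l, Fin (M l))) × (∀ k, B k)) : ℝ :=
  (∏ l, ∏ i, pX l (ω.1.1 l i)) * (∏ l, (M l : ℝ)⁻¹) *
    ∏ k, V k (codeword ω.1.1 ω.1.2) (ω.2 k)

omit [∀ l, Fintype (A l)] in
theorem channel_mem_pi (hV : ∀ k x, V k x ∈ stdSimplex ℝ (B k)) (x : ∀ l, A l) :
    (fun b : ∀ k, B k => ∏ k, V k x (b k)) ∈ stdSimplex ℝ (∀ k, B k) :=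
  ⟨fun _ => Finset.prod_nonneg fun k _ => (hV k x).1 _,
    sum_prod_eq_one (fun k => V k x) fun k => (hV k x).2⟩

theorem sum_message_inv (hM : ∀ l, 0 < M l) :
    ∑ _m : ∀ l, Fin (M l), ∏ l, (M l : ℝ)⁻¹ = 1 := by
  rw [← Fintype.prod_sum (f := fun l (_ : Fin (M l)) => (M l : ℝ)⁻¹)]
  refine Finset.prod_eq_one fun l _ => ?_
  have : (M l : ℝ) ≠ 0 := by exact_mod_cast (hM l).ne'
  simp [this]

/-- For any messages, the selected entries of random codebooks are independent with laws `pX`.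
Obliviousness enters here: the relay maps depend on the outputs alone, so they see only this law of
the inputs. -/
theorem mass_codingLaw (hX : ∀ l, pX l ∈ stdSimplex ℝ (A l)) (hM : ∀ l, 0 < M l) :
    mass (codingLaw M pX V) (fun ω => (codeword ω.1.1 ω.1.2, ω.2)) =
      inputOutputLaw pX V := by
  classical
  ext ⟨x, b⟩
  have h1 : mass (codingLaw M pX V) (fun ω => (codeword ω.1.1 ω.1.2, ω.2)) (x, b) =
      ∑ m : ∀ l, Fin (M l), (∏ l, (M l : ℝ)⁻¹) *
        ∑ c : ∀ l, Fin (M l) → A l, (∏ l, ∏ i, pX l (c l i)) *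
          (if codeword c m = x then ∏ k, V k (codeword c m) (b k) else 0) := by
    rw [mass, Fintype.sum_prod_type, Fintype.sum_prod_type, Finset.sum_comm]
    refine Finset.sum_congr rfl fun m _ => ?_
    rw [Finset.mul_sum]
    refine Finset.sum_congr rfl fun c _ => ?_
    simp only [Prod.mk.injEq, codingLaw]
    by_cases h : codeword c m = x
    · simp only [h, true_and, if_true, Finset.sum_ite_eq', Finset.mem_univ]
      ring
    · simp [h]
  rw [h1]
  have h2 : ∀ m : ∀ l, Fin (M l), ∑ c : ∀ l, Fin (M l) → A l, (∏ l, ∏ i, pX l (c l i)) *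
      (if codeword c m = x then ∏ k, V k (codeword c m) (b k) else 0) =
      (∏ l, pX l (x l)) * ∏ k, V k x (b k) := by
    intro m
    rw [sum_codeword (fun l => (hX l).2) m (fun x' => if x' = x then ∏ k, V k x' (b k) else 0)]
    simp
  simp_rw [h2]
  rw [← Finset.sum_mul, sum_message_inv hM, one_mul, inputOutputLaw, kernelLaw]

theorem codingLaw_mem (hX : ∀ l, pX l ∈ stdSimplex ℝ (A l))
    (hV : ∀ k x, V k x ∈ stdSimplex ℝ (B k)) (hM : ∀ l, 0 < M l) :
    codingLaw M pX V ∈ stdSimplex ℝ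
      (((∀ l, Fin (M l) → A l) × (∀ l, Fin (M l))) × (∀ k, B k)) := by
  classical
  refine ⟨fun ω => mul_nonneg (mul_nonneg (Finset.prod_nonneg fun l _ => Finset.prod_nonneg
    fun i _ => (hX l).1 _) (Finset.prod_nonneg fun l _ => by positivity))
      (Finset.prod_nonneg fun k _ => (hV k _).1 _), ?_⟩
  rw [← sum_mass (codingLaw M pX V) (fun ω => (codeword ω.1.1 ω.1.2, ω.2)), mass_codingLaw hX hM,
    Fintype.sum_prod_type]
  simp_rw [inputOutputLaw, kernelLaw, ← Finset.mul_sum, (channel_mem_pi hV _).2, mul_one]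
  exact sum_prod_eq_one pX fun l => (hX l).2

/-- The messages are uniform given the codebooks and the other messages. -/
theorem condEnt_messages (hX : ∀ l, pX l ∈ stdSimplex ℝ (A l))
    (hV : ∀ k x, V k x ∈ stdSimplex ℝ (B k)) (hM : ∀ l, 0 < M l) (T : Finset (Fin L)) :
    condEnt (codingLaw M pX V) (fun ω => ω.1.2) (fun ω => (ω.1.1, Tᶜ.restrict ω.1.2)) =
      ∑ t ∈ T, Real.logb 2 (M t) := by
  classical
  have hM' : ∀ l, (M l : ℝ) ≠ 0 := fun l => by exact_mod_cast (hM l).ne'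
  have hp := codingLaw_mem hX hV hM
  have hfst : mass (codingLaw M pX V) Prod.fst =
      fun z => (∏ l, ∏ i, pX l (z.1 l i)) * ∏ l, (M l : ℝ)⁻¹ := by
    ext z
    rw [mass, Fintype.sum_prod_type, Finset.sum_eq_single z]
    · simp only [if_true, codingLaw]
      rw [← Finset.mul_sum, (channel_mem_pi hV _).2, mul_one]
    · intro z' _ hz; simp [hz]
    · simp
  have h := condEnt_comp (codingLaw M pX V) Prod.fst (fun z => z.2)
    (fun z => (z.1, Tᶜ.restrict z.2))
  rw [h, hfst]
  rw [condEnt_eq_of_kernel (fun z => mul_nonneg (Finset.prod_nonneg fun l _ =>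
    Finset.prod_nonneg fun i _ => (hX l).1 _) (Finset.prod_nonneg fun l _ => by positivity))
    (fun _ => ∏ t ∈ T, (M t : ℝ)⁻¹)]
  · rw [← Finset.sum_mul]
    have h1 : ∑ z : (∀ l, Fin (M l) → A l) × (∀ l, Fin (M l)),
        (∏ l, ∏ i, pX l (z.1 l i)) * ∏ l, (M l : ℝ)⁻¹ = 1 := by
      rw [← hp.2, ← sum_mass (codingLaw M pX V) Prod.fst, hfst]
    rw [h1, one_mul, Real.logb_prod _ _ fun t _ => inv_ne_zero (hM' t), ← Finset.sum_neg_distrib]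
    exact Finset.sum_congr rfl fun t _ => by rw [Real.logb_inv, neg_neg]
  · rintro ⟨c, m⟩ -
    have h2 := sum_prod_agree (fun l (_ : Fin (M l)) => (M l : ℝ)⁻¹)
      (fun l => by simp [hM']) T m (fun _ => 1)
    simp only [mul_one] at h2
    rw [sum_message_inv hM, mul_one] at h2
    have e1 : mass (fun z : (∀ l, Fin (M l) → A l) × (∀ l, Fin (M l)) =>
        (∏ l, ∏ i, pX l (z.1 l i)) * ∏ l, (M l : ℝ)⁻¹)
        (fun z => (z.1, Tᶜ.restrict z.2)) (c, Tᶜ.restrict m) =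
        (∏ l, ∏ i, pX l (c l i)) * ∏ l ∈ Tᶜ, (M l : ℝ)⁻¹ := by
      rw [mass, Fintype.sum_prod_type, Finset.sum_eq_single c, ← h2, Finset.mul_sum]
      · refine Finset.sum_congr rfl fun m' _ => ?_
        simp only [Prod.mk.injEq, restrict_eq_restrict_iff, true_and]
        split_ifs <;> simp
      · intro c' _ hc
        simp [hc]
      · simp
    have e2 : mass (fun z : (∀ l, Fin (M l) → A l) × (∀ l, Fin (M l)) =>
        (∏ l, ∏ i, pX l (z.1 l i)) * ∏ l, (M l : ℝ)⁻¹)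
        (fun z => (z.2, z.1, Tᶜ.restrict z.2)) (m, c, Tᶜ.restrict m) =
        (∏ l, ∏ i, pX l (c l i)) * ∏ l, (M l : ℝ)⁻¹ := by
      rw [mass, Finset.sum_eq_single (c, m)]
      · simp
      · rintro ⟨c', m'⟩ _ hc
        rw [if_neg]
        simp only [Prod.mk.injEq, not_and]
        exact fun h1 h2 => absurd (Prod.ext h2 h1) hc
      · simp
    dsimp only
    rw [e1, e2, mul_assoc, mul_comm (∏ l ∈ Tᶜ, _), Finset.prod_mul_prod_compl]

/-- The converse for a single use of the channel. -/
theorem oneShot_converse (hX : ∀ l, pX l ∈ stdSimplex ℝ (A l))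
    (hV : ∀ k x, V k x ∈ stdSimplex ℝ (B k)) (hM : ∀ l, 0 < M l) (r : ∀ k, B k → Fin (N k))
    (g : (∀ l, Fin (M l) → A l) → (∀ k, Fin (N k)) → ∀ l, Fin (M l)) (T : Finset (Fin L)) :
    ∑ t ∈ T, Real.logb 2 (M t) ≤
      1 + oneShotError pX V r g * ∑ l, Real.logb 2 (M l) +
        (condEnt (inputOutputLaw pX V) (fun ω k => r k (ω.2 k))
          (fun ω => Tᶜ.restrict ω.1) -
        condEnt (inputOutputLaw pX V) (fun ω k => r k (ω.2 k))
          (fun ω => ω.1)) := by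
  classical
  have hp := codingLaw_mem hX hV hM
  set p := codingLaw M pX V with hpdef
  set Jv : ((∀ l, Fin (M l) → A l) × (∀ l, Fin (M l))) × (∀ k, B k) → ∀ k, Fin (N k) :=
    fun ω k => r k (ω.2 k) with hJ
  set C : ((∀ l, Fin (M l) → A l) × (∀ l, Fin (M l))) × (∀ k, B k) → _ :=
    fun ω => (ω.1.1, Tᶜ.restrict ω.1.2) with hC
  -- Here `H(M|C) = H(M|J,C) + H(J|C) - H(J|M,C)`. Fano bounds the first term; `C` determines the
  -- codewords of `Tᶜ`, which bounds the second; given messages and codebooks, the law of `J`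
  -- depends on the codewords only.
  have e0 := condEnt_exchange hp.1 (fun ω => ω.1.2) Jv C
  have e1 := condEnt_messages hX hV hM T
  have e2 : condEnt p (fun ω => ω.1.2) (fun ω => (Jv ω, C ω)) ≤
      1 + oneShotError pX V r g * ∑ l, Real.logb 2 (M l) := by
    refine (condEnt_anti hp.1 _ (fun ω => (ω.1.1, Jv ω)) _ (fun z => (z.2.1, z.1))
      fun ω => rfl).trans ?_
    refine (condEnt_le_fano hp _ _ (fun z => g z.1 z.2)).trans_eq ?_
    rw [Fintype.card_pi, Nat.cast_prod, Real.logb_prod _ _ fun l _ => by simp [(hM l).ne']]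
    congr 2
    · rw [Fintype.sum_prod_type, oneShotError]
      refine Finset.sum_congr rfl fun z _ => Finset.sum_congr rfl fun b _ => ?_
      rw [ind_eq_ite, hpdef, codingLaw]
      simp only [ne_eq, ite_not, hJ]
    · simp
  have e3 : condEnt p Jv C ≤ condEnt (inputOutputLaw pX V)
      (fun ω k => r k (ω.2 k)) (fun ω => Tᶜ.restrict ω.1) := by
    rw [← mass_codingLaw hX hM, ← condEnt_comp]
    exact condEnt_anti hp.1 _ _ _ (fun z => fun l : (Tᶜ : Finset (Fin L)) => z.1 l (z.2 l))
      fun ω => rfl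
  have e4 : condEnt p Jv (fun ω => (ω.1.2, C ω)) =
      condEnt (inputOutputLaw pX V) (fun ω k => r k (ω.2 k))
        (fun ω => ω.1) := by
    have f1 : condEnt p Jv (fun ω => (ω.1.2, C ω)) = condEnt p Jv (fun ω => ω.1) :=
      condEnt_congr p (fun ω ω' => by
        simp only [hC, Prod.mk.injEq, restrict_eq_restrict_iff]
        constructor
        · rintro ⟨h1, h2, -⟩
          exact Prod.ext h2 h1
        · intro h
          simp [h]) fun _ _ _ => Iff.rfl
    rw [f1]
    have f2 := condEnt_kernel (w := fun z : (∀ l, Fin (M l) → A l) × (∀ l, Fin (M l)) =>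
        (∏ l, ∏ i, pX l (z.1 l i)) * ∏ l, (M l : ℝ)⁻¹)
      (v := fun z (b : ∀ k, B k) => ∏ k, V k (codeword z.1 z.2) (b k))
      (fun z => mul_nonneg (Finset.prod_nonneg fun l _ => Finset.prod_nonneg
        fun i _ => (hX l).1 _) (Finset.prod_nonneg fun l _ => by positivity))
      (fun z => channel_mem_pi hV _) (fun (b : ∀ k, B k) k => r k (b k))
    have f3 := condEnt_kernel (w := fun x : ∀ l, A l => ∏ l, pX l (x l))
      (v := fun x (b : ∀ k, B k) => ∏ k, V k x (b k)) (fun x => Finset.prod_nonneg fun l _ => (hX l).1 _)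
      (fun z => channel_mem_pi hV _) (fun (b : ∀ k, B k) k => r k (b k))
    refine f2.trans (Eq.trans ?_ f3.symm)
    congr 1
    have f4 := sum_mul_comp p (fun ω => (codeword ω.1.1 ω.1.2, ω.2)) (fun ω => Real.logb 2
      (mass (fun b : ∀ k, B k => ∏ k, V k ω.1 (b k)) (fun b k => r k (b k)) fun k => r k (ω.2 k)))
    rw [mass_codingLaw hX hM] at f4
    exact f4
  linarith

/-- The converse for a single use of the channel, with the descriptions of the relays in `S`
replaced by their rates. -/
theorem oneShot_converse_subset (hX : ∀ l, pX l ∈ stdSimplex ℝ (A l))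
    (hV : ∀ k x, V k x ∈ stdSimplex ℝ (B k)) (hM : ∀ l, 0 < M l) (hN : ∀ k, 0 < N k)
    (r : ∀ k, B k → Fin (N k))
    (g : (∀ l, Fin (M l) → A l) → (∀ k, Fin (N k)) → ∀ l, Fin (M l)) (T : Finset (Fin L))
    (S : Finset (Fin K)) :
    ∑ t ∈ T, Real.logb 2 (M t) ≤
      1 + oneShotError pX V r g * ∑ l, Real.logb 2 (M l) + ∑ s ∈ S, Real.logb 2 (N s) +
        (condEnt (inputOutputLaw pX V)
          (fun ω => Sᶜ.restrict fun k => r k (ω.2 k)) (fun ω => Tᶜ.restrict ω.1) -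
        condEnt (inputOutputLaw pX V) (fun ω k => r k (ω.2 k))
          (fun ω => ω.1)) := by
  classical
  have h := oneShot_converse hX hV hM r g T
  have hp : inputOutputLaw pX V ∈
      stdSimplex ℝ ((∀ l, A l) × (∀ k, B k)) := by
    refine ⟨kernelLaw_nonneg hX fun x => channel_mem_pi hV x, ?_⟩
    rw [Fintype.sum_prod_type]
    simp_rw [inputOutputLaw, kernelLaw, ← Finset.mul_sum, (channel_mem_pi hV _).2, mul_one]
    exact sum_prod_eq_one pX fun l => (hX l).2
  set p := inputOutputLaw pX V
  have e1 : condEnt p (fun ω k => r k (ω.2 k)) (fun ω => Tᶜ.restrict ω.1) =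
      condEnt p (fun ω => (Sᶜ.restrict (fun k => r k (ω.2 k)), S.restrict fun k => r k (ω.2 k)))
        (fun ω => Tᶜ.restrict ω.1) := by
    refine condEnt_congr p (fun _ _ => Iff.rfl) fun ω ω' _ => ?_
    rw [Prod.mk.injEq, restrict_eq_restrict_iff, restrict_eq_restrict_iff]
    constructor
    · exact fun h => ⟨fun k _ => congrFun h k, fun k _ => congrFun h k⟩
    · intro h
      ext1 k
      by_cases hk : k ∈ S
      · exact h.2 k hk
      · exact h.1 k (by simpa using hk)
  rw [e1, condEnt_chain hp.1] at h
  have e2 := condEnt_le_log_card hp (fun ω => S.restrict fun k => r k (ω.2 k))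
    (fun ω => (Sᶜ.restrict (fun k => r k (ω.2 k)), Tᶜ.restrict ω.1))
  rw [Fintype.card_pi, Nat.cast_prod, Real.logb_prod _ _ fun k _ => by simp [(hN k).ne']] at e2
  have e3 : ∑ k : S, Real.logb 2 (Fintype.card (Fin (N k))) = ∑ s ∈ S, Real.logb 2 (N s) := by
    simp_rw [Fintype.card_fin]
    exact Finset.sum_coe_sort S fun k => Real.logb 2 (N k)
  rw [e3] at e2
  linarith

end OneShotConverse

/-! ## From blocks to single letters -/

section SingleLetter

/-- Coordinate `i` is overwritten by `b`, so the weight there enters only through its total mass,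
which is one. -/
theorem sum_prod_mul_update_eq {ι α : Type*} [Fintype ι] [DecidableEq ι] [Fintype α]
    {w w' : ι → α → ℝ} {i : ι} (hi : ∑ a, w i a = 1) (hi' : ∑ a, w' i a = 1)
    (h : ∀ j, j ≠ i → w j = w' j) (b : α) (f : (ι → α) → ℝ) :
    ∑ y : ι → α, (∏ j, w j (y j)) * f (Function.update y i b) =
      ∑ y : ι → α, (∏ j, w' j (y j)) * f (Function.update y i b) := by
  classical
  have key : ∀ w : ι → α → ℝ, ∑ a, w i a = 1 →
      ∑ y : ι → α, (∏ j, w j (y j)) * f (Function.update y i b) =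
        ∑ z : ι → α, (∏ j, if j = i then (if z i = b then 1 else 0) else w j (z j)) * f z := by
    intro w hw
    have h1 : ∀ y : ι → α, (∏ j, w j (y j)) * f (Function.update y i b) =
        ∑ z : ι → α, (∏ j, w j (y j) * if z j = Function.update y i b j then 1 else 0) * f z := by
      intro y
      rw [Finset.sum_eq_single (Function.update y i b)]
      · simp
      · intro z _ hz
        obtain ⟨j, hj⟩ := Function.ne_iff.1 hz
        rw [Finset.prod_eq_zero (Finset.mem_univ j) (by simp [hj]), zero_mul]
      · simp
    simp_rw [h1]
    rw [Finset.sum_comm]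
    refine Finset.sum_congr rfl fun z _ => ?_
    rw [← Finset.sum_mul]
    congr 1
    have h2 : ∀ y : ι → α, ∏ j, w j (y j) * (if z j = Function.update y i b j then 1 else 0) =
        ∏ j, w j (y j) * (if z j = (if j = i then b else y j) then 1 else 0) := by
      intro y
      refine Finset.prod_congr rfl fun j _ => ?_
      by_cases hj : j = i
      · subst hj; simp
      · simp [hj]
    simp_rw [h2]
    rw [← Fintype.prod_sum (f := fun j a => w j a * if z j = (if j = i then b else a) then 1 else 0)]
    refine Finset.prod_congr rfl fun j _ => ?_
    by_cases hj : j = i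
    · subst hj
      simp [hw]
    · simp [hj]
  rw [key w hi, key w' hi']
  refine Finset.sum_congr rfl fun z _ => ?_
  congr 1
  refine Finset.prod_congr rfl fun j _ => ?_
  by_cases hj : j = i
  · simp [hj]
  · rw [if_neg hj, if_neg hj, h j hj]

theorem mass_pi_restrict {κ : Type*} [Fintype κ] [DecidableEq κ] {B J : κ → Type*}
    [∀ k, Fintype (B k)] {v : ∀ k, B k → ℝ} (hv : ∀ k, ∑ b, v k b = 1) (r : ∀ k, B k → J k)
    (D : Finset κ) (u : ∀ k, J k) :
    mass (fun b : ∀ k, B k => ∏ k, v k (b k)) (fun b => D.restrict fun k => r k (b k))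
      (D.restrict u) = ∏ k ∈ D, mass (v k) (r k) (u k) := by
  classical
  have h1 : ∀ b : ∀ k, B k, (if (D.restrict fun k => r k (b k)) = D.restrict u then
      ∏ k, v k (b k) else 0) = ∏ k, if k ∈ D → r k (b k) = u k then v k (b k) else 0 := by
    intro b
    rw [Fintype.prod_ite_zero]
    simp only [restrict_eq_restrict_iff]
  rw [mass, Finset.sum_congr rfl fun b _ => (by convert h1 b : _ = _)]
  rw [← Fintype.prod_sum (f := fun k b => if k ∈ D → r k b = u k then v k b else 0),
    ← Finset.prod_mul_prod_compl D, Finset.prod_eq_one (s := Dᶜ), mul_one]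
  · refine Finset.prod_congr rfl fun k hk => ?_
    simp [hk, mass]
  · intro k hk
    have : k ∉ D := by simpa using hk
    simp [this, hv]

variable {L K n : ℕ} {X : Fin L → Type*} {Y : Fin K → Type*} {J : Fin K → Type*}

/-- The inputs of all users at time `i`. -/
def column (x : ∀ l, Fin n → X l) (i : Fin n) : ∀ l, X l := fun l => x l i

/-- Replace the inputs at time `i`. -/
def setColumn (x : ∀ l, Fin n → X l) (i : Fin n) (a : ∀ l, X l) : ∀ l, Fin n → X l :=
  fun l => Function.update (x l) i (a l)

theorem column_setColumn (x : ∀ l, Fin n → X l) (i : Fin n) (a : ∀ l, X l) :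
    column (setColumn x i a) i = a := by
  ext l; simp [column, setColumn]

theorem column_setColumn_of_ne (x : ∀ l, Fin n → X l) {i i' : Fin n} (h : i' ≠ i)
    (a : ∀ l, X l) : column (setColumn x i a) i' = column x i' := by
  ext l; simp [column, setColumn, h]

theorem setColumn_setColumn (x : ∀ l, Fin n → X l) (i : Fin n) (a a' : ∀ l, X l) :
    setColumn (setColumn x i a) i a' = setColumn x i a' := by
  ext l; simp [setColumn]

variable [∀ k, Fintype (Y k)]

/-- The law of the index sent by relay `k`, given the inputs. -/
def indexLaw (V : ∀ k, (∀ l, X l) → Y k → ℝ) (r : ∀ k, (Fin n → Y k) → J k) (k : Fin K)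
    (x : ∀ l, Fin n → X l) (u : J k) : ℝ := mass (blockChannel V k x) (r k) u

/-- The law of the index sent by relay `k`, given the inputs and the observation at time `i`. -/
def letterTest (V : ∀ k, (∀ l, X l) → Y k → ℝ) (r : ∀ k, (Fin n → Y k) → J k)
    (x : ∀ l, Fin n → X l) (i : Fin n) (k : Fin K) (b : Y k) (u : J k) : ℝ :=
  mass (blockChannel V k x) (fun y => r k (Function.update y i b)) u

variable {V : ∀ k, (∀ l, X l) → Y k → ℝ} {r : ∀ k, (Fin n → Y k) → J k}

theorem mass_eq_sum_ind {Ω α : Type*} [Fintype Ω] (p : Ω → ℝ) (A : Ω → α) (a : α) :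
    mass p A a = ∑ ω, p ω * ind (A ω = a) := by
  classical
  rw [mass]
  exact Finset.sum_congr rfl fun ω _ => by rw [ind_eq_ite]; split_ifs <;> simp

/-- The inputs at time `i` influence only the observation at time `i`, which is overwritten. The
test channel therefore depends on the other inputs alone, and these may be put into `Q`. -/
theorem letterTest_setColumn (hV : ∀ k x, V k x ∈ stdSimplex ℝ (Y k)) (x : ∀ l, Fin n → X l)
    (i : Fin n) (a : ∀ l, X l) (k : Fin K) (b : Y k) (u : J k) :
    letterTest V r (setColumn x i a) i k b u = letterTest V r x i k b u := by
  simp_rw [letterTest, mass_eq_sum_ind, blockChannel]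
  exact sum_prod_mul_update_eq (w := fun j => V k (column (setColumn x i a) j))
    (w' := fun j => V k (column x j)) (hV _ _).2 (hV _ _).2
    (fun j hj => by rw [column_setColumn_of_ne x hj]) b (fun y => ind (r k y = u))

/-- Averaging the overwritten observation over the channel with input `a` is resampling it, so one
recovers the law of the index when the inputs at time `i` are `a`. -/
theorem outProb_letterTest (hV : ∀ k x, V k x ∈ stdSimplex ℝ (Y k)) (x : ∀ l, Fin n → X l)
    (i : Fin n) (k : Fin K) (a : ∀ l, X l) (u : J k) :
    outProb V (letterTest V r x i) k a u = indexLaw V r k (setColumn x i a) u := by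
  have h := sum_prod_mul_update (fun j => V k (column (setColumn x i a) j)) i (hV _ _).2
    (fun y => ind (r k y = u))
  rw [indexLaw, mass_eq_sum_ind]
  refine Eq.trans ?_ h
  simp_rw [outProb, ← letterTest_setColumn hV x i a, letterTest, mass_eq_sum_ind, Finset.mul_sum]
  rw [Finset.sum_comm]
  refine Finset.sum_congr rfl fun y _ => Finset.sum_congr rfl fun b _ => ?_
  rw [column_setColumn, blockChannel]
  change _ * ((∏ j, V k (column (setColumn x i a) j) (y j)) * _) = _
  ring

/-- The observation at time `i` and the index have the joint law of the single-letter scheme. -/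
theorem sum_letterTest_mul [∀ k, Fintype (J k)] (hV : ∀ k x, V k x ∈ stdSimplex ℝ (Y k))
    (x : ∀ l, Fin n → X l) (i : Fin n) (φ : (∀ k, Y k) → (∀ k, J k) → ℝ) :
    ∑ b : ∀ k, Y k, ∑ u : ∀ k, J k, ((∏ k, V k (column x i) (b k)) *
        ∏ k, letterTest V r x i k (b k) (u k)) * φ b u =
      ∑ y : ∀ k, Fin n → Y k, (∏ k, blockChannel V k x (y k)) *
        φ (fun k => y k i) (fun k => r k (y k)) := by
  classical
  have h := sum_prod_mul_comp (fun k => blockChannel V k x) (fun k y => (y i, r k y))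
    (fun z => φ (fun k => (z k).1) (fun k => (z k).2))
  rw [h]
  rw [← Fintype.sum_prod_type' (f := fun (b : ∀ k, Y k) (u : ∀ k, J k) =>
    ((∏ k, V k (column x i) (b k)) * ∏ k, letterTest V r x i k (b k) (u k)) * φ b u)]
  symm
  refine Fintype.sum_equiv ⟨fun z => (fun k => (z k).1, fun k => (z k).2),
    fun z k => (z.1 k, z.2 k), fun _ => rfl, fun _ => rfl⟩ _ _ fun z => ?_
  simp only [Equiv.coe_fn_mk]
  rw [← Finset.prod_mul_distrib]
  congr 1
  refine Finset.prod_congr rfl fun k _ => ?_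
  -- Resampling the observation at time `i` factors the joint law of that observation and the index.
  have h1 := sum_prod_mul_update (fun j => V k (column x j)) i (hV _ _).2
    (fun y => if (y i, r k y) = z k then 1 else 0)
  simp only [mul_ite, mul_one, mul_zero, Function.update_self] at h1
  refine Eq.trans h1.symm ?_
  rw [letterTest, mass_eq_sum_ind, Finset.mul_sum]
  refine Finset.sum_congr rfl fun y _ => ?_
  rw [Finset.sum_eq_single (z k).1]
  · simp only [ind_eq_ite, Prod.ext_iff, true_and, blockChannel]
    change (∏ j, V k (column x j) (y j)) * _ = _ * ((∏ j, V k (column x j) (y j)) * _)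
    split_ifs <;> ring
  · intro b _ hb
    rw [if_neg]
    exact fun hc => hb (congrArg Prod.fst hc)
  · simp

variable [∀ l, Fintype (X l)] {pX : Fin n → ∀ l, X l → ℝ}

theorem sum_blockInput_setColumn (hX : ∀ i l, pX i l ∈ stdSimplex ℝ (X l)) (i : Fin n)
    (f : (∀ l, Fin n → X l) → ℝ) :
    ∑ x : ∀ l, Fin n → X l, (∏ l, blockInput pX l (x l)) *
        ∑ a : ∀ l, X l, (∏ l, pX i l (a l)) * f (setColumn x i a) =
      ∑ x : ∀ l, Fin n → X l, (∏ l, blockInput pX l (x l)) * f x := by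
  have h := sum_prod_mul_update (fun i (a : ∀ l, X l) => ∏ l, pX i l (a l)) i
    (sum_prod_eq_one (pX i) fun l => (hX i l).2) (fun z => f fun l j => z j l)
  have hprod : ∀ x : ∀ l, Fin n → X l, ∏ l, blockInput pX l (x l) = ∏ j, ∏ l, pX j l (x l j) :=
    fun x => Finset.prod_comm
  simp_rw [hprod]
  refine Eq.trans (Fintype.sum_equiv (Equiv.piComm fun (l : Fin L) (_ : Fin n) => X l) _ _
    fun x => ?_) (h.trans (Fintype.sum_equiv
      (Equiv.piComm fun (_ : Fin n) (l : Fin L) => X l) _ _ fun x => rfl))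
  change _ = (∏ j, ∏ l, pX j l (x l j)) * _
  congr 1
  refine Finset.sum_congr rfl fun a _ => ?_
  congr 2
  ext l j
  by_cases hj : j = i
  · subst hj; simp [setColumn]
  · simp [setColumn, hj, Function.swap]

/-- The mean over a block. -/
def blockMean (pX : Fin n → ∀ l, X l → ℝ) (V : ∀ k, (∀ l, X l) → Y k → ℝ)
    (φ : (∀ l, Fin n → X l) → (∀ k, Fin n → Y k) → ℝ) : ℝ :=
  ∑ ω, inputOutputLaw (blockInput pX) (blockChannel V) ω * φ ω.1 ω.2

theorem blockMean_eq (φ : (∀ l, Fin n → X l) → (∀ k, Fin n → Y k) → ℝ) :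
    blockMean pX V φ = ∑ x, (∏ l, blockInput pX l (x l)) *
      ∑ y : ∀ k, Fin n → Y k, (∏ k, blockChannel V k x (y k)) * φ x y := by
  simp_rw [blockMean, Fintype.sum_prod_type, inputOutputLaw, kernelLaw, Finset.mul_sum, mul_assoc]

/-- With the inputs at other times as part of `Q` and the indices as auxiliary variables, the
single-letter law reproduces the true joint law of the inputs, the observations at time `i` and the
indices. -/
theorem sum_lawProb_letterTest [∀ k, Fintype (J k)] (hX : ∀ i l, pX i l ∈ stdSimplex ℝ (X l))
    (hV : ∀ k x, V k x ∈ stdSimplex ℝ (Y k)) (i : Fin n)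
    (φ : (∀ l, Fin n → X l) → (∀ k, Y k) → (∀ k, J k) → ℝ) :
    ∑ x, (∏ l, blockInput pX l (x l)) * ∑ a, ∑ b, ∑ u,
        lawProb (pX i) V (letterTest V r x i) a b u * φ (setColumn x i a) b u =
      blockMean pX V fun x y => φ x (fun k => y k i) (fun k => r k (y k)) := by
  rw [blockMean_eq]
  refine Eq.trans ?_ ((sum_blockInput_setColumn hX i fun x => ∑ b : ∀ k, Y k, ∑ u : ∀ k, J k,
    ((∏ k, V k (column x i) (b k)) * ∏ k, letterTest V r x i k (b k) (u k)) * φ x b u).trans ?_)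
  · refine Finset.sum_congr rfl fun x _ => ?_
    congr 1
    refine Finset.sum_congr rfl fun a _ => ?_
    rw [column_setColumn]
    simp_rw [letterTest_setColumn hV, Finset.mul_sum, lawProb, mul_assoc]
  · exact Finset.sum_congr rfl fun x _ => by rw [sum_letterTest_mul hV x i (φ x)]

theorem isLaw_letterTest [∀ k, Fintype (J k)] (hX : ∀ i l, pX i l ∈ stdSimplex ℝ (X l))
    (hV : ∀ k x, V k x ∈ stdSimplex ℝ (Y k)) (i : Fin n) (x : ∀ l, Fin n → X l) :
    IsLaw (pX i) V (letterTest V r x i) where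
  input_mem := hX i
  channel_mem := hV
  test_mem k b := by
    have h : blockChannel V k x ∈ stdSimplex ℝ (Fin n → Y k) :=
      block_mem (α := ∀ l, X l) (f := fun _ => V k) (fun _ => hV k) (column x)
    exact ⟨fun u => mass_nonneg h.1 _ _, (sum_mass _ _).trans h.2⟩

/-- The law of the indices of the relays outside `S` when the inputs of the users in `T` at time `i`
are drawn afresh. -/
def columnPart (pX : Fin n → ∀ l, X l → ℝ) (V : ∀ k, (∀ l, X l) → Y k → ℝ)
    (r : ∀ k, (Fin n → Y k) → J k) (T : Finset (Fin L)) (S : Finset (Fin K)) (i : Fin n)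
    (x : ∀ l, Fin n → X l) (u : ∀ k, J k) : ℝ :=
  ∑ a : ∀ l, X l, (∏ l, pX i l (a l)) *
    ∏ k ∈ Sᶜ, indexLaw V r k (setColumn x i (T.piecewise a (column x i))) (u k)

/-- Each kernel of the auxiliary law is a conditional law of the indices within the block, so the
averaged bound is a combination of block expectations that can be summed over the times. -/
theorem sum_rateFun_letterTest [∀ k, Fintype (J k)] (hX : ∀ i l, pX i l ∈ stdSimplex ℝ (X l))
    (hV : ∀ k x, V k x ∈ stdSimplex ℝ (Y k)) (C : Fin K → ℝ) (T : Finset (Fin L))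
    (S : Finset (Fin K)) (i : Fin n) :
    ∑ x, (∏ l, blockInput pX l (x l)) * rateFun C V (pX i) (letterTest V r x i) T S =
      ∑ s ∈ S, C s + (∑ k, blockMean pX V (fun x y => Real.logb 2 (indexLaw V r k x (r k (y k)))) -
        ∑ s ∈ S, blockMean pX V
          (fun x y => Real.logb 2 (letterTest V r x i s (y s i) (r s (y s)))) -
        blockMean pX V
          fun x y => Real.logb 2 (columnPart pX V r T S i x fun k => r k (y k))) := by
  have h1 : ∑ x : ∀ l, Fin n → X l, ∏ l, blockInput pX l (x l) = 1 :=
    sum_prod_eq_one (blockInput pX) fun l => sum_prod_eq_one (fun i => pX i l) fun i => (hX i l).2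
  have h2 : ∀ x : ∀ l, Fin n → X l, rateFun C V (pX i) (letterTest V r x i) T S =
      ∑ s ∈ S, C s + ∑ a, ∑ b, ∑ u, lawProb (pX i) V (letterTest V r x i) a b u *
        (∑ k, Real.logb 2 (indexLaw V r k (setColumn x i a) (u k)) -
          ∑ s ∈ S, Real.logb 2 (letterTest V r (setColumn x i a) i s (b s) (u s)) -
          Real.logb 2 (columnPart pX V r T S i (setColumn x i a) u)) := by
    intro x
    rw [rateFun]
    congr 1
    refine Finset.sum_congr rfl fun a _ => Finset.sum_congr rfl fun b _ =>
      Finset.sum_congr rfl fun u _ => ?_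
    rw [(isLaw_letterTest hX hV i x).mul_logb_lawRatio T S a b u, mul_sub, mul_sub,
      Finset.mul_sum, Finset.mul_sum]
    simp_rw [outProb_letterTest hV, letterTest_setColumn hV, partProb, columnPart,
      outProb_letterTest hV, setColumn_setColumn, column_setColumn]
  simp_rw [h2, mul_add]
  rw [Finset.sum_add_distrib, ← Finset.sum_mul, h1, one_mul,
    sum_lawProb_letterTest hX hV i (fun x b u => ∑ k, Real.logb 2 (indexLaw V r k x (u k)) -
      ∑ s ∈ S, Real.logb 2 (letterTest V r x i s (b s) (u s)) -
      Real.logb 2 (columnPart pX V r T S i x u))]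
  simp_rw [blockMean, mul_sub, Finset.mul_sum, Finset.sum_sub_distrib]
  rw [Finset.sum_comm, Finset.sum_comm (s := Finset.univ) (t := S)]

end SingleLetter

/-! ## Bounding block informations by single letters -/

section BlockBound

variable {L K n : ℕ} {X : Fin L → Type*} {Y : Fin K → Type*} {J : Fin K → Type*}
  [∀ l, Fintype (X l)] [∀ k, Fintype (Y k)]
  {pX : Fin n → ∀ l, X l → ℝ} {V : ∀ k, (∀ l, X l) → Y k → ℝ} {r : ∀ k, (Fin n → Y k) → J k}

theorem blockInput_mem (hX : ∀ i l, pX i l ∈ stdSimplex ℝ (X l)) (l : Fin L) :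
    blockInput pX l ∈ stdSimplex ℝ (Fin n → X l) :=
  block_mem (α := Unit) (fun i _ => hX i l) fun _ => ()

omit [∀ l, Fintype (X l)] in
theorem blockChannel_mem (hV : ∀ k x, V k x ∈ stdSimplex ℝ (Y k)) (k : Fin K)
    (x : ∀ l, Fin n → X l) : blockChannel V k x ∈ stdSimplex ℝ (Fin n → Y k) :=
  block_mem (α := ∀ l, X l) (f := fun _ => V k) (fun _ => hV k) (column x)

theorem blockMean_eval (hV : ∀ k x, V k x ∈ stdSimplex ℝ (Y k)) (k : Fin K)
    (φ : (∀ l, Fin n → X l) → (Fin n → Y k) → ℝ) :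
    blockMean pX V (fun x y => φ x (y k)) =
      ∑ x, (∏ l, blockInput pX l (x l)) * ∑ y, blockChannel V k x y * φ x y := by
  rw [blockMean_eq]
  refine Finset.sum_congr rfl fun x _ => ?_
  rw [sum_prod_mul_eval_pi (fun k => blockChannel V k x) (fun k => (blockChannel_mem hV k x).2) k
    (φ x)]

/-- The information about the observations at the different times is at most the entropy of the
index. -/
theorem sum_letterTest_le (hX : ∀ i l, pX i l ∈ stdSimplex ℝ (X l))
    (hV : ∀ k x, V k x ∈ stdSimplex ℝ (Y k)) (k : Fin K) [Fintype (J k)] :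
    ∑ i, (blockMean pX V (fun x y => Real.logb 2 (letterTest V r x i k (y k i) (r k (y k)))) -
        blockMean pX V fun x y => Real.logb 2 (indexLaw V r k x (r k (y k)))) ≤
      -blockMean pX V fun x y => Real.logb 2 (indexLaw V r k x (r k (y k))) := by
  classical
  have h1 : ∀ i, blockMean pX V
      (fun x y => Real.logb 2 (letterTest V r x i k (y k i) (r k (y k)))) = _ := fun i =>
    blockMean_eval hV k fun x y => Real.logb 2 (letterTest V r x i k (y i) (r k y))
  rw [blockMean_eval hV k fun x y => Real.logb 2 (indexLaw V r k x (r k y))]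
  simp_rw [h1, ← Finset.sum_sub_distrib, ← mul_sub]
  rw [Finset.sum_comm, ← Finset.sum_neg_distrib]
  refine Finset.sum_le_sum fun x _ => ?_
  rw [← Finset.mul_sum, ← mul_neg]
  refine mul_le_mul_of_nonneg_left ?_ (Finset.prod_nonneg fun l _ => (blockInput_mem hX l).1 _)
  -- For fixed inputs the independent coordinates are the observations at the different times, and
  -- the index is a deterministic function of them; hence the trivial kernel on `Unit`.
  have h2 := sum_resampled_le (w := fun i => V k (column x i)) (v := fun _ (_ : Unit) => 1)
    (fun i => hV _ _) (fun _ => ⟨fun _ => zero_le_one, by simp⟩) (fun y _ => r k y)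
  have h3 : ∀ T : Finset (Fin n), ∀ y u, resampled (fun i => V k (column x i))
      (fun _ (_ : Unit) => 1) (fun y _ => r k y) T y u =
      mass (blockChannel V k x) (fun y' => r k (T.piecewise y' y)) u := by
    intro T y u
    rw [resampled, mass_eq_sum_ind]
    refine Finset.sum_congr rfl fun y' _ => ?_
    rw [mass_eq_sum_ind]
    simp only [Finset.univ_unique, Finset.sum_singleton, one_mul]
    rfl
  have h4 : ∀ i y, mass (blockChannel V k x) (fun y' => r k (({i}ᶜ : Finset (Fin n)).piecewise y' y))
      (r k y) = letterTest V r x i k (y i) (r k y) := by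
    intro i y
    rw [letterTest]
    congr 1
    ext y'
    congr 1
    ext i'
    by_cases h : i' = i
    · subst h; simp
    · simp [h]
  have h5 : ∀ y : Fin n → Y k, kernelLaw (fun i => V k (column x i)) (fun _ (_ : Unit) => 1)
      (y, ()) = blockChannel V k x y := fun y => mul_one _
  simp only [Fintype.sum_prod_type, Finset.univ_unique, Finset.sum_singleton,
    PUnit.default_eq_unit, h3, h5, h4, Finset.piecewise_univ] at h2
  exact h2

/-- The law of the indices of the relays outside `S` when the inputs of the users in `T` at the
times in `D` are drawn afresh. -/
def mixedPart (pX : Fin n → ∀ l, X l → ℝ) (V : ∀ k, (∀ l, X l) → Y k → ℝ)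
    (r : ∀ k, (Fin n → Y k) → J k) (T : Finset (Fin L)) (S : Finset (Fin K)) (D : Finset (Fin n))
    (x : ∀ l, Fin n → X l) (u : ∀ k, J k) : ℝ :=
  ∑ a : Fin n → ∀ l, X l, (∏ i, ∏ l, pX i l (a i l)) *
    ∏ k ∈ Sᶜ, indexLaw V r k (T.piecewise (fun l => D.piecewise (fun i => a i l) (x l)) x) (u k)

theorem mixedPart_empty (hX : ∀ i l, pX i l ∈ stdSimplex ℝ (X l)) (T : Finset (Fin L))
    (S : Finset (Fin K)) (x : ∀ l, Fin n → X l) (u : ∀ k, J k) :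
    mixedPart pX V r T S ∅ x u = ∏ k ∈ Sᶜ, indexLaw V r k x (u k) := by
  have h : ∀ a : Fin n → ∀ l, X l,
      T.piecewise (fun l => (∅ : Finset (Fin n)).piecewise (fun i => a i l) (x l)) x = x := by
    intro a
    ext l i
    by_cases hl : l ∈ T <;> simp [hl]
  simp_rw [mixedPart, h]
  rw [← Finset.sum_mul, sum_prod_eq_one (fun i (a : ∀ l, X l) => ∏ l, pX i l (a l)) fun i =>
    sum_prod_eq_one (pX i) fun l => (hX i l).2, one_mul]

theorem mixedPart_singleton (hX : ∀ i l, pX i l ∈ stdSimplex ℝ (X l)) (T : Finset (Fin L))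
    (S : Finset (Fin K)) (i : Fin n) (x : ∀ l, Fin n → X l) (u : ∀ k, J k) :
    mixedPart pX V r T S {i} x u = columnPart pX V r T S i x u := by
  have h : ∀ a : Fin n → ∀ l, X l,
      T.piecewise (fun l => ({i} : Finset (Fin n)).piecewise (fun i => a i l) (x l)) x =
        setColumn x i (T.piecewise (a i) (column x i)) := by
    intro a
    ext l i'
    by_cases hl : l ∈ T <;> by_cases hi : i' = i
    · subst hi; simp [hl, setColumn]
    · simp [hl, hi, setColumn]
    · subst hi; simp [hl, setColumn, column]
    · simp [hl, hi, setColumn]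
  simp_rw [mixedPart, h]
  exact sum_prod_mul_eval (fun i (a : ∀ l, X l) => ∏ l, pX i l (a l))
    (fun i => sum_prod_eq_one (pX i) fun l => (hX i l).2) i
    (fun a => ∏ k ∈ Sᶜ, indexLaw V r k (setColumn x i (T.piecewise a (column x i))) (u k))

theorem mixedPart_univ (T : Finset (Fin L)) (S : Finset (Fin K)) (x : ∀ l, Fin n → X l)
    (u : ∀ k, J k) :
    mixedPart pX V r T S Finset.univ x u = ∑ x' : ∀ l, Fin n → X l,
      (∏ l, blockInput pX l (x' l)) * ∏ k ∈ Sᶜ, indexLaw V r k (T.piecewise x' x) (u k) := by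
  simp_rw [mixedPart, Finset.piecewise_univ]
  refine Fintype.sum_equiv (Equiv.piComm fun (_ : Fin n) (l : Fin L) => X l) _ _ fun a => ?_
  congr 1
  exact Finset.prod_comm

/-- Redrawing the inputs of `T` does not change their law. It allows the inputs outside `T` to be
held fixed while those of `T` vary as independent columns over time. -/
theorem blockMean_piecewise (hX : ∀ i l, pX i l ∈ stdSimplex ℝ (X l)) (T : Finset (Fin L))
    (φ : (∀ l, Fin n → X l) → (∀ k, Fin n → Y k) → ℝ) :
    ∑ x : ∀ l, Fin n → X l, (∏ l, blockInput pX l (x l)) * ∑ a : Fin n → ∀ l, X l,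
      (∏ i, ∏ l, pX i l (a i l)) * ∑ y : ∀ k, Fin n → Y k,
        (∏ k, blockChannel V k (T.piecewise (fun l i => a i l) x) (y k)) *
          φ (T.piecewise (fun l i => a i l) x) y = blockMean pX V φ := by
  rw [blockMean_eq]
  have h := sum_prod_piecewise (blockInput pX) T (fun x _ => ∑ y : ∀ k, Fin n → Y k,
    (∏ k, blockChannel V k x (y k)) * φ x y)
  have h1 : ∑ x : ∀ l, Fin n → X l, ∏ l, blockInput pX l (x l) = 1 :=
    sum_prod_eq_one (blockInput pX) fun l => (blockInput_mem hX l).2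
  refine Eq.trans ?_ (h.trans ?_)
  · refine Finset.sum_congr rfl fun x _ => ?_
    rw [Finset.mul_sum]
    refine Fintype.sum_equiv (Equiv.piComm fun (_ : Fin n) (l : Fin L) => X l) _ _ fun a => ?_
    rw [← mul_assoc]
    congr 2
    exact Finset.prod_comm
  · refine Finset.sum_congr rfl fun x _ => ?_
    rw [← Finset.sum_mul, ← Finset.mul_sum, h1, mul_one]

/-- The information the indices carry about the inputs is at most the sum of the informations about
the inputs at the different times given all other inputs. -/
theorem mixedPart_others_le [∀ k, Fintype (J k)] (hX : ∀ i l, pX i l ∈ stdSimplex ℝ (X l))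
    (hV : ∀ k x, V k x ∈ stdSimplex ℝ (Y k)) (T : Finset (Fin L)) (S : Finset (Fin K)) :
    blockMean pX V (fun x y => Real.logb 2 (mixedPart pX V r T S ∅ x fun k => r k (y k))) -
      blockMean pX V (fun x y =>
        Real.logb 2 (mixedPart pX V r T S Finset.univ x fun k => r k (y k))) ≤
    ∑ i, (blockMean pX V (fun x y => Real.logb 2 (mixedPart pX V r T S ∅ x fun k => r k (y k))) -
      blockMean pX V
        (fun x y => Real.logb 2 (mixedPart pX V r T S {i} x fun k => r k (y k)))) := by
  classical
  simp_rw [← blockMean_piecewise (pX := pX) hX T, ← Finset.sum_sub_distrib, ← mul_sub]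
  rw [Finset.sum_comm]
  refine Finset.sum_le_sum fun x _ => ?_
  rw [← Finset.mul_sum]
  refine mul_le_mul_of_nonneg_left ?_ (Finset.prod_nonneg fun l _ => (blockInput_mem hX l).1 _)
  -- With `x` fixed outside `T`, the independent coordinates are the columns `a i`, the kernel is
  -- the channel, and the described variable consists of the indices outside `S`.
  have h := resampled_others_le (w := fun i (a : ∀ l, X l) => ∏ l, pX i l (a l))
    (v := fun a (y : ∀ k, Fin n → Y k) =>
      ∏ k, blockChannel V k (T.piecewise (fun l i => a i l) x) (y k))
    (fun i => ⟨fun a => Finset.prod_nonneg fun l _ => (hX i l).1 _,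
      sum_prod_eq_one (pX i) fun l => (hX i l).2⟩)
    (fun a => channel_mem_pi (fun k x => blockChannel_mem hV k x) _)
    (fun _ y => Sᶜ.restrict fun k => r k (y k))
  have h3 : ∀ (D : Finset (Fin n)) (a : Fin n → ∀ l, X l) (y : ∀ k, Fin n → Y k),
      resampled (fun i (a : ∀ l, X l) => ∏ l, pX i l (a l))
        (fun a (y : ∀ k, Fin n → Y k) =>
          ∏ k, blockChannel V k (T.piecewise (fun l i => a i l) x) (y k))
        (fun _ y => Sᶜ.restrict fun k => r k (y k)) D a (Sᶜ.restrict fun k => r k (y k)) =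
      mixedPart pX V r T S D (T.piecewise (fun l i => a i l) x) fun k => r k (y k) := by
    intro D a y
    rw [resampled, mixedPart]
    refine Finset.sum_congr rfl fun a' _ => ?_
    congr 1
    have h4 : T.piecewise (fun l => D.piecewise (fun i => a' i l)
        (T.piecewise (fun l i => a i l) x l)) (T.piecewise (fun l i => a i l) x) =
        T.piecewise (fun l i => D.piecewise a' a i l) x := by
      ext l i
      by_cases hl : l ∈ T <;> by_cases hi : i ∈ D <;> simp [hl, hi]
    rw [h4]
    exact mass_pi_restrict (fun k => (blockChannel_mem hV k _).2) r Sᶜ fun k => r k (y k)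
  simp_rw [Fintype.sum_prod_type, h3, kernelLaw, mul_assoc, ← Finset.mul_sum] at h
  simp_rw [← Finset.sum_sub_distrib, ← mul_sub] at h ⊢
  exact h

end BlockBound

/-! ## The converse -/

section Converse

variable {L K n : ℕ} {X : Fin L → Type*} {Y : Fin K → Type*}
  [∀ l, Fintype (X l)] [∀ k, Fintype (Y k)]

section

variable {J : Fin K → Type*} {pX : Fin n → ∀ l, X l → ℝ} {V : ∀ k, (∀ l, X l) → Y k → ℝ}
  {r : ∀ k, (Fin n → Y k) → J k}

/-- On the support every index has positive conditional probability, so the logarithm of the product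
splits; elsewhere the weight is zero. -/
theorem inputOutputLaw_mul_logb_prod (hX : ∀ i l, pX i l ∈ stdSimplex ℝ (X l))
    (hV : ∀ k x, V k x ∈ stdSimplex ℝ (Y k)) (D : Finset (Fin K))
    (ω : (∀ l, Fin n → X l) × (∀ k, Fin n → Y k)) :
    inputOutputLaw (blockInput pX) (blockChannel V) ω *
        Real.logb 2 (∏ k ∈ D, indexLaw V r k ω.1 (r k (ω.2 k))) =
      ∑ k ∈ D, inputOutputLaw (blockInput pX) (blockChannel V) ω *
        Real.logb 2 (indexLaw V r k ω.1 (r k (ω.2 k))) := by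
  have h0 : 0 ≤ inputOutputLaw (blockInput pX) (blockChannel V) ω :=
    kernelLaw_nonneg (blockInput_mem hX)
      (fun x => channel_mem_pi (fun k x => blockChannel_mem hV k x) x) ω
  rcases h0.eq_or_lt with h | h
  · simp [← h]
  · have h1 : ∀ k, 0 < blockChannel V k ω.1 (ω.2 k) := by
      intro k
      refine ((blockChannel_mem hV k ω.1).1 _).lt_of_ne fun hk => h.ne' ?_
      rw [inputOutputLaw, kernelLaw, Finset.prod_eq_zero (Finset.mem_univ k) hk.symm, mul_zero]
    rw [Real.logb_prod, Finset.mul_sum]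
    exact fun k _ => (mass_pos (blockChannel_mem hV k ω.1).1 (r k) (h1 k)).ne'

theorem blockMean_logb_mixedPart_empty (hX : ∀ i l, pX i l ∈ stdSimplex ℝ (X l))
    (hV : ∀ k x, V k x ∈ stdSimplex ℝ (Y k)) (T : Finset (Fin L)) (S : Finset (Fin K)) :
    blockMean pX V (fun x y => Real.logb 2 (mixedPart pX V r T S ∅ x fun k => r k (y k))) =
      ∑ k ∈ Sᶜ, blockMean pX V fun x y => Real.logb 2 (indexLaw V r k x (r k (y k))) := by
  simp_rw [mixedPart_empty hX, blockMean]
  rw [Finset.sum_comm]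
  exact Finset.sum_congr rfl fun ω _ => inputOutputLaw_mul_logb_prod hX hV _ ω

theorem condEnt_indices_users (hX : ∀ i l, pX i l ∈ stdSimplex ℝ (X l))
    (hV : ∀ k x, V k x ∈ stdSimplex ℝ (Y k)) (T : Finset (Fin L)) (S : Finset (Fin K)) :
    condEnt (inputOutputLaw (blockInput pX) (blockChannel V))
        (fun ω => Sᶜ.restrict fun k => r k (ω.2 k)) (fun ω => Tᶜ.restrict ω.1) =
      -blockMean pX V fun x y =>
        Real.logb 2 (mixedPart pX V r T S Finset.univ x fun k => r k (y k)) := by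
  refine (condEnt_resampled (blockInput_mem hX)
    (fun x => channel_mem_pi (fun k x => blockChannel_mem hV k x) x)
    (fun _ (y : ∀ k, Fin n → Y k) => Sᶜ.restrict fun k => r k (y k)) T).trans ?_
  rw [blockMean]
  congr 1
  refine Finset.sum_congr rfl fun ω _ => ?_
  congr 2
  rw [mixedPart_univ, resampled]
  refine Finset.sum_congr rfl fun x _ => ?_
  congr 1
  exact mass_pi_restrict (fun k => (blockChannel_mem hV k _).2) r Sᶜ fun k => r k (ω.2 k)

theorem condEnt_indices_inputs (hX : ∀ i l, pX i l ∈ stdSimplex ℝ (X l))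
    (hV : ∀ k x, V k x ∈ stdSimplex ℝ (Y k)) :
    condEnt (inputOutputLaw (blockInput pX) (blockChannel V))
        (fun ω k => r k (ω.2 k)) (fun ω => ω.1) =
      -∑ k, blockMean pX V fun x y => Real.logb 2 (indexLaw V r k x (r k (y k))) := by
  refine (condEnt_kernel (w := fun x : ∀ l, Fin n → X l => ∏ l, blockInput pX l (x l))
    (fun x => Finset.prod_nonneg fun l _ => (blockInput_mem hX l).1 _)
    (fun x => channel_mem_pi (fun k x => blockChannel_mem hV k x) x)
    (fun (y : ∀ k, Fin n → Y k) k => r k (y k))).trans ?_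
  simp_rw [blockMean]
  rw [Finset.sum_comm]
  congr 1
  refine Finset.sum_congr rfl fun ω _ => ?_
  rw [← inputOutputLaw_mul_logb_prod hX hV]
  congr 2
  refine Eq.trans (mass_congr _ fun y => ?_) (mass_pi_restrict
    (fun k => (blockChannel_mem hV k ω.1).2) r Finset.univ fun k => r k (ω.2 k))
  rw [restrict_eq_restrict_iff, funext_iff]
  simp

/-- The multi-letter bound is at most the sum of the single-letter bounds. -/
theorem multiLetter_le [∀ k, Fintype (J k)] (hX : ∀ i l, pX i l ∈ stdSimplex ℝ (X l))
    (hV : ∀ k x, V k x ∈ stdSimplex ℝ (Y k)) (C : Fin K → ℝ) (T : Finset (Fin L))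
    (S : Finset (Fin K)) :
    n * ∑ s ∈ S, C s + (condEnt (inputOutputLaw (blockInput pX) (blockChannel V))
        (fun ω => Sᶜ.restrict fun k => r k (ω.2 k)) (fun ω => Tᶜ.restrict ω.1) -
      condEnt (inputOutputLaw (blockInput pX) (blockChannel V))
        (fun ω k => r k (ω.2 k)) (fun ω => ω.1)) ≤
      ∑ i, ∑ x, (∏ l, blockInput pX l (x l)) * rateFun C V (pX i) (letterTest V r x i) T S := by
  simp_rw [sum_rateFun_letterTest hX hV]
  rw [condEnt_indices_users hX hV, condEnt_indices_inputs hX hV]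
  -- `h1` bounds the information about the inputs of `T` by its single-letter terms; `h2` bounds the
  -- single-letter compression informations by `H(J_s|X^n)`. Splitting the entropy of all indices
  -- over `S` and `Sᶜ` matches the two.
  have h1 := mixedPart_others_le (r := r) hX hV T S
  have h2 := Finset.sum_le_sum fun s (_ : s ∈ S) => sum_letterTest_le (r := r) hX hV s
  simp_rw [blockMean_logb_mixedPart_empty hX hV, mixedPart_singleton hX] at h1
  rw [Finset.sum_comm] at h2
  simp only [Finset.sum_sub_distrib, Finset.sum_add_distrib, Finset.sum_neg_distrib,
    Finset.sum_const, Finset.card_univ, Fintype.card_fin, nsmul_eq_mul] at h1 h2 ⊢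
  have h3 := Finset.sum_add_sum_compl S fun k =>
    blockMean pX V fun x y => Real.logb 2 (indexLaw V r k x (r k (y k)))
  rw [← h3, mul_add]
  linarith

end

/-- The error probability of a code, as an average of one-shot errors. -/
theorem Code.exists_errorProb_eq {W : (∀ l, X l) → (∀ k, Y k) → ℝ} (hCI : CondIndepOutputs W)
    {C : Fin K → ℝ} {R : Fin L → ℝ} (c : Code X Y C n R) :
    ∃ g : (Fin n → Fin c.nQ) → (∀ l, Fin (numIdx n (R l)) → Fin n → X l) →
      (∀ k, Fin (numIdx n (C k))) → ∀ l, Fin (numIdx n (R l)),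
    c.errorProb W = ∑ q : Fin n → Fin c.nQ, (∏ i, c.pQ (q i)) *
      oneShotError (blockInput fun i l => c.pX l (q i)) (blockChannel (marginal W))
        (fun k y => c.relay k y q) (g q) := by
  classical
  -- By bijectivity of the encoder, an index is the same as a codebook; the one-shot decoder
  -- recovers the index first.
  set e := fun l q => Equiv.ofBijective _ (c.enc_bijective l q) with he
  refine ⟨fun q cb j => c.dec (fun l => (e l q).symm (cb l)) j q, ?_⟩
  rw [Code.errorProb]
  refine Finset.sum_congr rfl fun q _ => ?_
  rw [oneShotError, Fintype.sum_prod_type, Finset.mul_sum]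
  refine Fintype.sum_equiv (Equiv.piCongrRight fun l => e l q) _ _ fun f => ?_
  rw [Finset.mul_sum]
  refine Finset.sum_congr rfl fun m _ => ?_
  rw [Finset.mul_sum]
  refine Fintype.sum_equiv (Equiv.piComm fun (_ : Fin n) (k : Fin K) => Y k) _ _ fun y => ?_
  have h1 : ∏ i, W (c.input f m q i) (y i) =
      ∏ k, blockChannel (marginal W) k (fun l => c.enc l (f l) (m l) q) (fun i => y i k) := by
    simp_rw [blockChannel]
    rw [Finset.prod_comm]
    exact Finset.prod_congr rfl fun i _ => hCI _ _
  have h2 : (fun l => (e l q).symm (e l q (f l))) = f := by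
    ext1 l
    exact (e l q).symm_apply_apply (f l)
  rw [h1]
  change _ = _ * ((∏ l, ∏ m', ∏ i, c.pX l (q i) (c.enc l (f l) m' q i)) *
    (∏ l, (numIdx n (R l) : ℝ)⁻¹) *
    (∏ k, blockChannel (marginal W) k (fun l => c.enc l (f l) (m l) q) (fun i => y i k)) *
    ind (c.dec (fun l => (e l q).symm (e l q (f l))) (fun k => c.relay k (fun i => y i k) q) q ≠ m))
  rw [h2, ind_eq_ite]
  simp only [ne_eq, ite_not, mul_assoc]
  rfl

theorem oneShotError_nonneg {A : Fin L → Type*} {B : Fin K → Type*} [∀ l, Fintype (A l)]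
    [∀ k, Fintype (B k)] {M : Fin L → ℕ} {N : Fin K → ℕ} {pX : ∀ l, A l → ℝ}
    {V : ∀ k, (∀ l, A l) → B k → ℝ} (hX : ∀ l, pX l ∈ stdSimplex ℝ (A l))
    (hV : ∀ k x, V k x ∈ stdSimplex ℝ (B k)) (r : ∀ k, B k → Fin (N k))
    (g : (∀ l, Fin (M l) → A l) → (∀ k, Fin (N k)) → ∀ l, Fin (M l)) :
    0 ≤ oneShotError pX V r g :=
  Finset.sum_nonneg fun _ _ => Finset.sum_nonneg fun _ _ => mul_nonneg
    (mul_nonneg (mul_nonneg (Finset.prod_nonneg fun l _ => Finset.prod_nonneg fun i _ =>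
      (hX l).1 _) (Finset.prod_nonneg fun l _ => by positivity))
      (Finset.prod_nonneg fun k _ => (hV k _).1 _)) (ind_nonneg _)

theorem logb_numIdx_le (n : ℕ) {a : ℝ} (ha : 0 ≤ a) : Real.logb 2 (numIdx n a) ≤ n * a := by
  rw [Real.logb_le_iff_le_rpow one_lt_two (by exact_mod_cast numIdx_pos n ha)]
  exact numIdx_le n a

/-- Rounding down loses at most a factor of two, since the number rounded is at least one. -/
theorem le_logb_numIdx (n : ℕ) {a : ℝ} (ha : 0 ≤ a) : n * a - 1 ≤ Real.logb 2 (numIdx n a) := by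
  rw [Real.le_logb_iff_rpow_le one_lt_two (by exact_mod_cast numIdx_pos n ha),
    Real.rpow_sub two_pos, Real.rpow_one]
  exact half_le_numIdx n ha

/-- The rates of a code satisfy the single-letter bounds up to vanishing terms. -/
theorem Code.exists_mem_convexHull {W : (∀ l, X l) → (∀ k, Y k) → ℝ} (hW : IsChannel W)
    (hCI : CondIndepOutputs W) {C : Fin K → ℝ} (hC : ∀ k, 0 ≤ C k) {R : Fin L → ℝ}
    (hR : ∀ l, 0 ≤ R l) (hn : 0 < n) (c : Code X Y C n R) :
    ∃ v ∈ convexHull ℝ (rateSet C (marginal W) (testCard L Y)),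
      ∀ (T : Finset (Fin L)) (S : Finset (Fin K)),
        ∑ t ∈ T, R t ≤ v (T, S) + ((L + 1) / n + c.errorProb W * ∑ l, R l) := by
  classical
  obtain ⟨g, hg⟩ := c.exists_errorProb_eq hCI
  have hV : ∀ k x, marginal W k x ∈ stdSimplex ℝ (Y k) := fun k x => marginal_mem hW k x
  have hX : ∀ (q : Fin n → Fin c.nQ) i l, c.pX l (q i) ∈ stdSimplex ℝ (X l) :=
    fun q i l => c.pX_mem l (q i)
  have hn0 : (0 : ℝ) < n := by exact_mod_cast hn
  have hq0 : ∀ q : Fin n → Fin c.nQ, 0 ≤ ∏ i, c.pQ (q i) := fun q =>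
    Finset.prod_nonneg fun i _ => c.pQ_mem.1 _
  have hq1 : ∑ q : Fin n → Fin c.nQ, ∏ i, c.pQ (q i) = 1 :=
    sum_prod_eq_one (fun _ => c.pQ) fun _ => c.pQ_mem.2
  -- The mixture variable is a uniform time, the time-sharing sequence and the block of inputs, with
  -- their true probabilities; the inputs at the chosen time are carried along but do not affect the
  -- test channels.
  set wt : Fin n × (Fin n → Fin c.nQ) × (∀ l, Fin n → X l) → ℝ := fun z =>
    (n : ℝ)⁻¹ * ((∏ i, c.pQ (z.2.1 i)) *
      ∏ l, blockInput (fun i l => c.pX l (z.2.1 i)) l (z.2.2 l)) with hwt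
  set pt : Fin n × (Fin n → Fin c.nQ) × (∀ l, Fin n → X l) →
      Finset (Fin L) × Finset (Fin K) → ℝ := fun z =>
    rateVec C (marginal W) (fun l => c.pX l (z.2.1 z.1))
      (letterTest (marginal W) (fun k y => c.relay k y z.2.1) z.2.2 z.1) with hpt
  refine ⟨∑ z, wt z • pt z, ?_, fun T S => ?_⟩
  · refine (convex_convexHull ℝ _).sum_mem (fun z _ => ?_) ?_ fun z _ => subset_convexHull ℝ _ ?_
    · exact mul_nonneg (inv_nonneg.2 hn0.le) (mul_nonneg (hq0 _)
        (Finset.prod_nonneg fun l _ => (blockInput_mem (hX z.2.1) l).1 _))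
    · simp_rw [hwt, Fintype.sum_prod_type, ← Finset.mul_sum]
      have h1 : ∀ q : Fin n → Fin c.nQ, ∑ x : ∀ l, Fin n → X l,
          ∏ l, blockInput (fun i l => c.pX l (q i)) l (x l) = 1 := fun q =>
        sum_prod_eq_one _ fun l => (blockInput_mem (hX q) l).2
      simp_rw [h1, mul_one, hq1]
      simp [hn0.ne']
    · exact rateVec_mem_rateSet C (isLaw_letterTest (hX z.2.1) hV z.1 z.2.2)
  · set E : (Fin n → Fin c.nQ) → ℝ := fun q =>
      oneShotError (blockInput fun i l => c.pX l (q i)) (blockChannel (marginal W))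
        (fun k y => c.relay k y q) (g q) with hE
    set F : (Fin n → Fin c.nQ) → ℝ := fun q => ∑ i, ∑ x,
      (∏ l, blockInput (fun i l => c.pX l (q i)) l (x l)) *
        rateFun C (marginal W) (fun l => c.pX l (q i))
          (letterTest (marginal W) (fun k y => c.relay k y q) x i) T S with hF
    have hq : ∀ q, ∑ t ∈ T, R t ≤ (n : ℝ)⁻¹ * F q + (L + 1) / n + E q * ∑ l, R l := by
      intro q
      have h1 := oneShot_converse_subset (blockInput_mem (hX q)) (blockChannel_mem hV)
        (fun l => numIdx_pos n (hR l)) (fun k => numIdx_pos n (hC k)) (fun k y => c.relay k y q)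
        (g q) T S
      have h2 := multiLetter_le (r := fun k y => c.relay k y q) (hX q) hV C T S
      have h3 : ∑ s ∈ S, Real.logb 2 (numIdx n (C s)) ≤ n * ∑ s ∈ S, C s := by
        rw [Finset.mul_sum]
        exact Finset.sum_le_sum fun s _ => logb_numIdx_le n (hC s)
      have h4 : ∑ l, Real.logb 2 (numIdx n (R l)) ≤ n * ∑ l, R l := by
        rw [Finset.mul_sum]
        exact Finset.sum_le_sum fun s _ => logb_numIdx_le n (hR s)
      -- One bit per user is lost by rounding the message sets; with the single bit from Fano's
      -- inequality this gives `(L + 1) / n`.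
      have h5 : n * ∑ t ∈ T, R t - L ≤ ∑ t ∈ T, Real.logb 2 (numIdx n (R t)) := by
        have hcard : (T.card : ℝ) ≤ L := by exact_mod_cast card_finset_fin_le T
        have := Finset.sum_le_sum fun t (_ : t ∈ T) => le_logb_numIdx n (hR t)
        rw [Finset.sum_sub_distrib, ← Finset.mul_sum, Finset.sum_const, nsmul_eq_mul,
          mul_one] at this
        linarith
      have h6 : E q * ∑ l, Real.logb 2 (numIdx n (R l)) ≤ E q * (n * ∑ l, R l) :=
        mul_le_mul_of_nonneg_left h4
          (oneShotError_nonneg (blockInput_mem (hX q)) (blockChannel_mem hV) _ _)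
      have h7 : n * ∑ t ∈ T, R t ≤ F q + (L + 1) + E q * (n * ∑ l, R l) := by
        linarith
      have h8 : (n : ℝ)⁻¹ * F q + (L + 1) / n + E q * ∑ l, R l =
          (F q + (L + 1) + E q * (n * ∑ l, R l)) / n := by
        field_simp
      rw [h8, le_div_iff₀ hn0, mul_comm]
      exact h7
    have hv : (∑ z, wt z • pt z) (T, S) = ∑ q, (∏ i, c.pQ (q i)) * ((n : ℝ)⁻¹ * F q) := by
      rw [Finset.sum_apply, Fintype.sum_prod_type]
      simp_rw [Fintype.sum_prod_type, hF, Finset.mul_sum]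
      rw [Finset.sum_comm]
      refine Finset.sum_congr rfl fun q _ => Finset.sum_congr rfl fun i _ =>
        Finset.sum_congr rfl fun x _ => ?_
      simp only [hwt, hpt, Pi.smul_apply, smul_eq_mul, rateVec]
      ring
    calc ∑ t ∈ T, R t = ∑ q : Fin n → Fin c.nQ, (∏ i, c.pQ (q i)) * ∑ t ∈ T, R t := by
          rw [← Finset.sum_mul, hq1, one_mul]
      _ ≤ ∑ q : Fin n → Fin c.nQ, (∏ i, c.pQ (q i)) *
          ((n : ℝ)⁻¹ * F q + (L + 1) / n + E q * ∑ l, R l) :=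
          Finset.sum_le_sum fun q _ => mul_le_mul_of_nonneg_left (hq q) (hq0 q)
      _ = _ := by
          rw [hv, hg]
          simp_rw [mul_add, Finset.sum_add_distrib, ← mul_assoc, ← Finset.sum_mul, hq1, one_mul]
          rw [add_assoc]

theorem mem_singleLetterRegion {W : (∀ l, X l) → (∀ k, Y k) → ℝ} (hW : IsChannel W)
    (hCI : CondIndepOutputs W) {C : Fin K → ℝ} (hC : ∀ k, 0 ≤ C k) {R : Fin L → ℝ}
    (hR : R ∈ capacityRegion W C) : R ∈ singleLetterRegion W C := by
  have hR0 : (0 : Fin L → ℝ) ≤ R :=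
    closure_minimal (t := Set.Ici 0) (fun R' hR' => hR'.1) isClosed_Ici hR
  refine mem_singleLetterRegion_of_approx hW hR0 fun η hη => ?_
  -- The slack `η` is shared by the approximation of `R`, the rounding term and the error
  -- probability; the added ones keep the denominators positive.
  obtain ⟨R', ⟨hR'0, hR'⟩, hdist⟩ := Metric.mem_closure_iff.1 hR (η / 3 / (L + 1)) (by positivity)
  have hs : 0 ≤ ∑ l, R' l := Finset.sum_nonneg fun l _ => hR'0 l
  obtain ⟨N, hN⟩ := hR' (η / 3 / (∑ l, R' l + 1)) (by positivity)
  obtain ⟨m, hm⟩ := exists_nat_gt ((L + 1) / (η / 3))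
  obtain ⟨c, hc⟩ := hN (max N (m + 1)) (le_max_left _ _)
  obtain ⟨v, hv, hvR⟩ := c.exists_mem_convexHull hW hCI hC hR'0 (by omega)
  refine ⟨v, hv, fun T _ S => ?_⟩
  have h1 : ∑ t ∈ T, R t ≤ ∑ t ∈ T, R' t + η / 3 := by
    have h2 : ∀ t ∈ T, R t ≤ R' t + η / 3 / (L + 1) := fun t _ => by
      have := (dist_le_pi_dist R R' t).trans hdist.le
      rw [Real.dist_eq] at this
      linarith [le_abs_self (R t - R' t)]
    refine (Finset.sum_le_sum h2).trans ?_
    rw [Finset.sum_add_distrib, Finset.sum_const, nsmul_eq_mul]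
    have hcard : (T.card : ℝ) ≤ L + 1 := by
      have : (T.card : ℝ) ≤ L := by exact_mod_cast card_finset_fin_le T
      linarith
    have := mul_le_mul_of_nonneg_right hcard (show 0 ≤ η / 3 / ((L : ℝ) + 1) by positivity)
    rw [mul_div_cancel₀ _ (by positivity : (L : ℝ) + 1 ≠ 0)] at this
    linarith
  have h2 : ((L : ℝ) + 1) / ((max N (m + 1) : ℕ) : ℝ) ≤ η / 3 := by
    have hmm : (m : ℝ) ≤ ((max N (m + 1) : ℕ) : ℝ) := by
      exact_mod_cast (Nat.le_succ m).trans (le_max_right N (m + 1))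
    have hm0 : 0 < (m : ℝ) := lt_trans (by positivity) hm
    rw [div_le_iff₀ (hm0.trans_le hmm)]
    rw [div_lt_iff₀ (by positivity)] at hm
    have := mul_le_mul_of_nonneg_left hmm (show 0 ≤ η / 3 by positivity)
    linarith
  have h3 : c.errorProb W * ∑ l, R' l ≤ η / 3 := by
    refine (mul_le_mul_of_nonneg_right hc hs).trans ?_
    rw [div_mul_eq_mul_div, div_le_iff₀ (by positivity)]
    nlinarith
  have h4 := hvR T S
  linarith

end Converse

end CRAN

end

theorem theorem1 {L K : ℕ} (hL : 1 ≤ L) (hK : 1 ≤ K)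
    {X : Fin L → Type*} [∀ l, Fintype (X l)] {Y : Fin K → Type*} [∀ k, Fintype (Y k)]
    (W : (∀ l, X l) → (∀ k, Y k) → ℝ) (hW : CRAN.IsChannel W) (hCI : CRAN.CondIndepOutputs W)
    (C : Fin K → ℝ) (hC : ∀ k, 0 ≤ C k) :
    CRAN.capacityRegion W C = CRAN.singleLetterRegion W C := by
  exact Set.Subset.antisymm (fun _ h => CRAN.mem_singleLetterRegion hW hCI hC h)
    fun _ h => CRAN.mem_capacityRegion hW hCI hC h
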